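/- Let $\widehat{\mathbb C}$ be the Riemann sphere with the chordal distance. A \emph{piecewise Möbius transformation} (PMT) $F$ with $K$ regions consists of pairwise disjoint non-empty connected open sets $R_1,\dots,R_K\subset\widehat{\mathbb C}$ with $\bigcup_k\overline{R_k}=\widehat{\mathbb C}$, each $\partial R_k$ being a finite union of piecewise smooth simple closed curves, and of $f_1,\dots,f_K\in PSL(2,\mathbb C)$ such that $f_j\ne f_k$ whenever $j\neq k$ and $\overline{R_j}\cap\overline{R_k}$ contains a non-degenerate curve; $F$ equals $f_k$ on $R_k$ and is undefined on $B(F)=\bigcup_k\partial R_k$. Put $R(F)=\bigcup_k R_k$; let $F^{-n}(B(F))$ be the set of points at which $F^n$ is defined and takes a value in $B(F)$, let $\mathcal B(F)=\overline{\bigcup_{n\ge0}F^{-n}(B(F))}$ and $\mathcal R(F)=\widehat{\mathbb C}\setminus\mathcal B(F)$. The connected components of $\mathcal R(F)$ are the \emph{regular components}. A regular component $U$ is \emph{periodic} of period $n\ge1$ if $n$ is least with $F^n(U)\subset U$, and is \emph{wandering} if the regular components containing $F^n(U)$, $n\ge 0$, are pairwise distinct. A point $z$ is periodic of (least) period $n\geq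 1$ if its first $n$ iterates are defined, $F^n(z)=z$, and $n$ is least with this property. Let $\lambda$ be the derivative of $F^n$ at $z$ in a local coordinate. The point is \emph{attracting} if $|\lambda|<1$, and \emph{neutral} if it is elliptic ($|\lambda|=1\ne\lambda$), parabolic ($\lambda=1$ and $F^n$ is not the identity near $z$) or of identity ($F^n$ is the identity near $z$). A point $z_0$ is \emph{ghost-periodic} if $z_0\in F^{-N}(B(F))$ for some $N\ge0$ and there is a periodic regular component $U$, of some period $n$, with $z_0\in\partial U$ and $(F^n)^k(z)\to z_0$ as $k\to\infty$ for all $z\in U$. $F$ is \emph{hyperbolic} if it has at least one attracting periodic point, no neutral periodic point, no ghost-periodic point and no wandering regular component. Two PMTs $F,G$ with $K$ regions are \emph{topologically conjugate} if there is a homeomorphism $h$ of $\widehat{\mathbb C}$ with $h(B(F))=B(G)$ and $h\circ F=G\circ h$ on $R(F)$. $F=((R_k),(f_k))$ is \emph{structurally stable} if there are a neighbourhood $\mathcal N$ of $(f_1,\dots,f_K)$ in $PSL(2,\mathbb C)^K$ and $\varepsilon>0$ such that $F$ is topologically conjugate to every PMT $G=((S_k),(g_k))$ with $K$ regions for which $(g_1,\dots,g_K)\in\mathcal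 N$, $B(G)$ is at Hausdorff distance less than $\varepsilon$ from $B(F)$, and, for each $k$, $\overline{S_k}$ is at Hausdorff distance less than $\varepsilon$ from $\overline{R_k}$. \textbf{Theorem.} Every structurally stable PMT without wandering regular components is hyperbolic. -/

import Mathlib

open Set Filter Topology
open scoped MatrixGroups

noncomputable section

/-- The Riemann sphere. -/
abbrev RSphere : Type := OnePoint ℂ

namespace RSphere

/-- The affine coordinate of the sphere; it is meaningful away from the point at infinity. -/
def coord (z : RSphere) : ℂ := z.elim 0 id

/-- The inversion `z ↦ 1 / z` of the sphere, which exchanges `0` and infinity. -/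
def inversion (z : RSphere) : RSphere :=
  z.elim ((0 : ℂ) : RSphere) (fun a => open Classical in
    if a = 0 then OnePoint.infty else ((a⁻¹ : ℂ) : RSphere))

/-- The chordal distance on the sphere. -/
def chordal (z w : RSphere) : ℝ :=
  z.elim
    (w.elim 0 (fun b => 2 / Real.sqrt (1 + ‖b‖ ^ 2)))
    (fun a => w.elim (2 / Real.sqrt (1 + ‖a‖ ^ 2))
      (fun b => 2 * ‖a - b‖ / (Real.sqrt (1 + ‖a‖ ^ 2) * Real.sqrt (1 + ‖b‖ ^ 2))))

/-- For compact `A`, `B` this says that the Hausdorff distance of `A` and `B`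
(with respect to the chordal distance) is less than `ε`. -/
def HausdorffClose (ε : ℝ) (A B : Set RSphere) : Prop :=
  (∀ a ∈ A, ∃ b ∈ B, chordal a b < ε) ∧ (∀ b ∈ B, ∃ a ∈ A, chordal a b < ε)

/-- The action of `PSL(2, ℂ)` on the sphere by conformal automorphisms, that is, the action on
the projective line transported to `ℂ ∪ {∞}`. -/
def mobius (g : PSL(2, ℂ)) (z : RSphere) : RSphere :=
  open Classical in
  (OnePoint.equivProjectivization ℂ).symm (g • OnePoint.equivProjectivization ℂ z)

/-- On finite points the action is `z ↦ (a z + b) / (c z + d)`. -/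
theorem mobius_mk_coe (A : SL(2, ℂ)) (z : ℂ) :
    mobius (A : PSL(2, ℂ)) (z : RSphere) =
      open Classical in
      if A 1 0 * z + A 1 1 = 0 then OnePoint.infty
      else (((A 0 0 * z + A 0 1) / (A 1 0 * z + A 1 1) : ℂ) : RSphere) := by
  classical
  have h := OnePoint.smul_some_eq_ite (g := (A : GL (Fin 2) ℂ)) (k := z)
  exact h

/-- The complex derivative of a self-map of the sphere at a point that it fixes, computed in
the coordinate `z` at a finite point and in the coordinate `1 / z` at infinity. -/
def multiplier (φ : RSphere → RSphere) (z : RSphere) : ℂ :=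
  z.elim
    (deriv (fun x : ℂ => coord (inversion (φ (inversion (x : RSphere))))) 0)
    (fun a => deriv (fun x : ℂ => coord (φ (x : RSphere))) a)

/-- `γ` is a smooth curve with nowhere vanishing velocity on `[a, b]`, tested in one of the
coordinates `z` and `1 / z` at every parameter. -/
def IsSmoothRegularOn (γ : ℝ → RSphere) (a b : ℝ) : Prop :=
  ∀ t ∈ Icc a b,
    (γ t ≠ OnePoint.infty ∧
      ContDiffWithinAt ℝ ((⊤ : ℕ∞) : WithTop ℕ∞) (fun s => coord (γ s)) (Icc a b) t ∧
      derivWithin (fun s => coord (γ s)) (Icc a b) t ≠ 0) ∨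
    (γ t ≠ ((0 : ℂ) : RSphere) ∧
      ContDiffWithinAt ℝ ((⊤ : ℕ∞) : WithTop ℕ∞)
        (fun s => coord (inversion (γ s))) (Icc a b) t ∧
      derivWithin (fun s => coord (inversion (γ s))) (Icc a b) t ≠ 0)

/-- `C` is a piecewise smooth simple closed curve in the sphere. -/
def IsPiecewiseSmoothSimpleClosedCurve (C : Set RSphere) : Prop :=
  ∃ γ : ℝ → RSphere, ContinuousOn γ (Icc 0 1) ∧ γ 0 = γ 1 ∧ InjOn γ (Ico 0 1) ∧
    γ '' Icc 0 1 = C ∧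
    ∃ (m : ℕ) (t : ℕ → ℝ), t 0 = 0 ∧ t m = 1 ∧
      ∀ i < m, t i < t (i + 1) ∧ IsSmoothRegularOn γ (t i) (t (i + 1))

/-- `A` contains a (non-degenerate) curve. -/
def ContainsArc (A : Set RSphere) : Prop :=
  ∃ γ : ℝ → RSphere, ContinuousOn γ (Icc 0 1) ∧ InjOn γ (Icc 0 1) ∧ γ '' Icc 0 1 ⊆ A

end RSphere

open RSphere

/-- A piecewise Möbius transformation of the sphere with `K` regions: the regions `R k` and, for
each of them, the conformal automorphism `f k` of the sphere that acts on it. -/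
structure PMT (K : ℕ) where
  R : Fin K → Set RSphere
  f : Fin K → PSL(2, ℂ)
  isOpen_R : ∀ k, IsOpen (R k)
  isConnected_R : ∀ k, IsConnected (R k)
  frontier_R : ∀ k, ∃ 𝒞 : Set (Set RSphere), 𝒞.Finite ∧
    (∀ C ∈ 𝒞, IsPiecewiseSmoothSimpleClosedCurve C) ∧ frontier (R k) = ⋃₀ 𝒞
  disjoint_R : ∀ j k, j ≠ k → Disjoint (R j) (R k)
  cover_R : ⋃ k, closure (R k) = univ
  minimal : ∀ j k, j ≠ k → ContainsArc (closure (R j) ∩ closure (R k)) → f j ≠ f k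

namespace PMT

variable {K : ℕ} (F : PMT K)

/-- The region of conformality `R(F)`. -/
def conf : Set RSphere := ⋃ k, F.R k

/-- The discontinuity set `B(F)`. -/
def disc : Set RSphere := ⋃ k, frontier (F.R k)

/-- The map `z ↦ F(z)`, equal to `f k` on `R k`. The transformation is undefined on `B(F)`, where
the value below is a dummy; every notion below only looks at values inside `R(F)`. -/
def map (z : RSphere) : RSphere :=
  open Classical in if h : ∃ k, z ∈ F.R k then mobius (F.f h.choose) z else z

theorem map_of_mem {k : Fin K} {z : RSphere} (hz : z ∈ F.R k) : F.map z = mobius (F.f k) z := by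
  have h : ∃ k, z ∈ F.R k := ⟨k, hz⟩
  have hk : h.choose = k := by
    by_contra hne
    exact Set.disjoint_left.mp (F.disjoint_R _ _ hne) h.choose_spec hz
  rw [map, dif_pos h, hk]

/-- The domain of definition of the iterate `F^n`. -/
def dom (n : ℕ) : Set RSphere := {z | ∀ i < n, F.map^[i] z ∈ F.conf}

/-- The preimage `F^{-n}(B(F))`. -/
def preDisc (n : ℕ) : Set RSphere := {z | z ∈ F.dom n ∧ F.map^[n] z ∈ F.disc}

/-- The pre-discontinuity set, the closure of the union of all `F^{-n}(B(F))`. -/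
def preDiscSet : Set RSphere := closure (⋃ n, F.preDisc n)

/-- The regular set. -/
def regularSet : Set RSphere := F.preDiscSetᶜ

/-- A regular component is a connected component of the regular set. -/
def IsRegularComponent (U : Set RSphere) : Prop :=
  ∃ z ∈ F.regularSet, U = connectedComponentIn F.regularSet z

/-- `U` is a periodic regular component of period `n`. -/
def IsPeriodicComponent (n : ℕ) (U : Set RSphere) : Prop :=
  F.IsRegularComponent U ∧ 0 < n ∧ F.map^[n] '' U ⊆ U ∧
    ∀ m, 0 < m → m < n → ¬ (F.map^[m] '' U ⊆ U)

/-- `U` is a wandering regular component: the regular components that contain the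
images `F^n(U)`, `n ≥ 0`, are pairwise distinct. -/
def IsWanderingComponent (U : Set RSphere) : Prop :=
  F.IsRegularComponent U ∧ ∀ m n, m ≠ n →
    ¬ ∃ V, F.IsRegularComponent V ∧ F.map^[m] '' U ⊆ V ∧ F.map^[n] '' U ⊆ V

def HasNoWanderingComponents : Prop := ∀ U, ¬ F.IsWanderingComponent U

/-- `z` is a periodic point of (least) period `n`; its whole orbit lies in `R(F)`. -/
def IsPeriodicPoint (n : ℕ) (z : RSphere) : Prop :=
  0 < n ∧ z ∈ F.dom n ∧ F.map^[n] z = z ∧ ∀ m, 0 < m → m < n → F.map^[m] z ≠ z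

def perAttr : Set RSphere :=
  {z | ∃ n, F.IsPeriodicPoint n z ∧ ‖multiplier F.map^[n] z‖ < 1}

/-- Elliptic periodic points. -/
def perEll : Set RSphere :=
  {z | ∃ n, F.IsPeriodicPoint n z ∧ ‖multiplier F.map^[n] z‖ = 1 ∧ multiplier F.map^[n] z ≠ 1}

/-- Parabolic periodic points. -/
def perPar : Set RSphere :=
  {z | ∃ n, F.IsPeriodicPoint n z ∧ multiplier F.map^[n] z = 1 ∧ ¬ (∀ᶠ w in 𝓝 z, F.map^[n] w = w)}

/-- Periodic points of identity. -/
def perId : Set RSphere :=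
  {z | ∃ n, F.IsPeriodicPoint n z ∧ ∀ᶠ w in 𝓝 z, F.map^[n] w = w}

/-- Neutral periodic points. -/
def perNeu : Set RSphere := F.perEll ∪ F.perPar ∪ F.perId

/-- Ghost-periodic points. -/
def perGhost : Set RSphere :=
  {z₀ | (∃ N, z₀ ∈ F.preDisc N) ∧ ∃ n U, F.IsPeriodicComponent n U ∧ z₀ ∈ frontier U ∧
    ∀ z ∈ U, Tendsto (fun k : ℕ => (F.map^[n])^[k] z) atTop (𝓝 z₀)}

def IsHyperbolic : Prop :=
  F.perAttr.Nonempty ∧ F.perNeu = ∅ ∧ F.perGhost = ∅ ∧ F.HasNoWanderingComponents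

/-- Topological conjugacy: `h ∘ F = G ∘ h`, including equality of the domains of definition. -/
def IsConj {K : ℕ} (F G : PMT K) : Prop :=
  ∃ h : RSphere ≃ₜ RSphere, h '' F.disc = G.disc ∧ ∀ z ∈ F.conf, h (F.map z) = G.map (h z)

/-- `F` is topologically conjugate to every `G` in a neighbourhood of `F` in the space of
transformations with `K` regions. Neighbourhoods are those of the product of the topology of
`PSL(2, ℂ)^K` and of the Hausdorff metric on the partitions: the discontinuity sets are close,
and so are the closed regions that carry the same label. -/
def IsStructurallyStable : Prop :=
  ∃ 𝒩 ∈ 𝓝 F.f, ∃ ε > 0, ∀ G : PMT K, G.f ∈ 𝒩 →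
    HausdorffClose ε F.disc G.disc →
    (∀ k, HausdorffClose ε (closure (F.R k)) (closure (G.R k))) →
    IsConj F G

end PMT

end

open scoped ContDiff

noncomputable section

open RSphere

namespace RSphere

/-! ### The action of `PSL(2, ℂ)` on the sphere -/

/-! Stability is tested against two kinds of small perturbation: of the branches with the regions
fixed, and of the regions with the branches fixed. All results are conjugate to `F`, hence to each
other.

Branches. `exists_isGeneric` gives a transformation `G` near `F` with the same regions for which
every nonempty composition of branches is loxodromic, fixes no point of the discontinuity set, and
returns no relatively open piece of a region's boundary to that set (`IsGeneric`). Words are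
countable in number and the bad parameters of each are handled by meagre sets, so Baire's theorem
applies. What has to be excluded for `F` is then expressed in a form that homeomorphisms preserve. A
neutral point has two-sided orbits arbitrarily close to it; a loxodromic fixed point has none. A
ghost-periodic point is fixed by an extended composition of branches, and its orbit carries such a
fixed point into the discontinuity set.

Attracting points. If the regular set is nonempty, absence of wandering components gives a set that
some iterate maps into itself. The corresponding set of `G` accumulates at the attracting fixed
point of a loxodromic composition, which genericity keeps off the discontinuity set; it is a genuine
periodic point (`IsGeneric.exists_attracting`). Its counterpart for `F` is not repelling, since
forward orbits stay near it, and not neutral, so it attracts.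

Nonempty regular set. Otherwise preimages of the discontinuity set are dense. A diffeomorphism
supported in a small disc can then push a boundary arc onto a pull-back of another boundary arc
(`exists_transport_hasBoundaryReturn`). The transported transformation has a boundary return, and
conjugacy hands it on to `G`, which has none. -/

theorem mobius_one (z : RSphere) : mobius 1 z = z := by
  simp [mobius]

theorem mobius_mul (g h : PSL(2, ℂ)) (z : RSphere) :
    mobius (g * h) z = mobius g (mobius h z) := by
  simp [mobius, mul_smul]

theorem mobius_inv_apply (g : PSL(2, ℂ)) (z : RSphere) : mobius g⁻¹ (mobius g z) = z := by
  rw [← mobius_mul, inv_mul_cancel, mobius_one]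

theorem mobius_apply_inv (g : PSL(2, ℂ)) (z : RSphere) : mobius g (mobius g⁻¹ z) = z := by
  rw [← mobius_mul, mul_inv_cancel, mobius_one]

theorem mobius_mk_infty (A : SL(2, ℂ)) :
    mobius (A : PSL(2, ℂ)) OnePoint.infty =
      open Classical in
      if A 1 0 = 0 then OnePoint.infty else ((A 0 0 / A 1 0 : ℂ) : RSphere) := by
  classical
  have h := OnePoint.smul_infty_eq_ite (A : GL (Fin 2) ℂ)
  exact h

theorem mobius_mk_coe_of_ne {A : SL(2, ℂ)} {z : ℂ} (h : A 1 0 * z + A 1 1 ≠ 0) :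
    mobius (A : PSL(2, ℂ)) (z : RSphere) =
      (((A 0 0 * z + A 0 1) / (A 1 0 * z + A 1 1) : ℂ) : RSphere) := by
  rw [mobius_mk_coe, if_neg h]

theorem det_eq (A : SL(2, ℂ)) : A 0 0 * A 1 1 - A 0 1 * A 1 0 = 1 := by
  rw [← Matrix.det_fin_two]; exact A.2

/-- The element of the special linear group with the given entries. -/
def mkSL {S : Type*} [CommRing S] (a b c d : S) (h : a * d - b * c = 1) : SL(2, S) :=
  ⟨!![a, b; c, d], by rw [Matrix.det_fin_two_of, h]⟩

@[simp] theorem coe_mkSL {S : Type*} [CommRing S] (a b c d : S)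
    (h : a * d - b * c = 1) : (mkSL a b c d h : Matrix (Fin 2) (Fin 2) S) = !![a, b; c, d] := rfl

theorem continuous_mobius_of_lower_left_eq_zero {A : SL(2, ℂ)} (h : A 1 0 = 0) :
    Continuous (mobius (A : PSL(2, ℂ))) := by
  have hd := det_eq A
  have hd1 : A 1 1 ≠ 0 := by
    intro h1; simp [h, h1] at hd
  have ha : A 0 0 ≠ 0 := by
    intro h1; simp [h, h1] at hd
  have e : mobius (A : PSL(2, ℂ)) = fun z => OnePoint.map
      (fun z : ℂ => (A 0 0 / A 1 1) * z + (A 0 1) / (A 1 1)) z := by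
    funext z
    induction z using OnePoint.rec with
    | infty => rw [mobius_mk_infty, if_pos h]; rfl
    | coe z =>
      rw [mobius_mk_coe_of_ne (by simpa [h] using hd1), OnePoint.map_some]
      congr 1
      rw [h, zero_mul, zero_add]; field_simp
  rw [e]
  let H : ℂ ≃ₜ ℂ := (Homeomorph.mulLeft₀ (A 0 0 / A 1 1) (div_ne_zero ha hd1)).trans
    (Homeomorph.addRight (A 0 1 / A 1 1))
  exact H.onePointCongr.continuous

theorem continuous_mobius_neg_inv :
    Continuous (mobius ((mkSL 0 (-1) 1 0 (by ring) : SL(2, ℂ)) : PSL(2, ℂ))) := by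
  set J : SL(2, ℂ) := mkSL 0 (-1) 1 0 (by ring) with hJ
  have h0 : mobius (J : PSL(2, ℂ)) OnePoint.infty = ((0 : ℂ) : RSphere) := by
    rw [mobius_mk_infty]; simp [hJ]
  have h1 : ∀ z : ℂ, z ≠ 0 → mobius (J : PSL(2, ℂ)) (z : RSphere) = ((-z⁻¹ : ℂ) : RSphere) := by
    intro z hz
    rw [mobius_mk_coe_of_ne (by simpa [hJ] using hz)]
    simp [hJ, mkSL, neg_div]
  have h2 : mobius (J : PSL(2, ℂ)) ((0 : ℂ) : RSphere) = OnePoint.infty := by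
    rw [mobius_mk_coe, if_pos (by simp [hJ])]
  rw [continuous_iff_continuousAt]
  intro z
  induction z using OnePoint.rec with
  | infty =>
    rw [OnePoint.continuousAt_infty', h0, coclosedCompact_eq_cocompact,
      ← Metric.cobounded_eq_cocompact]
    have : Tendsto (fun z : ℂ => ((-z⁻¹ : ℂ) : RSphere)) (Bornology.cobounded ℂ)
        (𝓝 ((0 : ℂ) : RSphere)) := by
      refine (OnePoint.continuous_coe.tendsto _).comp ?_
      simpa using (tendsto_inv₀_cobounded (α := ℂ)).neg
    refine this.congr' ?_
    have : ∀ᶠ z : ℂ in Bornology.cobounded ℂ, z ≠ 0 := by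
      rw [Metric.cobounded_eq_cocompact]
      exact (isCompact_singleton).compl_mem_cocompact
    filter_upwards [this] with z hz
    exact (h1 z hz).symm
  | coe z =>
    rw [OnePoint.continuousAt_coe]
    by_cases hz : z = 0
    · subst hz
      rw [continuousAt_iff_punctured_nhds]
      simp only [Function.comp_apply, h2]
      have : Tendsto (fun z : ℂ => ((-z⁻¹ : ℂ) : RSphere)) (𝓝[≠] 0)
          (𝓝 (OnePoint.infty : RSphere)) := by
        refine OnePoint.tendsto_coe_infty.comp ?_
        rw [coclosedCompact_eq_cocompact, ← Metric.cobounded_eq_cocompact]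
        exact tendsto_neg_cobounded.comp tendsto_inv₀_nhdsNE_zero
      refine this.congr' ?_
      filter_upwards [self_mem_nhdsWithin] with z hz
      exact (h1 z hz).symm
    · have : ContinuousAt (fun z : ℂ => ((-z⁻¹ : ℂ) : RSphere)) z :=
        OnePoint.continuous_coe.continuousAt.comp (continuousAt_inv₀ hz).neg
      refine this.congr ?_
      filter_upwards [isOpen_ne.mem_nhds hz] with w hw
      exact (h1 w hw).symm

/-- Bruhat decomposition: continuity of a general Möbius map reduces to affine maps and `z ↦ -1 /
z`. -/
theorem exists_eq_mul_neg_inv_mul {A : SL(2, ℂ)} (h : A 1 0 ≠ 0) :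
    ∃ U V : SL(2, ℂ), U 1 0 = 0 ∧ V 1 0 = 0 ∧ A = U * (mkSL 0 (-1) 1 0 (by ring) * V) := by
  have hd := det_eq A
  refine ⟨mkSL 1 (A 0 0 / A 1 0) 0 1 (by ring), mkSL (A 1 0) (A 1 1) 0 (A 1 0)⁻¹ (by simp [h]),
    by simp, by simp, ?_⟩
  apply Subtype.ext
  rw [Matrix.SpecialLinearGroup.coe_mul, Matrix.SpecialLinearGroup.coe_mul, coe_mkSL, coe_mkSL,
    coe_mkSL]
  ext i j
  fin_cases i <;> fin_cases j <;> simp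
  · field_simp
  · field_simp
    linear_combination -hd

theorem continuous_mobius (g : PSL(2, ℂ)) : Continuous (mobius g) := by
  obtain ⟨A, rfl⟩ := QuotientGroup.mk_surjective g
  by_cases h : A 1 0 = 0
  · exact continuous_mobius_of_lower_left_eq_zero h
  obtain ⟨U, V, hU, hV, e⟩ := exists_eq_mul_neg_inv_mul h
  have : mobius (A : PSL(2, ℂ)) = mobius (U : PSL(2, ℂ)) ∘
      (mobius ((mkSL 0 (-1) 1 0 (by ring) : SL(2, ℂ)) : PSL(2, ℂ)) ∘ mobius (V : PSL(2, ℂ))) := by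
    funext z
    rw [e, QuotientGroup.mk_mul, QuotientGroup.mk_mul, mobius_mul, mobius_mul]
    rfl
  rw [this]
  exact (continuous_mobius_of_lower_left_eq_zero hU).comp
    (continuous_mobius_neg_inv.comp (continuous_mobius_of_lower_left_eq_zero hV))

/-- A conformal automorphism as a homeomorphism of the sphere. -/
def mobiusHomeo (g : PSL(2, ℂ)) : RSphere ≃ₜ RSphere where
  toFun := mobius g
  invFun := mobius g⁻¹
  left_inv := mobius_inv_apply g
  right_inv := mobius_apply_inv g
  continuous_toFun := continuous_mobius g
  continuous_invFun := continuous_mobius g⁻¹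

@[simp] theorem coe_mobiusHomeo (g : PSL(2, ℂ)) : ⇑(mobiusHomeo g) = mobius g := rfl

theorem mobius_injective (g : PSL(2, ℂ)) : Function.Injective (mobius g) :=
  (mobiusHomeo g).injective

end RSphere

/-! ### Words and itineraries -/

/-- The composition `f (w (n - 1)) ∘ ⋯ ∘ f (w 0)` along the word `w`. -/
def compAlong {K : ℕ} (f : Fin K → PSL(2, ℂ)) (w : ℕ → Fin K) : ℕ → PSL(2, ℂ)
  | 0 => 1
  | n + 1 => f (w n) * compAlong f w n

theorem compAlong_add {K : ℕ} (f : Fin K → PSL(2, ℂ)) (w : ℕ → Fin K) (m n : ℕ) :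
    compAlong f w (m + n) = compAlong f (fun i => w (m + i)) n * compAlong f w m := by
  induction n with
  | zero => simp [compAlong]
  | succ n ih =>
    rw [← add_assoc, compAlong, ih, compAlong, mul_assoc]

theorem compAlong_mul_of_periodic {K : ℕ} (f : Fin K → PSL(2, ℂ)) {w : ℕ → Fin K} {n : ℕ}
    (hw : ∀ i, w (n + i) = w i) (k : ℕ) : compAlong f w (n * k) = compAlong f w n ^ k := by
  induction k with
  | zero => simp [compAlong]
  | succ k ih =>
    rw [mul_add, mul_one, add_comm, compAlong_add, funext hw, ih, pow_succ]

/-- For a word of period `n`, passing to a shifted word conjugates the composition. -/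
theorem compAlong_shift_of_periodic {K : ℕ} (f : Fin K → PSL(2, ℂ)) {w : ℕ → Fin K} {n : ℕ}
    (hw : ∀ i, w (n + i) = w i) (i : ℕ) :
    compAlong f (fun j => w (i + j)) n * compAlong f w i =
      compAlong f w i * compAlong f w n := by
  rw [← compAlong_add, add_comm, compAlong_add, funext hw]

namespace PMT

variable {K : ℕ} (F : PMT K)

theorem isClosed_disc : IsClosed F.disc :=
  isClosed_iUnion_of_finite fun _ => isClosed_frontier

theorem isOpen_conf : IsOpen F.conf := isOpen_iUnion F.isOpen_R

theorem disjoint_closure_R {j k : Fin K} (h : j ≠ k) : Disjoint (closure (F.R j)) (F.R k) :=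
  (F.disjoint_R j k h).closure_left (F.isOpen_R k)

/-- Openness keeps each region away from the closures of the others, and these closures cover the
sphere. Hence a homeomorphism matching discontinuity sets also matches domains of definition. -/
theorem conf_eq_compl_disc : F.conf = F.discᶜ := by
  ext z
  constructor
  · intro hz hd
    obtain ⟨k, hk⟩ := mem_iUnion.1 hz
    obtain ⟨j, hj⟩ := mem_iUnion.1 hd
    by_cases h : j = k
    · subst h
      rw [(F.isOpen_R j).frontier_eq] at hj
      exact hj.2 hk
    · exact Set.disjoint_left.1 (F.disjoint_closure_R h) hj.1 hk
  · intro hz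
    obtain ⟨k, hk⟩ := mem_iUnion.1 (F.cover_R ▸ mem_univ z : z ∈ ⋃ k, closure (F.R k))
    by_contra h
    refine hz (mem_iUnion.2 ⟨k, ?_⟩)
    rw [(F.isOpen_R k).frontier_eq]
    exact ⟨hk, fun h' => h (mem_iUnion.2 ⟨k, h'⟩)⟩

theorem mem_R_of_mem_closure {k : Fin K} {z : RSphere} (hz : z ∈ closure (F.R k))
    (hd : z ∉ F.disc) : z ∈ F.R k := by
  by_contra h
  refine hd (mem_iUnion.2 ⟨k, ?_⟩)
  rw [(F.isOpen_R k).frontier_eq]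
  exact ⟨hz, h⟩

/-- Every point is a limit of points of some region. This thinness is what later lets generic
parameters avoid the discontinuity set. -/
theorem interior_disc : interior F.disc = ∅ := by
  rw [Set.eq_empty_iff_forall_notMem]
  intro z hz
  obtain ⟨k, hk⟩ := mem_iUnion.1 (F.cover_R ▸ mem_univ z : z ∈ ⋃ k, closure (F.R k))
  obtain ⟨y, hy, hy'⟩ := mem_closure_iff.1 hk _ isOpen_interior hz
  have : y ∈ F.conf := mem_iUnion.2 ⟨k, hy'⟩
  rw [conf_eq_compl_disc] at this
  exact this (interior_subset hy)

theorem eq_of_mem_R {j k : Fin K} {z : RSphere} (hj : z ∈ F.R j) (hk : z ∈ F.R k) : j = k := by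
  by_contra h
  exact Set.disjoint_left.1 (F.disjoint_R j k h) hj hk

theorem nonempty_fin (F : PMT K) : Nonempty (Fin K) := by
  obtain ⟨k, -⟩ := mem_iUnion.1
    (F.cover_R ▸ mem_univ OnePoint.infty : OnePoint.infty ∈ ⋃ k, closure (F.R k))
  exact ⟨k⟩

/-- The first `n` points of the orbit of `z` under the extended branches along `w` stay in the
closed regions prescribed by `w`. -/
def Follows (w : ℕ → Fin K) (n : ℕ) (z : RSphere) : Prop :=
  ∀ i < n, mobius (compAlong F.f w i) z ∈ closure (F.R (w i))

/-- The first `n` points of the orbit of `z` lie in the regions prescribed by `w`. -/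
def Itinerary (w : ℕ → Fin K) (n : ℕ) (z : RSphere) : Prop :=
  ∀ i < n, mobius (compAlong F.f w i) z ∈ F.R (w i)

variable {F}

theorem Itinerary.map_iterate {w : ℕ → Fin K} {n : ℕ} {z : RSphere} (h : F.Itinerary w n z)
    {i : ℕ} (hi : i ≤ n) : F.map^[i] z = mobius (compAlong F.f w i) z := by
  induction i with
  | zero => simp [compAlong, mobius_one]
  | succ i ih =>
    rw [Function.iterate_succ_apply', ih (by omega), F.map_of_mem (h i (by omega)), compAlong,
      mobius_mul]

theorem Itinerary.mem_dom {w : ℕ → Fin K} {n : ℕ} {z : RSphere} (h : F.Itinerary w n z) :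
    z ∈ F.dom n := by
  intro i hi
  rw [h.map_iterate hi.le]
  exact mem_iUnion.2 ⟨_, h i hi⟩

theorem Itinerary.follows {w : ℕ → Fin K} {n : ℕ} {z : RSphere} (h : F.Itinerary w n z) :
    F.Follows w n z := fun i hi => subset_closure (h i hi)

theorem itinerary_of_iterate_mem {w : ℕ → Fin K} {n : ℕ} {z : RSphere}
    (h : ∀ i < n, F.map^[i] z ∈ F.R (w i)) : F.Itinerary w n z := by
  induction n with
  | zero => intro i hi; omega
  | succ n ih =>
    have h' := ih fun i hi => h i (by omega)
    intro i hi
    rw [← h'.map_iterate (by omega)]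
    exact h i hi

theorem exists_itinerary {n : ℕ} {z : RSphere} (h : z ∈ F.dom n) : ∃ w, F.Itinerary w n z := by
  have : ∀ i, ∃ k, i < n → F.map^[i] z ∈ F.R k := by
    intro i
    by_cases hi : i < n
    · obtain ⟨k, hk⟩ := mem_iUnion.1 (h i hi)
      exact ⟨k, fun _ => hk⟩
    · exact ⟨F.nonempty_fin.some, fun h => absurd h hi⟩
  choose w hw using this
  exact ⟨w, itinerary_of_iterate_mem hw⟩

theorem isOpen_setOf_itinerary (w : ℕ → Fin K) (n : ℕ) : IsOpen {z | F.Itinerary w n z} := by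
  have : {z | F.Itinerary w n z} =
      ⋂ i ∈ Finset.range n, mobius (compAlong F.f w i) ⁻¹' F.R (w i) := by
    ext z; simp [Itinerary]
  rw [this]
  exact isOpen_biInter_finset fun i _ => (F.isOpen_R _).preimage (continuous_mobius _)

theorem Itinerary.eventually {w : ℕ → Fin K} {n : ℕ} {z : RSphere} (h : F.Itinerary w n z) :
    ∀ᶠ x in 𝓝 z, F.Itinerary w n x :=
  (isOpen_setOf_itinerary w n).mem_nhds h

theorem Itinerary.eventuallyEq {w : ℕ → Fin K} {n : ℕ} {z : RSphere} (h : F.Itinerary w n z) :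
    F.map^[n] =ᶠ[𝓝 z] mobius (compAlong F.f w n) := by
  filter_upwards [h.eventually] with x hx
  exact hx.map_iterate le_rfl

/-! ### Topological conjugacy -/

theorem IsConj.symm {F G : PMT K} (h : IsConj F G) : IsConj G F := by
  obtain ⟨h, hd, hc⟩ := h
  refine ⟨h.symm, ?_, ?_⟩
  · rw [← hd, ← image_comp]; simp
  · intro z hz
    have : h.symm z ∈ F.conf := by
      rw [conf_eq_compl_disc] at hz ⊢
      intro h'
      apply hz
      rw [← hd]
      exact ⟨_, h', h.apply_symm_apply z⟩
    rw [Homeomorph.symm_apply_eq, hc _ this, h.apply_symm_apply]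

/-- The homeomorphism `h` conjugates `F` to `G` and maps the region `k` to the region `σ k`. -/
structure IsConjBy (F G : PMT K) (h : RSphere ≃ₜ RSphere) (σ : Fin K → Fin K) : Prop where
  image_disc : h '' F.disc = G.disc
  image_R : ∀ k, h '' F.R k = G.R (σ k)
  map_conf : ∀ z ∈ F.conf, h (F.map z) = G.map (h z)

/-- Disjoint open regions cannot share a connected set. This gives regular components an itinerary
and conjugacies an action on labels. -/
theorem exists_subset_R {U : Set RSphere} (hU : IsConnected U) (hsub : U ⊆ F.conf) :
    ∃ j, U ⊆ F.R j := by
  obtain ⟨z, hz⟩ := hU.nonempty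
  obtain ⟨j, hj⟩ := mem_iUnion.1 (hsub hz)
  refine ⟨j, hU.isPreconnected.subset_left_of_subset_union (F.isOpen_R j)
    (v := ⋃ (i) (_ : i ≠ j), F.R i) (isOpen_biUnion fun i _ => F.isOpen_R i) ?_ ?_ ⟨z, hz, hj⟩⟩
  · simp only [disjoint_iUnion_right]
    exact fun i hi => F.disjoint_R _ _ hi.symm
  · intro y hy
    obtain ⟨i, hi⟩ := mem_iUnion.1 (hsub hy)
    by_cases h : i = j
    · exact Or.inl (h ▸ hi)
    · exact Or.inr (mem_biUnion (x := i) h hi)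

theorem exists_image_R_subset {F G : PMT K} {h : RSphere ≃ₜ RSphere}
    (hd : h '' F.disc = G.disc) (k : Fin K) : ∃ j, h '' F.R k ⊆ G.R j := by
  refine exists_subset_R ((F.isConnected_R k).image _ h.continuous.continuousOn) ?_
  rw [conf_eq_compl_disc, ← hd, ← Set.image_compl_eq h.bijective, ← conf_eq_compl_disc]
  exact image_mono (subset_iUnion _ k)

/-- A conjugacy need not respect labels. The inverse homeomorphism induces a map `τ` of labels with
`τ (σ k) = k`, which turns the inclusions of images into equalities. -/
theorem IsConj.exists_isConjBy {F G : PMT K} (h : IsConj F G) : ∃ h σ, IsConjBy F G h σ := by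
  obtain ⟨h, hd, hc⟩ := h
  have hd' : h.symm '' G.disc = F.disc := by rw [← hd, ← image_comp]; simp
  choose σ hσ using exists_image_R_subset hd
  choose τ hτ using exists_image_R_subset hd'
  refine ⟨h, σ, hd, fun k => (hσ k).antisymm ?_, hc⟩
  have h1 : τ (σ k) = k := by
    obtain ⟨z, hz⟩ := (F.isConnected_R k).nonempty
    refine F.eq_of_mem_R (z := z) ?_ hz
    have := hτ (σ k) (mem_image_of_mem h.symm (hσ k (mem_image_of_mem h hz)))
    simpa using this
  intro y hy
  refine ⟨h.symm y, ?_, h.apply_symm_apply y⟩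
  have := hτ (σ k) (mem_image_of_mem h.symm hy)
  rwa [h1] at this

namespace IsConjBy

variable {F G : PMT K} {h : RSphere ≃ₜ RSphere} {σ : Fin K → Fin K}

theorem mem_closure (H : IsConjBy F G h σ) {k : Fin K} {z : RSphere} (hz : z ∈ closure (F.R k)) :
    h z ∈ closure (G.R (σ k)) := by
  rw [← H.image_R, ← h.image_closure]
  exact mem_image_of_mem h hz

/-- Each branch is continuous on the whole sphere, so the conjugacy relation passes from a region to
its closure. This makes statements about extended orbits through the discontinuity set invariant. -/
theorem mobius_apply (H : IsConjBy F G h σ) {k : Fin K} {z : RSphere} (hz : z ∈ closure (F.R k)) :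
    h (mobius (F.f k) z) = mobius (G.f (σ k)) (h z) := by
  have h1 : IsClosed {z | h (mobius (F.f k) z) = mobius (G.f (σ k)) (h z)} :=
    isClosed_eq (h.continuous.comp (continuous_mobius _)) ((continuous_mobius _).comp h.continuous)
  refine closure_minimal (fun x hx => ?_) h1 hz
  have hx' : h x ∈ G.R (σ k) := by rw [← H.image_R]; exact mem_image_of_mem h hx
  have := H.map_conf x (mem_iUnion.2 ⟨k, hx⟩)
  rwa [F.map_of_mem hx, G.map_of_mem hx'] at this

theorem compAlong_apply (H : IsConjBy F G h σ) {w : ℕ → Fin K} {n : ℕ} {z : RSphere} (hz : F.Follows w n z) {i : ℕ}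
    (hi : i ≤ n) :
    h (mobius (compAlong F.f w i) z) = mobius (compAlong G.f (σ ∘ w) i) (h z) := by
  induction i with
  | zero => simp [compAlong, mobius_one]
  | succ i ih =>
    rw [compAlong, compAlong, mobius_mul, mobius_mul, H.mobius_apply (hz i (by omega)),
      ih (by omega)]
    rfl

theorem follows (H : IsConjBy F G h σ) {w : ℕ → Fin K} {n : ℕ} {z : RSphere} (hz : F.Follows w n z) :
    G.Follows (σ ∘ w) n (h z) := by
  intro i hi
  rw [← H.compAlong_apply hz hi.le]
  exact H.mem_closure (hz i hi)

theorem mem_disc_iff (H : IsConjBy F G h σ) {z : RSphere} : h z ∈ G.disc ↔ z ∈ F.disc := by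
  rw [← H.image_disc, h.injective.mem_set_image]

theorem mem_conf_iff (H : IsConjBy F G h σ) {z : RSphere} : h z ∈ G.conf ↔ z ∈ F.conf := by
  rw [conf_eq_compl_disc, conf_eq_compl_disc, mem_compl_iff, mem_compl_iff, H.mem_disc_iff]

theorem map_iterate (H : IsConjBy F G h σ) {n : ℕ} {z : RSphere} (hz : z ∈ F.dom n) {i : ℕ} (hi : i ≤ n) :
    h (F.map^[i] z) = G.map^[i] (h z) := by
  induction i with
  | zero => rfl
  | succ i ih =>
    rw [Function.iterate_succ_apply', Function.iterate_succ_apply', ← ih (by omega),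
      H.map_conf _ (hz i (by omega))]

theorem mem_dom (H : IsConjBy F G h σ) {n : ℕ} {z : RSphere} (hz : z ∈ F.dom n) : h z ∈ G.dom n := by
  intro i hi
  rw [← H.map_iterate hz hi.le, H.mem_conf_iff]
  exact hz i hi

theorem isPeriodicPoint (H : IsConjBy F G h σ) {n : ℕ} {z : RSphere} (hz : F.IsPeriodicPoint n z) :
    G.IsPeriodicPoint n (h z) := by
  obtain ⟨h0, h1, h2, h3⟩ := hz
  refine ⟨h0, H.mem_dom h1, ?_, fun m hm hmn => ?_⟩
  · rw [← H.map_iterate h1 le_rfl, h2]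
  · rw [← H.map_iterate h1 hmn.le]
    exact fun h' => h3 m hm hmn (h.injective h')

end IsConjBy

end PMT

namespace RSphere

/-! ### Local dynamics at a fixed point of a conformal automorphism -/

/-- Arbitrarily close to `z`, but avoiding `z`, there are orbits of `φ` indexed by `ι`. -/
def HasLocalOrbits (ι : Type) [Add ι] [One ι] (φ : RSphere → RSphere) (z : RSphere) : Prop :=
  ∀ V ∈ 𝓝 z, ∃ u : ι → RSphere, ∀ j, u j ∈ V ∧ u j ≠ z ∧ φ (u j) = u (j + 1)

/-- Multipliers are not topological invariants, but local orbits are. At a fixed point of a Möbius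
map, orbits over `ℤ` exist exactly when the multiplier has modulus one, and orbits over `ℕ` exactly
when it has modulus at most one. -/
theorem HasLocalOrbits.conj {ι : Type} [Add ι] [One ι] {φ ψ : RSphere → RSphere} {z : RSphere}
    (H : HasLocalOrbits ι φ z) (h : RSphere ≃ₜ RSphere)
    (hc : ∀ᶠ x in 𝓝 z, h (φ x) = ψ (h x)) : HasLocalOrbits ι ψ (h z) := by
  intro V hV
  obtain ⟨u, hu⟩ := H _ (inter_mem (h.continuous.continuousAt hV) hc)
  refine ⟨fun j => h (u j), fun j => ⟨(hu j).1.1, fun h' => (hu j).2.1 (h.injective h'), ?_⟩⟩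
  change ψ (h (u j)) = h (u (j + 1))
  rw [← (hu j).2.2]
  exact (hu j).1.2.symm

theorem HasLocalOrbits.congr {ι : Type} [Add ι] [One ι] {φ ψ : RSphere → RSphere} {z : RSphere}
    (H : HasLocalOrbits ι φ z) (hc : φ =ᶠ[𝓝 z] ψ) : HasLocalOrbits ι ψ z :=
  H.conj (Homeomorph.refl _) hc

theorem HasLocalOrbits.nat_of_int {φ : RSphere → RSphere} {z : RSphere}
    (H : HasLocalOrbits ℤ φ z) : HasLocalOrbits ℕ φ z := by
  intro V hV
  obtain ⟨u, hu⟩ := H V hV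
  exact ⟨fun j => u j, fun j => by simpa using hu j⟩

theorem eventually_coe_mem_of_mem_nhds_infty {V : Set RSphere}
    (hV : V ∈ 𝓝 (OnePoint.infty : RSphere)) : ∃ M : ℝ, ∀ x : ℂ, M ≤ ‖x‖ → (x : RSphere) ∈ V := by
  have : ∀ᶠ x : ℂ in Bornology.cobounded ℂ, (x : RSphere) ∈ V := by
    rw [Metric.cobounded_eq_cocompact, ← coclosedCompact_eq_cocompact]
    exact OnePoint.tendsto_coe_infty hV
  rw [← comap_norm_atTop, Filter.eventually_comap] at this
  obtain ⟨M, hM⟩ := Filter.eventually_atTop.1 this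
  exact ⟨M, fun x hx => hM _ hx x rfl⟩

theorem setOf_norm_le_mem_nhds_infty (M : ℝ) :
    ((↑) '' Metric.closedBall (0 : ℂ) M : Set RSphere)ᶜ ∈ 𝓝 (OnePoint.infty : RSphere) := by
  refine IsOpen.mem_nhds ?_ (by simp)
  exact OnePoint.isOpen_compl_image_coe.2
    ⟨Metric.isClosed_closedBall, isCompact_closedBall _ _⟩

/-- The map `g` fixes `z`, and in a coordinate that sends `z` to infinity it reads
`x ↦ μ * x + b`. -/
def IsAffineAt (g : RSphere → RSphere) (z : RSphere) (μ b : ℂ) : Prop :=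
  ∃ P : RSphere ≃ₜ RSphere, P z = OnePoint.infty ∧ g z = z ∧
    ∀ x : ℂ, P (g (P.symm x)) = ((μ * x + b : ℂ) : RSphere)

theorem hasLocalOrbits_of_sequence {ι : Type} [Add ι] [One ι] {g : RSphere → RSphere}
    {z : RSphere} {μ b : ℂ} (hg : IsAffineAt g z μ b)
    (H : ∀ M : ℝ, ∃ x : ι → ℂ, ∀ j, M ≤ ‖x j‖ ∧ μ * x j + b = x (j + 1)) :
    HasLocalOrbits ι g z := by
  obtain ⟨P, hz, -, hP⟩ := hg
  intro V hV
  have hV' : P.symm ⁻¹' V ∈ 𝓝 (OnePoint.infty : RSphere) := by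
    refine P.symm.continuous.continuousAt ?_
    rwa [← hz, P.symm_apply_apply]
  obtain ⟨M, hM⟩ := eventually_coe_mem_of_mem_nhds_infty hV'
  obtain ⟨x, hx⟩ := H M
  refine ⟨fun j => P.symm (x j), fun j => ⟨hM _ (hx j).1, fun h => ?_, ?_⟩⟩
  · rw [Homeomorph.symm_apply_eq, hz] at h
    exact OnePoint.coe_ne_infty _ h
  · change g (P.symm (x j)) = P.symm (x (j + 1))
    rw [← (hx j).2, ← hP, P.symm_apply_apply]

/-- For `μ ≠ 1` the affine map is multiplication by `μ` about its finite fixed point. -/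
theorem sub_center_mul {μ b x : ℂ} (hμ : μ ≠ 1) :
    μ * x + b = b / (1 - μ) + μ * (x - b / (1 - μ)) := by
  have : 1 - μ ≠ 0 := sub_ne_zero.2 hμ.symm
  field_simp; ring

theorem IsAffineAt.hasLocalOrbits_int {g : RSphere → RSphere}
    {z : RSphere} {μ b : ℂ} (hg : IsAffineAt g z μ b) (hμ : ‖μ‖ = 1) :
    HasLocalOrbits ℤ g z := by
  refine hasLocalOrbits_of_sequence hg fun M => ?_
  have hμ0 : μ ≠ 0 := by rintro rfl; simp at hμ
  by_cases h1 : μ = 1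
  · subst h1
    by_cases hb : b = 0
    · subst hb
      exact ⟨fun _ => (M : ℂ), fun j => ⟨by simpa using le_abs_self M, by ring⟩⟩
    -- Parabolic case: the points lie on a line parallel to `b` at distance `|M|` from the origin,
    -- so the whole two-sided orbit of the translation stays far out.
    · refine ⟨fun j => b * (Complex.I * (M / ‖b‖ : ℝ) + (j : ℝ)), fun j => ⟨?_, ?_⟩⟩
      · have hb' : 0 < ‖b‖ := norm_pos_iff.2 hb
        have h2 : |M / ‖b‖| ≤ ‖Complex.I * (M / ‖b‖ : ℝ) + ((j : ℝ) : ℂ)‖ := by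
          refine le_trans (le_of_eq ?_) (Complex.abs_im_le_norm _)
          simp
        rw [norm_mul]
        calc M = ‖b‖ * (M / ‖b‖) := by field_simp
          _ ≤ ‖b‖ * |M / ‖b‖| := by gcongr; exact le_abs_self _
          _ ≤ _ := by gcongr
      · push_cast; ring
  · set p := b / (1 - μ) with hp
    -- Rotation about `p`: the radius `|M| + ‖p‖` keeps the circle at distance at least `M` from the
    -- origin.
    refine ⟨fun j => p + μ ^ j * ((|M| + ‖p‖ : ℝ) : ℂ), fun j => ⟨?_, ?_⟩⟩
    · have h2 : ‖μ ^ j * ((|M| + ‖p‖ : ℝ) : ℂ)‖ = |M| + ‖p‖ := by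
        rw [norm_mul, norm_zpow, hμ, one_zpow, one_mul, Complex.norm_real, Real.norm_eq_abs,
          abs_of_nonneg (by positivity)]
      have h3 := norm_sub_le (p + μ ^ j * ((|M| + ‖p‖ : ℝ) : ℂ)) p
      rw [add_sub_cancel_left, h2] at h3
      linarith [le_abs_self M]
    · beta_reduce
      rw [sub_center_mul h1, zpow_add_one₀ hμ0, ← hp]; ring

theorem IsAffineAt.hasLocalOrbits_nat {g : RSphere → RSphere}
    {z : RSphere} {μ b : ℂ} (hg : IsAffineAt g z μ b) (hμ : 1 < ‖μ‖) :
    HasLocalOrbits ℕ g z := by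
  refine hasLocalOrbits_of_sequence hg fun M => ?_
  have h1 : μ ≠ 1 := by rintro rfl; simp at hμ
  set p := b / (1 - μ) with hp
  refine ⟨fun j => p + μ ^ j * ((|M| + ‖p‖ : ℝ) : ℂ), fun j => ⟨?_, ?_⟩⟩
  · have h2 : |M| + ‖p‖ ≤ ‖μ ^ j * ((|M| + ‖p‖ : ℝ) : ℂ)‖ := by
      rw [norm_mul, norm_pow, Complex.norm_real, Real.norm_eq_abs,
        abs_of_nonneg (by positivity : 0 ≤ |M| + ‖p‖)]
      exact le_mul_of_one_le_left (by positivity) (one_le_pow₀ hμ.le)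
    have h3 := norm_sub_le (p + μ ^ j * ((|M| + ‖p‖ : ℝ) : ℂ)) p
    rw [add_sub_cancel_left] at h3
    linarith [le_abs_self M]
  · beta_reduce
    rw [sub_center_mul h1, pow_succ, ← hp]; ring

/-- An orbit close to `z` in the coordinate that sends `z` to infinity. -/
theorem IsAffineAt.exists_coordinate {ι : Type} [Add ι] [One ι] {g : RSphere → RSphere}
    {z : RSphere} {μ b : ℂ} (hg : IsAffineAt g z μ b) (H : HasLocalOrbits ι g z) (M : ℝ) :
    ∃ x : ι → ℂ, ∀ j, M < ‖x j‖ ∧ μ * x j + b = x (j + 1) := by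
  obtain ⟨P, hz, -, hP⟩ := hg
  obtain ⟨u, hu⟩ := H (P ⁻¹' ((↑) '' Metric.closedBall (0 : ℂ) M : Set RSphere)ᶜ)
    (P.continuous.continuousAt (by rw [hz]; exact setOf_norm_le_mem_nhds_infty M))
  have : ∀ j, ∃ x : ℂ, (x : RSphere) = P (u j) := by
    intro j
    rw [← OnePoint.ne_infty_iff_exists, ← hz]
    exact fun h => (hu j).2.1 (P.injective h)
  choose x hx using this
  refine ⟨x, fun j => ⟨?_, ?_⟩⟩
  · by_contra h
    exact (hu j).1 ⟨x j, by simpa using h, hx j⟩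
  · apply OnePoint.coe_injective
    rw [hx, ← (hu j).2.2, ← hP, hx, P.symm_apply_apply]

/-- If `‖μ‖ < 1`, every orbit tends to the finite fixed point `p`, whereas an orbit close enough to
`z` stays beyond radius `‖p‖ + 1`. -/
theorem IsAffineAt.one_le_norm {g : RSphere → RSphere}
    {z : RSphere} {μ b : ℂ} (hg : IsAffineAt g z μ b) (H : HasLocalOrbits ℕ g z) : 1 ≤ ‖μ‖ := by
  by_contra! hμ
  have h1 : μ ≠ 1 := by rintro rfl; simp at hμ
  set p := b / (1 - μ) with hp
  obtain ⟨x, hx⟩ := hg.exists_coordinate H (‖p‖ + 1)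
  have h2 : ∀ j : ℕ, x j = p + μ ^ j * (x 0 - p) := by
    intro j
    induction j with
    | zero => simp
    | succ j ih => rw [← (hx j).2, sub_center_mul h1, ← hp, ih, pow_succ]; ring
  have h3 : Tendsto (fun j : ℕ => p + μ ^ j * (x 0 - p)) atTop (𝓝 (p + 0 * (x 0 - p))) :=
    ((tendsto_pow_atTop_nhds_zero_of_norm_lt_one hμ).mul_const _).const_add _
  have h5 : Tendsto (fun j : ℕ => ‖x j‖) atTop (𝓝 ‖p‖) := by
    rw [zero_mul, add_zero] at h3
    exact h3.norm.congr fun j => by rw [← h2]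
  have := ge_of_tendsto' h5 fun j => (hx j).1.le
  linarith

/-- If `‖μ‖ > 1`, backward orbits tend to `p`, so the previous argument applies in reversed time. -/
theorem IsAffineAt.norm_eq_one {g : RSphere → RSphere}
    {z : RSphere} {μ b : ℂ} (hg : IsAffineAt g z μ b) (H : HasLocalOrbits ℤ g z) : ‖μ‖ = 1 := by
  refine le_antisymm ?_ (hg.one_le_norm H.nat_of_int)
  by_contra! hμ
  have h1 : μ ≠ 1 := by rintro rfl; simp at hμ
  have h0 : μ ≠ 0 := by rintro rfl; simp at hμ; linarith
  set p := b / (1 - μ) with hp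
  obtain ⟨x, hx⟩ := hg.exists_coordinate H (‖p‖ + 1)
  have h2 : ∀ j : ℕ, x (-j) = p + μ⁻¹ ^ j * (x 0 - p) := by
    intro j
    induction j with
    | zero => simp
    | succ j ih =>
      have h3 := (hx (-(j + 1 : ℕ) : ℤ)).2
      rw [show (-(j + 1 : ℕ) : ℤ) + 1 = -j by push_cast; ring, sub_center_mul h1, ← hp, ih] at h3
      have h4 := add_left_cancel h3
      rw [pow_succ', mul_assoc, ← h4, inv_mul_cancel_left₀ h0]
      ring
  have h3 : Tendsto (fun j : ℕ => p + μ⁻¹ ^ j * (x 0 - p)) atTop (𝓝 (p + 0 * (x 0 - p))) :=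
    ((tendsto_pow_atTop_nhds_zero_of_norm_lt_one
      (by rw [norm_inv]; exact inv_lt_one_of_one_lt₀ hμ)).mul_const _).const_add _
  have h5 : Tendsto (fun j : ℕ => ‖x (-j)‖) atTop (𝓝 ‖p‖) := by
    rw [zero_mul, add_zero] at h3
    exact h3.norm.congr fun j => by rw [← h2]
  have := ge_of_tendsto' h5 fun j => (hx (-j)).1.le
  linarith

/-- The exceptional point is the other fixed point `p`; the distance to `p` of every other finite
point grows geometrically, and infinity stands for `z`. -/
theorem IsAffineAt.tendsto_iterate {g : RSphere → RSphere}
    {z : RSphere} {μ b : ℂ} (hg : IsAffineAt g z μ b) (hμ : 1 < ‖μ‖) :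
    ∃ r, ∀ x, x ≠ r → Tendsto (fun k : ℕ => g^[k] x) atTop (𝓝 z) := by
  have h1 : μ ≠ 1 := by rintro rfl; simp at hμ
  obtain ⟨P, hz, hgz, hP⟩ := hg
  set p := b / (1 - μ) with hp
  refine ⟨P.symm p, fun x hx => ?_⟩
  by_cases hxz : x = z
  · subst hxz
    have : ∀ k, g^[k] x = x := fun k => Function.iterate_fixed hgz k
    simp [this]
  obtain ⟨y, hy⟩ : ∃ y : ℂ, (y : RSphere) = P x := by
    rw [← OnePoint.ne_infty_iff_exists, ← hz]
    exact fun h => hxz (P.injective h)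
  have hyp : y - p ≠ 0 := by
    intro h
    apply hx
    rw [← sub_eq_zero.1 h, hy, P.symm_apply_apply]
  have h2 : ∀ k : ℕ, g^[k] x = P.symm ((p + μ ^ k * (y - p) : ℂ) : RSphere) := by
    intro k
    induction k with
    | zero => simp [hy]
    | succ k ih =>
      rw [Function.iterate_succ_apply', ih, ← P.symm_apply_apply (g _), hP, sub_center_mul h1,
        ← hp, pow_succ]
      congr 3; ring
  have h3 : Tendsto (fun k : ℕ => ((p + μ ^ k * (y - p) : ℂ) : RSphere)) atTop
      (𝓝 OnePoint.infty) := by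
    refine OnePoint.tendsto_coe_infty.comp ?_
    rw [coclosedCompact_eq_cocompact, ← Metric.cobounded_eq_cocompact,
      ← tendsto_norm_atTop_iff_cobounded]
    have h4 : Tendsto (fun k : ℕ => ‖μ‖ ^ k * ‖y - p‖ - ‖p‖) atTop atTop :=
      tendsto_atTop_add_const_right _ _
        ((tendsto_pow_atTop_atTop_of_one_lt hμ).atTop_mul_const (norm_pos_iff.2 hyp))
    refine tendsto_atTop_mono (fun k => ?_) h4
    have := norm_sub_le (p + μ ^ k * (y - p)) p
    rw [add_sub_cancel_left, norm_mul, norm_pow] at this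
    linarith
  have h4 := (P.symm.continuous.tendsto OnePoint.infty).comp h3
  rw [← hz, P.symm_apply_apply] at h4
  simp_rw [h2]
  exact h4

/-! ### Multipliers -/

theorem coord_coe (a : ℂ) : coord (a : RSphere) = a := rfl

theorem inversion_coe {a : ℂ} (ha : a ≠ 0) : inversion (a : RSphere) = ((a⁻¹ : ℂ) : RSphere) := by
  simp [inversion, ha]

theorem inversion_zero : inversion ((0 : ℂ) : RSphere) = OnePoint.infty := by
  simp [inversion]

theorem isAffineAt_infty {A : SL(2, ℂ)} (h : A 1 0 = 0) :
    IsAffineAt (mobius (A : PSL(2, ℂ))) OnePoint.infty (A 0 0 ^ 2) (A 0 1 * A 0 0) := by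
  have hd := det_eq A
  rw [h, mul_zero, sub_zero] at hd
  have hd1 : A 1 1 ≠ 0 := right_ne_zero_of_mul_eq_one hd
  refine ⟨Homeomorph.refl _, rfl, by rw [mobius_mk_infty, if_pos h], fun x => ?_⟩
  change mobius (A : PSL(2, ℂ)) (x : RSphere) = _
  rw [mobius_mk_coe_of_ne (by simpa [h] using hd1)]
  congr 1
  rw [h, zero_mul, zero_add, div_eq_iff hd1]
  linear_combination (-(A 0 0) * x - A 0 1) * hd

theorem IsAffineAt.of_conj {g : RSphere → RSphere} {z : RSphere} {μ b : ℂ}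
    (Q : RSphere ≃ₜ RSphere) (h : IsAffineAt (fun x => Q (g (Q.symm x))) (Q z) μ b) :
    IsAffineAt g z μ b := by
  obtain ⟨P, h1, h2, h3⟩ := h
  refine ⟨Q.trans P, h1, ?_, fun x => by simpa using h3 x⟩
  simpa using h2

theorem isAffineAt_coe {A : SL(2, ℂ)} {z : ℂ} (hne : A 1 0 * z + A 1 1 ≠ 0)
    (hz : mobius (A : PSL(2, ℂ)) (z : RSphere) = z) :
    A 0 0 * z + A 0 1 = z * (A 1 0 * z + A 1 1) ∧ A 0 0 - z * A 1 0 = (A 1 0 * z + A 1 1)⁻¹ ∧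
    IsAffineAt (mobius (A : PSL(2, ℂ))) z ((A 1 0 * z + A 1 1) ^ 2)
      ((-A 1 0) * (A 1 0 * z + A 1 1)) := by
  have hd := det_eq A
  have hfix : A 0 0 * z + A 0 1 = z * (A 1 0 * z + A 1 1) := by
    rw [mobius_mk_coe_of_ne hne] at hz
    exact (div_eq_iff hne).1 (OnePoint.coe_injective hz)
  have hinv : A 0 0 - z * A 1 0 = (A 1 0 * z + A 1 1)⁻¹ := by
    apply eq_inv_of_mul_eq_one_left
    linear_combination hd + A 1 0 * hfix
  refine ⟨hfix, hinv, ?_⟩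
  -- `Q` is `x ↦ -1 / (x - z)`, which sends `z` to infinity; the conjugate of `A` is upper
  -- triangular with diagonal `e`, `e⁻¹` for `e = A 1 0 * z + A 1 1`.
  set Q : SL(2, ℂ) := mkSL 0 (-1) 1 (-z) (by ring) with hQ
  refine IsAffineAt.of_conj (mobiusHomeo (Q : PSL(2, ℂ))) ?_
  have hQz : mobiusHomeo (Q : PSL(2, ℂ)) (z : RSphere) = OnePoint.infty := by
    rw [coe_mobiusHomeo, mobius_mk_coe, if_pos (by simp [hQ])]
  have hQA : ((Q * A * Q⁻¹ : SL(2, ℂ)) : Matrix (Fin 2) (Fin 2) ℂ) =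
      !![A 1 0 * z + A 1 1, -A 1 0; 0, A 0 0 - z * A 1 0] := by
    rw [Matrix.SpecialLinearGroup.coe_mul, Matrix.SpecialLinearGroup.coe_mul,
      Matrix.SpecialLinearGroup.coe_inv, hQ, coe_mkSL, Matrix.adjugate_fin_two_of,
      Matrix.eta_fin_two (A : Matrix (Fin 2) (Fin 2) ℂ)]
    ext i j
    fin_cases i <;> fin_cases j <;> simp
    · linear_combination -hfix
    · ring
  have := isAffineAt_infty (A := Q * A * Q⁻¹) (by rw [hQA]; rfl)
  rw [hQz]
  rw [hQA] at this
  convert! this using 1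
  funext x
  simp only [QuotientGroup.mk_mul, mobius_mul]
  rfl

/-- At a fixed point `z` of a conformal automorphism, `e` is the eigenvalue of the line `z`. -/
theorem exists_eigenvalue {A : SL(2, ℂ)} {z : RSphere} (hz : mobius (A : PSL(2, ℂ)) z = z) :
    ∃ e b : ℂ, e ≠ 0 ∧ A 0 0 + A 1 1 = e + e⁻¹ ∧
      IsAffineAt (mobius (A : PSL(2, ℂ))) z (e ^ 2) b ∧
      ∀ φ : RSphere → RSphere, φ =ᶠ[𝓝 z] mobius (A : PSL(2, ℂ)) →
        multiplier φ z = (e ^ 2)⁻¹ := by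
  have hd := det_eq A
  induction z using OnePoint.rec with
  | infty =>
    have hc : A 1 0 = 0 := by
      by_contra h
      rw [mobius_mk_infty, if_neg h] at hz
      exact OnePoint.coe_ne_infty _ hz
    rw [hc, mul_zero, sub_zero] at hd
    have h0 : A 0 0 ≠ 0 := left_ne_zero_of_mul_eq_one hd
    have h1 : A 1 1 = (A 0 0)⁻¹ := eq_inv_of_mul_eq_one_right hd
    refine ⟨A 0 0, A 0 1 * A 0 0, h0, by rw [h1], isAffineAt_infty hc, fun φ hφ => ?_⟩
    -- The formula of `A` in the coordinate `1 / z`. It is derived for `x ≠ 0` and checked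
    -- separately at `x = 0`, which represents infinity.
    have hev : (fun x : ℂ => coord (inversion (φ (inversion (x : RSphere))))) =ᶠ[𝓝 0]
        fun x => (A 0 0)⁻¹ * x / (A 0 0 + A 0 1 * x) := by
      have h2 : ∀ᶠ x : ℂ in 𝓝[≠] 0, φ (inversion (x : RSphere)) =
          mobius (A : PSL(2, ℂ)) (inversion (x : RSphere)) := by
        have h3 : Tendsto (fun x : ℂ => inversion (x : RSphere)) (𝓝[≠] 0)
            (𝓝 (OnePoint.infty : RSphere)) := by
          have : Tendsto (fun z : ℂ => ((z⁻¹ : ℂ) : RSphere)) (𝓝[≠] 0)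
              (𝓝 (OnePoint.infty : RSphere)) := by
            refine OnePoint.tendsto_coe_infty.comp ?_
            rw [coclosedCompact_eq_cocompact, ← Metric.cobounded_eq_cocompact]
            exact tendsto_inv₀_nhdsNE_zero
          refine this.congr' ?_
          filter_upwards [self_mem_nhdsWithin] with x hx
          exact (inversion_coe hx).symm
        exact h3 hφ
      have h3 : ∀ᶠ x : ℂ in 𝓝 0, A 0 0 + A 0 1 * x ≠ 0 := by
        have : ContinuousAt (fun x : ℂ => A 0 0 + A 0 1 * x) 0 := by fun_prop
        exact this.eventually_ne (by simpa using h0)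
      rw [eventually_nhdsWithin_iff] at h2
      filter_upwards [h2, h3] with x hx hx3
      by_cases hx0 : x = 0
      · subst hx0
        rw [inversion_zero, hφ.self_of_nhds, hz]
        simp [inversion, coord]
      · rw [hx hx0, inversion_coe hx0, mobius_mk_coe_of_ne (by simp [hc, h1, h0]), hc, h1]
        have : A 0 0 * x⁻¹ + A 0 1 ≠ 0 := by
          intro h
          apply hx3
          field_simp at h
          linear_combination h
        rw [inversion_coe (div_ne_zero this (by simp [h0])), coord_coe]
        field_simp
        ring
    change deriv _ 0 = _
    rw [hev.deriv_eq]
    have : HasDerivAt (fun x => (A 0 0)⁻¹ * x / (A 0 0 + A 0 1 * x))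
        (((A 0 0)⁻¹ * 1 * (A 0 0 + A 0 1 * 0) - (A 0 0)⁻¹ * 0 * (A 0 1 * 1)) /
          (A 0 0 + A 0 1 * 0) ^ 2) 0 :=
      HasDerivAt.div ((hasDerivAt_id _).const_mul _)
        (((hasDerivAt_id _).const_mul _).const_add _) (by simpa using h0)
    rw [this.deriv]
    simp only [mul_zero, add_zero, zero_mul, sub_zero, mul_one]
    rw [inv_mul_cancel₀ h0, one_div]
  | coe z =>
    have hne : A 1 0 * z + A 1 1 ≠ 0 := by
      intro h
      rw [mobius_mk_coe, if_pos h] at hz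
      exact OnePoint.infty_ne_coe _ hz
    obtain ⟨hfix, hinv, haff⟩ := isAffineAt_coe hne hz
    refine ⟨A 1 0 * z + A 1 1, (-A 1 0) * (A 1 0 * z + A 1 1), hne, ?_, haff, fun φ hφ => ?_⟩
    · rw [← hinv]; ring
    · have hev : (fun x : ℂ => coord (φ (x : RSphere))) =ᶠ[𝓝 z]
          fun x => (A 0 0 * x + A 0 1) / (A 1 0 * x + A 1 1) := by
        have h3 : ∀ᶠ x : ℂ in 𝓝 z, A 1 0 * x + A 1 1 ≠ 0 := by
          have : ContinuousAt (fun x : ℂ => A 1 0 * x + A 1 1) z := by fun_prop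
          exact this.eventually_ne hne
        filter_upwards [OnePoint.continuous_coe.continuousAt hφ, h3] with x hx hx3
        rw [show φ x = _ from hx, mobius_mk_coe_of_ne hx3, coord_coe]
      change deriv _ z = _
      rw [hev.deriv_eq]
      have : HasDerivAt (fun x => (A 0 0 * x + A 0 1) / (A 1 0 * x + A 1 1))
          ((A 0 0 * 1 * (A 1 0 * z + A 1 1) - (A 0 0 * z + A 0 1) * (A 1 0 * 1)) /
            (A 1 0 * z + A 1 1) ^ 2) z :=
        HasDerivAt.div (((hasDerivAt_id _).const_mul _).add_const _)
          (((hasDerivAt_id _).const_mul _).add_const _) hne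
      rw [this.deriv, inv_eq_one_div]
      congr 1
      linear_combination hd

/-! ### Loxodromic elements -/

/-- A matrix in `SL(2, ℂ)` whose trace is not in `[-2, 2]` and which does not fix infinity. -/
def IsLoxodromic (A : SL(2, ℂ)) : Prop :=
  A 1 0 ≠ 0 ∧ ∀ r : ℝ, r ∈ Icc (-2) 2 → A 0 0 + A 1 1 ≠ r

/-- On the unit circle `e⁻¹` is the conjugate of `e`, so the trace would be `2 * e.re`, a real
number in `[-2, 2]`. -/
theorem IsLoxodromic.norm_ne_one {A : SL(2, ℂ)} (hA : IsLoxodromic A) {e : ℂ}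
    (he : A 0 0 + A 1 1 = e + e⁻¹) : ‖e‖ ≠ 1 := by
  intro h
  refine hA.2 (2 * e.re) ?_ ?_
  · have := abs_le.1 (Complex.abs_re_le_norm e)
    rw [h] at this
    constructor <;> linarith [this.1, this.2]
  · rw [he, Complex.inv_eq_conj h, Complex.add_conj]

/-- Of the two mutually inverse eigenvalues take the one with `‖e‖ > 1`: on its eigenline the
multiplier is `(e ^ 2)⁻¹`. The point is finite because `A 1 0 ≠ 0`. -/
theorem IsLoxodromic.exists_attracting {A : SL(2, ℂ)} (hA : IsLoxodromic A) :
    ∃ a r, mobius (A : PSL(2, ℂ)) a = a ∧ HasLocalOrbits ℕ (mobius (A : PSL(2, ℂ))) a ∧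
      ∀ x, x ≠ r → Tendsto (fun k : ℕ => (mobius (A : PSL(2, ℂ)))^[k] x) atTop (𝓝 a) := by
  have hd := det_eq A
  have hc := hA.1
  obtain ⟨e, he0, he, he1⟩ : ∃ e : ℂ, e ≠ 0 ∧ A 0 0 + A 1 1 = e + e⁻¹ ∧ 1 < ‖e‖ := by
    obtain ⟨e, he⟩ : ∃ e : ℂ, e ^ 2 - (A 0 0 + A 1 1) * e + 1 = 0 := by
      obtain ⟨s, hs⟩ := IsAlgClosed.exists_pow_nat_eq ((A 0 0 + A 1 1) ^ 2 - 4) (n := 2) two_pos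
      exact ⟨((A 0 0 + A 1 1) + s) / 2, by linear_combination hs / 4⟩
    have he0 : e ≠ 0 := by rintro rfl; simp at he
    have he' : A 0 0 + A 1 1 = e + e⁻¹ := by
      field_simp; linear_combination -he
    rcases lt_or_gt_of_ne (hA.norm_ne_one he') with h | h
    · refine ⟨e⁻¹, inv_ne_zero he0, by rw [he', inv_inv, add_comm], ?_⟩
      rw [norm_inv]
      exact (one_lt_inv₀ (norm_pos_iff.2 he0)).2 h
    · exact ⟨e, he0, he', h⟩
  have he2 : e ^ 2 - (A 0 0 + A 1 1) * e + 1 = 0 := by rw [he]; field_simp; ring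
  set a : ℂ := (e - A 1 1) / A 1 0 with ha
  have hea : A 1 0 * a + A 1 1 = e := by rw [ha]; field_simp; ring
  have hfix : mobius (A : PSL(2, ℂ)) (a : RSphere) = a := by
    rw [mobius_mk_coe_of_ne (by rwa [hea]), hea]
    congr 1
    rw [div_eq_iff he0, ha]
    field_simp
    linear_combination -hd - he2
  obtain ⟨-, -, haff⟩ := isAffineAt_coe (by rwa [hea]) hfix
  have hee : 1 < ‖(A 1 0 * a + A 1 1) ^ 2‖ := by
    rw [hea, norm_pow]
    exact one_lt_pow₀ he1 two_ne_zero
  obtain ⟨r, hr⟩ := haff.tendsto_iterate hee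
  exact ⟨a, r, hfix, haff.hasLocalOrbits_nat hee, hr⟩

end RSphere

namespace PMT

variable {K : ℕ} {F G : PMT K}

/-! ### Regular components -/

theorem disc_subset_preDiscSet : F.disc ⊆ F.preDiscSet := fun _ hz =>
  subset_closure (mem_iUnion.2 ⟨0, fun i hi => absurd hi (Nat.not_lt_zero i), hz⟩)

theorem regularSet_subset_conf : F.regularSet ⊆ F.conf := by
  rw [conf_eq_compl_disc]
  exact compl_subset_compl.2 disc_subset_preDiscSet

theorem isOpen_regularSet : IsOpen F.regularSet := isClosed_closure.isOpen_compl

/-- Branches are open maps: were the image a limit of points reaching the discontinuity set, some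
regular point near `z` would reach it one step later. -/
theorem map_mem_regularSet {z : RSphere} (hz : z ∈ F.regularSet) : F.map z ∈ F.regularSet := by
  obtain ⟨k, hk⟩ := mem_iUnion.1 (regularSet_subset_conf hz)
  have hN : IsOpen (F.regularSet ∩ F.R k) := isOpen_regularSet.inter (F.isOpen_R k)
  have hN' : IsOpen (mobius (F.f k) '' (F.regularSet ∩ F.R k)) :=
    (mobiusHomeo (F.f k)).isOpenMap _ hN
  intro hc
  rw [F.map_of_mem hk] at hc
  obtain ⟨_, ⟨u, hu, rfl⟩, hu'⟩ := mem_closure_iff.1 hc _ hN' (mem_image_of_mem _ ⟨hz, hk⟩)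
  obtain ⟨n, hn, hn'⟩ := mem_iUnion.1 hu'
  rw [← F.map_of_mem hu.2] at hn hn'
  refine hu.1 (subset_closure (mem_iUnion.2 ⟨n + 1, ?_, hn'⟩))
  rintro (_ | i) hi
  · exact mem_iUnion.2 ⟨k, hu.2⟩
  · exact hn i (by omega)

theorem map_iterate_mem_regularSet {z : RSphere} (hz : z ∈ F.regularSet) (i : ℕ) :
    F.map^[i] z ∈ F.regularSet := by
  induction i with
  | zero => exact hz
  | succ i ih =>
    rw [Function.iterate_succ_apply']
    exact map_mem_regularSet ih

theorem continuousOn_map : ContinuousOn F.map F.conf := by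
  intro z hz
  obtain ⟨k, hk⟩ := mem_iUnion.1 hz
  refine ContinuousAt.continuousWithinAt ?_
  refine (continuous_mobius (F.f k)).continuousAt.congr ?_
  filter_upwards [(F.isOpen_R k).mem_nhds hk] with x hx
  exact (F.map_of_mem hx).symm

theorem continuousOn_map_iterate (i : ℕ) : ContinuousOn F.map^[i] F.regularSet :=
  (continuousOn_map.mono regularSet_subset_conf).iterate (fun _ => map_mem_regularSet) i

theorem IsRegularComponent.isConnected {U : Set RSphere} (h : F.IsRegularComponent U) :
    IsConnected U := by
  obtain ⟨z, hz, rfl⟩ := h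
  exact isConnected_connectedComponentIn_iff.2 hz

theorem IsRegularComponent.subset {U : Set RSphere} (h : F.IsRegularComponent U) :
    U ⊆ F.regularSet := by
  obtain ⟨z, hz, rfl⟩ := h
  exact connectedComponentIn_subset _ _

theorem IsRegularComponent.subset_of_isConnected {U V : Set RSphere}
    (h : F.IsRegularComponent U) (hV : IsConnected V) (hV' : V ⊆ F.regularSet)
    (hUV : (V ∩ U).Nonempty) : V ⊆ U := by
  obtain ⟨z, hz, rfl⟩ := h
  obtain ⟨y, hy, hy'⟩ := hUV
  rw [connectedComponentIn_eq hy']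
  exact hV.isPreconnected.subset_connectedComponentIn hy hV'

theorem IsRegularComponent.isConnected_image {U : Set RSphere} (h : F.IsRegularComponent U)
    (i : ℕ) : IsConnected (F.map^[i] '' U) :=
  h.isConnected.image _ ((continuousOn_map_iterate i).mono h.subset)

theorem IsRegularComponent.image_subset {U : Set RSphere} (h : F.IsRegularComponent U)
    (i : ℕ) : F.map^[i] '' U ⊆ F.regularSet := by
  rintro _ ⟨z, hz, rfl⟩
  exact map_iterate_mem_regularSet (h.subset hz) i

theorem IsRegularComponent.exists_word {U : Set RSphere} (h : F.IsRegularComponent U) :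
    ∃ w : ℕ → Fin K, ∀ i, ∀ z ∈ U, F.map^[i] z ∈ F.R (w i) := by
  choose w hw using fun i => exists_subset_R (h.isConnected_image i)
    ((h.image_subset i).trans regularSet_subset_conf)
  exact ⟨w, fun i z hz => hw i (mem_image_of_mem _ hz)⟩

theorem word_add_eq {U : Set RSphere} (hU : U.Nonempty) {w : ℕ → Fin K}
    (hw : ∀ i, ∀ z ∈ U, F.map^[i] z ∈ F.R (w i)) {n : ℕ} (hn : F.map^[n] '' U ⊆ U) (i : ℕ) :
    w (n + i) = w i := by
  obtain ⟨z, hz⟩ := hU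
  have h1 := hw (n + i) z hz
  rw [add_comm, Function.iterate_add_apply, add_comm] at h1
  exact F.eq_of_mem_R h1 (hw i _ (hn (mem_image_of_mem _ hz)))

/-! ### Generic transformations -/

variable (F) in
/-- A relatively open part of the boundary of a region returns to the discontinuity set under
a composition of the extended branches. -/
def HasBoundaryReturn : Prop :=
  ∃ (w : ℕ → Fin K) (n : ℕ), 0 < n ∧ ∃ W : Set RSphere, IsOpen W ∧
    (W ∩ frontier (F.R (w 0))).Nonempty ∧ ∀ x ∈ W ∩ frontier (F.R (w 0)),
      F.Follows w n x ∧ mobius (compAlong F.f w n) x ∈ F.disc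

/-- The definition involves only boundaries, closed regions and extended branches, all of which `h`
transports; `σ` acts on the word. -/
theorem IsConjBy.hasBoundaryReturn {h : RSphere ≃ₜ RSphere} {σ : Fin K → Fin K}
    (H : IsConjBy F G h σ) (hF : F.HasBoundaryReturn) : G.HasBoundaryReturn := by
  obtain ⟨w, n, hn, W, hW, ⟨y, hy, hy'⟩, hx⟩ := hF
  have hfr : ∀ k, frontier (G.R (σ k)) = h '' frontier (F.R k) := by
    intro k; rw [← H.image_R, h.image_frontier]
  refine ⟨σ ∘ w, n, hn, h '' W, h.isOpenMap _ hW, ⟨h y, mem_image_of_mem _ hy, ?_⟩, ?_⟩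
  · rw [Function.comp_apply, hfr]
    exact mem_image_of_mem _ hy'
  · rw [Function.comp_apply, hfr, ← image_inter h.injective]
    rintro _ ⟨x, hxW, rfl⟩
    obtain ⟨h1, h2⟩ := hx x hxW
    refine ⟨H.follows h1, ?_⟩
    rw [← H.compAlong_apply h1 le_rfl, H.mem_disc_iff]
    exact h2

/-- All compositions of branches are loxodromic without fixed points on the discontinuity set,
and no part of the boundary of a region returns to the discontinuity set. -/
structure IsGeneric (G : PMT K) : Prop where
  loxodromic : ∀ (w : ℕ → Fin K) (n : ℕ), 0 < n →
    ∃ A : SL(2, ℂ), (A : PSL(2, ℂ)) = compAlong G.f w n ∧ IsLoxodromic A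
  fixed_notMem_disc : ∀ (w : ℕ → Fin K) (n : ℕ), 0 < n → ∀ b ∈ G.disc,
    mobius (compAlong G.f w n) b ≠ b
  not_hasBoundaryReturn : ¬ G.HasBoundaryReturn

theorem IsGeneric.not_hasLocalOrbits_int (hG : G.IsGeneric) {n : ℕ} {z : RSphere}
    (hz : G.IsPeriodicPoint n z) : ¬ HasLocalOrbits ℤ G.map^[n] z := by
  intro H
  obtain ⟨h0, hdom, hfix, -⟩ := hz
  obtain ⟨w, hw⟩ := exists_itinerary hdom
  obtain ⟨A, hA, hA'⟩ := hG.loxodromic w n h0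
  have hev := hw.eventuallyEq
  rw [← hA] at hev
  rw [hev.self_of_nhds] at hfix
  obtain ⟨e, b, -, htr, haff, -⟩ := exists_eigenvalue hfix
  have h1 := haff.norm_eq_one (H.congr hev)
  rw [norm_pow] at h1
  exact hA'.norm_ne_one htr ((pow_eq_one_iff_of_nonneg (norm_nonneg _) two_ne_zero).1 h1)

/-- Elliptic and parabolic points have unimodular multiplier; at a point of identity, constant
orbits serve. -/
theorem hasLocalOrbits_int_of_mem_perNeu {z : RSphere} (hz : z ∈ F.perNeu) :
    ∃ n, F.IsPeriodicPoint n z ∧ HasLocalOrbits ℤ F.map^[n] z := by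
  have key : ∀ n, F.IsPeriodicPoint n z → ‖multiplier F.map^[n] z‖ = 1 →
      HasLocalOrbits ℤ F.map^[n] z := by
    rintro n ⟨h0, hdom, hfix, -⟩ hm
    obtain ⟨w, hw⟩ := exists_itinerary hdom
    obtain ⟨A, hA⟩ := QuotientGroup.mk_surjective (compAlong F.f w n)
    have hev := hw.eventuallyEq
    rw [← hA] at hev
    rw [hev.self_of_nhds] at hfix
    obtain ⟨e, b, -, -, haff, hmul⟩ := exists_eigenvalue hfix
    rw [hmul _ hev, norm_inv, inv_eq_one] at hm
    exact (haff.hasLocalOrbits_int hm).congr hev.symm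
  rcases hz with (⟨n, hn, h1, -⟩ | ⟨n, hn, h1, -⟩) | ⟨n, hn, h1⟩
  · exact ⟨n, hn, key n hn h1⟩
  · exact ⟨n, hn, key n hn (by rw [h1, norm_one])⟩
  · refine ⟨n, hn, fun V hV => ?_⟩
    have : ∀ᶠ x in 𝓝[≠] z, x ∈ V ∧ F.map^[n] x = x :=
      eventually_nhdsWithin_of_eventually_nhds ((Filter.eventually_mem_set.2 hV).and h1)
    obtain ⟨x, ⟨hx1, hx2⟩, hx3⟩ := (this.and self_mem_nhdsWithin).exists
    exact ⟨fun _ => x, fun _ => ⟨hx1, hx3, hx2⟩⟩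

theorem IsConjBy.hasLocalOrbits {h : RSphere ≃ₜ RSphere} {σ : Fin K → Fin K}
    (H : IsConjBy F G h σ) {ι : Type} [Add ι] [One ι] {n : ℕ} {z : RSphere} (hz : z ∈ F.dom n)
    (ho : HasLocalOrbits ι F.map^[n] z) : HasLocalOrbits ι G.map^[n] (h z) := by
  refine ho.conj h ?_
  obtain ⟨w, hw⟩ := exists_itinerary hz
  filter_upwards [hw.eventually] with x hx
  exact H.map_iterate hx.mem_dom le_rfl

theorem perNeu_eq_empty_of_isConjBy {h : RSphere ≃ₜ RSphere} {σ : Fin K → Fin K}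
    (H : IsConjBy F G h σ) (hG : G.IsGeneric) : F.perNeu = ∅ := by
  rw [Set.eq_empty_iff_forall_notMem]
  intro z hz
  obtain ⟨n, hn, ho⟩ := hasLocalOrbits_int_of_mem_perNeu hz
  exact hG.not_hasLocalOrbits_int (H.isPeriodicPoint hn) (H.hasLocalOrbits hn.2.1 ho)

theorem follows_of_mem_closure {U : Set RSphere} {w : ℕ → Fin K}
    (hw : ∀ i, ∀ z ∈ U, F.map^[i] z ∈ F.R (w i)) {z : RSphere} (hz : z ∈ closure U) (n : ℕ) :
    F.Follows w n z := by
  intro i _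
  have h1 : IsClosed (mobius (compAlong F.f w i) ⁻¹' closure (F.R (w i))) :=
    isClosed_closure.preimage (continuous_mobius _)
  refine closure_minimal (fun x hx => ?_) h1 hz
  exact (itinerary_of_iterate_mem (n := i + 1) fun j _ => hw j x hx).follows i (by omega)

/-- A ghost-periodic point lies in the closure of its component, so its extended orbit follows the
component's periodic word, and passing to the limit makes it a fixed point of the composition over
one period. At time `N` this fixed point sits on the discontinuity set, a configuration that the
conjugacy carries to `G`. -/
theorem perGhost_eq_empty_of_isConjBy {h : RSphere ≃ₜ RSphere} {σ : Fin K → Fin K}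
    (H : IsConjBy F G h σ) (hG : G.IsGeneric) : F.perGhost = ∅ := by
  rw [Set.eq_empty_iff_forall_notMem]
  rintro z₀ ⟨⟨N, hN, hN'⟩, n, U, ⟨hU, hn, hUn, -⟩, hz₀, hlim⟩
  obtain ⟨w, hw⟩ := hU.exists_word
  have hper := word_add_eq hU.isConnected.nonempty hw hUn
  have hfol : ∀ n, F.Follows w n z₀ := fun n =>
    follows_of_mem_closure hw (frontier_subset_closure hz₀) n
  -- Before time `N` the orbit avoids the discontinuity set, so membership in closed regions
  -- improves to membership in regions and the true orbit agrees with the extended one.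
  have hit : ∀ i ≤ N, F.Itinerary w i z₀ := by
    intro i
    induction i with
    | zero => intro _ j hj; omega
    | succ i ih =>
      intro hi j hj
      rcases Nat.lt_succ_iff_lt_or_eq.1 hj with hj | rfl
      · exact ih (by omega) j hj
      · refine F.mem_R_of_mem_closure (hfol (j + 1) j (by omega)) ?_
        have := hN j (by omega)
        rw [(ih (by omega)).map_iterate le_rfl, conf_eq_compl_disc] at this
        exact this
  rw [(hit N le_rfl).map_iterate le_rfl] at hN'
  have hmap : ∀ z ∈ U, ∀ i, F.map^[i] z = mobius (compAlong F.f w i) z := fun z hz i =>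
    (itinerary_of_iterate_mem (n := i) fun j _ => hw j z hz).map_iterate le_rfl
  have hfix : mobius (compAlong F.f w n) z₀ = z₀ := by
    obtain ⟨z, hz⟩ := hU.isConnected.nonempty
    have h1 := hlim z hz
    have hmem : ∀ k : ℕ, (F.map^[n])^[k] z ∈ U := by
      intro k
      induction k with
      | zero => exact hz
      | succ k ih =>
        rw [Function.iterate_succ_apply']
        exact hUn (mem_image_of_mem _ ih)
    have h2 : Tendsto (fun k : ℕ => (F.map^[n])^[k + 1] z) atTop
        (𝓝 (mobius (compAlong F.f w n) z₀)) := by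
      refine (((continuous_mobius _).tendsto z₀).comp h1).congr fun k => ?_
      rw [Function.iterate_succ_apply', hmap _ (hmem k)]
      rfl
    exact tendsto_nhds_unique h2 ((tendsto_add_atTop_iff_nat 1).2 h1)
  refine hG.fixed_notMem_disc (fun j => σ (w (N + j))) n hn
    (h (mobius (compAlong F.f w N) z₀)) (H.mem_disc_iff.2 hN') ?_
  have hfol' : F.Follows (fun j => w (N + j)) n (mobius (compAlong F.f w N) z₀) := by
    intro i _
    rw [← mobius_mul, ← compAlong_add]
    exact hfol (N + i + 1) _ (by omega)
  have := H.compAlong_apply hfol' le_rfl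
  rw [← mobius_mul, compAlong_shift_of_periodic _ hper, mobius_mul, hfix] at this
  exact this.symm

/-- Two images of a component, at times `m < n`, lie in one component `V`; then `F^(n - m)` maps `V`
to a connected set meeting `V`. Nontriviality guarantees a point of `V` other than a given repelling
one. -/
theorem exists_invariant_of_regularSet_nonempty (hreg : F.regularSet.Nonempty)
    (hwand : F.HasNoWanderingComponents) :
    ∃ (V : Set RSphere) (d : ℕ) (w : ℕ → Fin K), V.Nontrivial ∧ 0 < d ∧ F.map^[d] '' V ⊆ V ∧
      ∀ i, ∀ z ∈ V, F.map^[i] z ∈ F.R (w i) := by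
  obtain ⟨x, hx⟩ : ∃ x : ℂ, (x : RSphere) ∈ F.regularSet :=
    OnePoint.denseRange_coe.exists_mem_open isOpen_regularSet hreg
  set U := connectedComponentIn F.regularSet (x : RSphere) with hUdef
  have hU : F.IsRegularComponent U := ⟨x, hx, rfl⟩
  have hUn : U.Nontrivial := by
    obtain ⟨r, hr, hball⟩ := Metric.isOpen_iff.1
      (isOpen_regularSet.preimage OnePoint.continuous_coe) x hx
    have h1 : (↑) '' Metric.ball x r ⊆ U := by
      refine IsPreconnected.subset_connectedComponentIn ?_
        (mem_image_of_mem _ (Metric.mem_ball_self hr)) (image_subset_iff.2 hball)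
      exact (convex_ball x r).isPreconnected.image _ OnePoint.continuous_coe.continuousOn
    refine (Set.Nontrivial.image ?_ OnePoint.coe_injective).mono h1
    refine ⟨x, Metric.mem_ball_self hr, x + (r / 2 : ℝ), ?_, ?_⟩
    · rw [Metric.mem_ball, dist_self_add_left, Complex.norm_real, Real.norm_of_nonneg (half_pos hr).le]
      linarith
    · simpa using hr.ne'
  have key : ∃ m n, m < n ∧ ∃ V, F.IsRegularComponent V ∧ F.map^[m] '' U ⊆ V ∧
      F.map^[n] '' U ⊆ V := by
    have := hwand U
    unfold IsWanderingComponent at this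
    push Not at this
    obtain ⟨m, n, hmn, V, hV, h1, h2⟩ := this hU
    rcases lt_or_gt_of_ne hmn with h | h
    · exact ⟨m, n, h, V, hV, h1, h2⟩
    · exact ⟨n, m, h, V, hV, h2, h1⟩
  obtain ⟨m, n, hmn, V, hV, h1, h2⟩ := key
  obtain ⟨u, hu⟩ := hU.exists_word
  obtain ⟨w, hw⟩ := hV.exists_word
  refine ⟨V, n - m, w, ?_, by omega, ?_, hw⟩
  · refine (Set.Nontrivial.image_of_injOn hUn ?_).mono h1
    have : ∀ z ∈ U, F.map^[m] z = mobius (compAlong F.f u m) z := fun z hz =>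
      (itinerary_of_iterate_mem (n := m) fun j _ => hu j z hz).map_iterate le_rfl
    intro a ha b hb hab
    rw [this a ha, this b hb] at hab
    exact mobius_injective _ hab
  · refine hV.subset_of_isConnected (hV.isConnected_image _) (hV.image_subset _) ?_
    refine ⟨F.map^[n] x, ⟨F.map^[m] x, h1 (mem_image_of_mem _ (mem_connectedComponentIn hx)), ?_⟩,
      h2 (mem_image_of_mem _ (mem_connectedComponentIn hx))⟩
    rw [← Function.iterate_add_apply]
    congr 2; omega

/-- The loxodromic composition attracts all points but `r`, so its attracting point `a` lies in the
closure of `V`. The extended orbit of `a` consists of fixed points of shifted compositions, hence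
misses the discontinuity set and is a genuine orbit. -/
theorem IsGeneric.exists_attracting (hG : G.IsGeneric) {V : Set RSphere} {d : ℕ}
    {w : ℕ → Fin K} (hV : V.Nontrivial) (hd : 0 < d) (hdV : G.map^[d] '' V ⊆ V)
    (hw : ∀ i, ∀ z ∈ V, G.map^[i] z ∈ G.R (w i)) :
    ∃ m a, G.IsPeriodicPoint m a ∧ HasLocalOrbits ℕ G.map^[m] a := by
  have hper := word_add_eq hV.nonempty hw hdV
  obtain ⟨A, hA, hlox⟩ := hG.loxodromic w d hd
  obtain ⟨a, r, hfix, -, htend⟩ := hlox.exists_attracting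
  rw [hA] at hfix htend
  have hmap : ∀ z ∈ V, G.map^[d] z = mobius (compAlong G.f w d) z := fun z hz =>
    (itinerary_of_iterate_mem (n := d) fun j _ => hw j z hz).map_iterate le_rfl
  have hcl : a ∈ closure V := by
    obtain ⟨v, hv, hvr⟩ := hV.exists_ne r
    refine mem_closure_of_tendsto (htend v hvr) (Eventually.of_forall fun k => ?_)
    induction k with
    | zero => exact hv
    | succ k ih =>
      rw [Function.iterate_succ_apply', ← hmap _ ih]
      exact hdV (mem_image_of_mem _ ih)
  have hit : ∀ n, G.Itinerary w n a := by
    intro n i _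
    refine G.mem_R_of_mem_closure (follows_of_mem_closure hw hcl (i + 1) i (by omega)) ?_
    intro hdisc
    refine hG.fixed_notMem_disc (fun j => w (i + j)) d hd _ hdisc ?_
    rw [← mobius_mul, compAlong_shift_of_periodic _ hper, mobius_mul, hfix]
  have hiter : ∀ n, G.map^[n] a = mobius (compAlong G.f w n) a := fun n =>
    (hit n).map_iterate le_rfl
  have hpt : Function.IsPeriodicPt G.map d a := (hiter d).trans hfix
  -- `d` need not be the least period of `a`. The composition over the least period is loxodromic
  -- too, and its attracting point has to be identified with `a`.
  set m := Function.minimalPeriod G.map a with hm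
  have hm0 : 0 < m := hpt.minimalPeriod_pos hd
  have hma : G.map^[m] a = a := Function.isPeriodicPt_minimalPeriod G.map a
  have hperm : ∀ i, w (m + i) = w i := fun i => word_add_eq (U := {a}) (singleton_nonempty a)
    (w := w) (fun i z hz => by
      rw [mem_singleton_iff.1 hz, hiter]; exact hit (i + 1) i (by omega))
    (by rw [image_singleton, hma]) i
  obtain ⟨l, hl⟩ := hpt.minimalPeriod_dvd
  rw [← hm] at hl
  have hl0 : 0 < l := Nat.pos_of_ne_zero (by rintro rfl; omega)
  obtain ⟨B, hB, hloxB⟩ := hG.loxodromic w m hm0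
  obtain ⟨a', r', hfix', horb, htend'⟩ := hloxB.exists_attracting
  rw [hB] at hfix' horb htend'
  have hAB : mobius (compAlong G.f w d) = (mobius (compAlong G.f w m))^[l] := by
    rw [hl, compAlong_mul_of_periodic _ hperm]
    clear hl hl0
    induction l with
    | zero => funext z; simp [mobius_one]
    | succ l ih =>
      funext z
      rw [pow_succ', mobius_mul, ih, Function.iterate_succ_apply']
  have haa : a = a' := by
    -- A point different from both exceptional ones tends to both attracting points, since one map
    -- is the `l`-th iterate of the other.
    obtain ⟨x, hx⟩ := (Set.toFinite {r, r'}).infinite_compl.nonempty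
    rw [mem_compl_iff, mem_insert_iff, mem_singleton_iff, not_or] at hx
    refine tendsto_nhds_unique (htend x hx.1) ?_
    have := (htend' x hx.2).comp (tendsto_id.const_mul_atTop' hl0)
    refine this.congr fun k => ?_
    rw [hAB, ← Function.iterate_mul]
    rfl
  refine ⟨m, a, ⟨hm0, (hit m).mem_dom, hma, fun j hj hjm h => ?_⟩, ?_⟩
  · exact Function.not_isPeriodicPt_of_pos_of_lt_minimalPeriod hj.ne' hjm h
  · rw [haa] at hit ⊢
    exact horb.congr (hit m).eventuallyEq.symm

theorem perAttr_nonempty_of_isConj (hFG : IsConj F G) (hG : G.IsGeneric)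
    (hreg : F.regularSet.Nonempty) (hwand : F.HasNoWanderingComponents) :
    F.perAttr.Nonempty := by
  obtain ⟨h, σ, H⟩ := hFG.exists_isConjBy
  -- `h'` need not be the inverse of `h`; only that it carries `G` to `F` is used.
  obtain ⟨h', σ', H'⟩ := hFG.symm.exists_isConjBy
  obtain ⟨V, d, w, hV, hd, hdV, hw⟩ := exists_invariant_of_regularSet_nonempty hreg hwand
  have hdom : ∀ z ∈ V, ∀ i, z ∈ F.dom i := fun z hz i =>
    (itinerary_of_iterate_mem fun j _ => hw j z hz).mem_dom
  obtain ⟨m, a, ha, horb⟩ := hG.exists_attracting (V := h '' V) (d := d) (w := σ ∘ w)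
    (hV.image h.injective) hd
    (by
      rintro _ ⟨_, ⟨z, hz, rfl⟩, rfl⟩
      rw [← H.map_iterate (hdom z hz d) le_rfl]
      exact mem_image_of_mem _ (hdV (mem_image_of_mem _ hz)))
    (by
      rintro i _ ⟨z, hz, rfl⟩
      rw [← H.map_iterate (hdom z hz i) le_rfl, Function.comp_apply, ← H.image_R]
      exact mem_image_of_mem _ (hw i z hz))
  have hq := H'.isPeriodicPoint ha
  have hqorb := H'.hasLocalOrbits ha.2.1 horb
  refine ⟨h' a, m, hq, ?_⟩
  obtain ⟨u, hu⟩ := exists_itinerary hq.2.1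
  obtain ⟨A, hA⟩ := QuotientGroup.mk_surjective (compAlong F.f u m)
  have hev := hu.eventuallyEq
  rw [← hA] at hev
  have hfix := hq.2.2.1
  rw [hev.self_of_nhds] at hfix
  obtain ⟨e, b, -, -, haff, hmul⟩ := exists_eigenvalue hfix
  -- Here `1 ≤ ‖e ^ 2‖`, and the multiplier is the inverse of `e ^ 2`; modulus one would make the
  -- point neutral.
  have h1 := haff.one_le_norm (hqorb.congr hev)
  have h2 : ‖multiplier F.map^[m] (h' a)‖ ≠ 1 := by
    intro h1
    have hn : h' a ∉ F.perNeu := by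
      rw [perNeu_eq_empty_of_isConjBy H hG]; exact notMem_empty _
    by_cases h2 : multiplier F.map^[m] (h' a) = 1
    · by_cases h3 : ∀ᶠ w in 𝓝 (h' a), F.map^[m] w = w
      · exact hn (Or.inr ⟨m, hq, h3⟩)
      · exact hn (Or.inl (Or.inr ⟨m, hq, h2, h3⟩))
    · exact hn (Or.inl (Or.inl ⟨m, hq, h1, h2⟩))
  refine lt_of_le_of_ne ?_ h2
  rw [hmul _ hev, norm_inv]
  exact inv_le_one_of_one_le₀ h1

end PMT

namespace RSphere

/-! ### Polynomial paths in `SL(2, ℂ)` -/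

/-- Infinite words are uncountable in number; lists are countable, as the Baire arguments require.
-/
theorem compAlong_eq_prod {K : ℕ} (w : ℕ → Fin K) (n : ℕ) :
    ∃ l : List (Fin K), l.length = n ∧ ∀ f, compAlong f w n = (l.map f).prod := by
  induction n with
  | zero => exact ⟨[], rfl, fun f => rfl⟩
  | succ n ih =>
    obtain ⟨l, hl, h⟩ := ih
    exact ⟨w n :: l, by simp [hl], fun f => by simp [compAlong, h]⟩

/-- Evaluation of a matrix of polynomials. -/
def evalSL (s : ℂ) : SL(2, Polynomial ℂ) →* SL(2, ℂ) :=
  Matrix.SpecialLinearGroup.map (Polynomial.evalRingHom s)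

theorem evalSL_apply (s : ℂ) (γ : SL(2, Polynomial ℂ))
    (i j : Fin 2) : evalSL s γ i j = (γ i j).eval s := rfl

theorem continuous_evalSL (γ : SL(2, Polynomial ℂ)) :
    Continuous fun s => evalSL s γ := by
  refine Continuous.subtype_mk (continuous_matrix fun i j => ?_) _
  exact (γ i j).continuous

theorem exists_path_to_one_mul {A B : SL(2, ℂ)}
    (hA : ∃ γ, evalSL 0 γ = A ∧ evalSL 1 γ = 1) (hB : ∃ γ, evalSL 0 γ = B ∧ evalSL 1 γ = 1) :
    ∃ γ, evalSL 0 γ = A * B ∧ evalSL 1 γ = 1 := by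
  obtain ⟨γ, h1, h2⟩ := hA
  obtain ⟨δ, h3, h4⟩ := hB
  exact ⟨γ * δ, by rw [map_mul, h1, h3], by rw [map_mul, h2, h4, one_mul]⟩

theorem exists_path_upper (a : ℂ) :
    ∃ γ, evalSL 0 γ = mkSL 1 a 0 1 (by ring) ∧ evalSL 1 γ = 1 := by
  refine ⟨mkSL 1 (Polynomial.C a * (1 - Polynomial.X)) 0 1 (by ring), ?_, ?_⟩ <;>
  · ext i j
    rw [evalSL_apply, coe_mkSL]
    fin_cases i <;> fin_cases j <;> simp

theorem exists_path_lower (a : ℂ) :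
    ∃ γ, evalSL 0 γ = mkSL 1 0 a 1 (by ring) ∧ evalSL 1 γ = 1 := by
  refine ⟨mkSL 1 0 (Polynomial.C a * (1 - Polynomial.X)) 1 (by ring), ?_, ?_⟩ <;>
  · ext i j
    rw [evalSL_apply, coe_mkSL]
    fin_cases i <;> fin_cases j <;> simp

/-- With nonzero lower left entry, `A` is a product of three elementary matrices: upper, lower,
upper. -/
theorem exists_path_to_one_of_ne {A : SL(2, ℂ)} (h : A 1 0 ≠ 0) :
    ∃ γ, evalSL 0 γ = A ∧ evalSL 1 γ = 1 := by
  have hd := det_eq A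
  have e : A = mkSL 1 ((A 0 0 - 1) / A 1 0) 0 1 (by ring) * (mkSL 1 0 (A 1 0) 1 (by ring) *
      mkSL 1 ((A 1 1 - 1) / A 1 0) 0 1 (by ring)) := by
    apply Subtype.ext
    rw [Matrix.SpecialLinearGroup.coe_mul, Matrix.SpecialLinearGroup.coe_mul, coe_mkSL, coe_mkSL,
      coe_mkSL]
    ext i j
    fin_cases i <;> fin_cases j <;> simp
    · field_simp; ring
    · field_simp; linear_combination -hd
    · field_simp; ring
  rw [e]
  exact exists_path_to_one_mul (exists_path_upper _)
    (exists_path_to_one_mul (exists_path_lower _) (exists_path_upper _))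

theorem exists_path_to_one (A : SL(2, ℂ)) : ∃ γ, evalSL 0 γ = A ∧ evalSL 1 γ = 1 := by
  by_cases h : A 1 0 = 0
  · have hd := det_eq A
    rw [h, mul_zero, sub_zero] at hd
    have hd1 : A 1 1 ≠ 0 := right_ne_zero_of_mul_eq_one hd
    have e : A = (A * mkSL 1 0 1 1 (by ring)) * mkSL 1 0 (-1) 1 (by ring) := by
      have : mkSL (1 : ℂ) 0 1 1 (by ring) * mkSL 1 0 (-1) 1 (by ring) = 1 := by
        apply Subtype.ext
        rw [Matrix.SpecialLinearGroup.coe_mul, coe_mkSL, coe_mkSL]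
        ext i j
        fin_cases i <;> fin_cases j <;> simp
      rw [mul_assoc, this, mul_one]
    rw [e]
    refine exists_path_to_one_mul (exists_path_to_one_of_ne ?_) (exists_path_lower _)
    rw [Matrix.SpecialLinearGroup.coe_mul, coe_mkSL]
    simpa [Matrix.mul_apply, h] using hd1
  · exact exists_path_to_one_of_ne h

/-- Along polynomial paths the trace and the entries of every product are polynomials in the
parameter, so that good behaviour at one parameter spreads to a dense set. -/
theorem exists_path (A B : SL(2, ℂ)) : ∃ γ, evalSL 0 γ = A ∧ evalSL 1 γ = B := by
  obtain ⟨γ, h1, h2⟩ := exists_path_to_one (A * B⁻¹)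
  have hC : ∀ s, evalSL s (Matrix.SpecialLinearGroup.map Polynomial.C B) = B := by
    intro s
    ext i j
    rw [evalSL_apply]
    simp
  exact ⟨γ * Matrix.SpecialLinearGroup.map Polynomial.C B,
    by rw [map_mul, h1, hC, inv_mul_cancel_right], by rw [map_mul, h2, hC, one_mul]⟩

/-! ### Avoiding small sets -/

/-- Open mapping: a nonconstant analytic germ covers a neighbourhood of its value. -/
theorem eventually_eq_of_interior_eq_empty {u : ℂ → ℂ} {z : ℂ} {N : Set ℂ}
    (hu : AnalyticAt ℂ u z) (hN : interior N = ∅) (h : ∀ᶠ w in 𝓝 z, u w ∈ N) :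
    ∀ᶠ w in 𝓝 z, u w = u z := by
  rcases hu.eventually_constant_or_nhds_le_map_nhds with h1 | h1
  · exact h1
  · exfalso
    have : N ∈ 𝓝 (u z) := h1 h
    rw [← mem_interior_iff_mem_nhds, hN] at this
    exact this

theorem interior_segment_eq_empty :
    interior ((fun r : ℝ => (r : ℂ)) '' Icc (-2) 2) = ∅ := by
  rw [Set.eq_empty_iff_forall_notMem]
  intro z hz
  have h1 : ∀ᶠ t : ℝ in 𝓝 0, z + t * Complex.I ∈ interior ((fun r : ℝ => (r : ℂ)) '' Icc (-2) 2) := by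
    have : ContinuousAt (fun t : ℝ => z + t * Complex.I) 0 := by fun_prop
    exact this (by simpa using isOpen_interior.mem_nhds hz)
  have h2 : ∀ᶠ t : ℝ in 𝓝[≠] 0, t ≠ 0 ∧
      z + t * Complex.I ∈ interior ((fun r : ℝ => (r : ℂ)) '' Icc (-2) 2) :=
    (eventually_mem_nhdsWithin).and (eventually_nhdsWithin_of_eventually_nhds h1)
  obtain ⟨t, ht, ht'⟩ := h2.exists
  obtain ⟨r, -, hr⟩ := interior_subset ht'
  obtain ⟨r', -, hr'⟩ := interior_subset hz
  have := congr_arg Complex.im hr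
  rw [← hr'] at this
  simp at this
  exact ht this.symm

theorem isClosed_segment : IsClosed ((fun r : ℝ => (r : ℂ)) '' Icc (-2) 2) :=
  (isCompact_Icc.image Complex.continuous_ofReal).isClosed

theorem dense_setOf_eval_ne_zero {p : Polynomial ℂ} (hp : p ≠ 0) :
    Dense {s : ℂ | p.eval s ≠ 0} := by
  have : {s : ℂ | p.eval s ≠ 0} = {s | p.IsRoot s}ᶜ := rfl
  rw [this]
  exact (Polynomial.finite_setOfPred_isRoot hp).countable.dense_compl ℂ

theorem dense_setOf_eval_notMem_segment {p : Polynomial ℂ} {s₁ : ℂ}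
    (hp : p.eval s₁ ∉ (fun r : ℝ => (r : ℂ)) '' Icc (-2) 2) :
    Dense {s : ℂ | p.eval s ∉ (fun r : ℝ => (r : ℂ)) '' Icc (-2) 2} := by
  set N := (fun r : ℝ => (r : ℂ)) '' Icc (-2) 2 with hN
  have : interior {s : ℂ | p.eval s ∈ N} = ∅ := by
    rw [Set.eq_empty_iff_forall_notMem]
    intro z hz
    have h1 : ∀ᶠ w in 𝓝 z, p.eval w ∈ N := mem_interior_iff_mem_nhds.1 hz
    have h2 := eventually_eq_of_interior_eq_empty
      (p.differentiable.analyticAt z) interior_segment_eq_empty h1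
    have h3 : p = Polynomial.C (p.eval z) := by
      refine Polynomial.eq_of_infinite_eval_eq _ _ ((infinite_of_mem_nhds z h2).mono ?_)
      intro w hw
      simpa using hw
    rw [h3, Polynomial.eval_C] at hp
    exact hp h1.self_of_nhds
  exact interior_eq_empty_iff_dense_compl.1 this

/-! ### Generic matrices -/

theorem exists_natCast_pow_eq {n : ℕ} (hn : 0 < n) : ∃ p q r t : ℕ, 2 ≤ p ∧ 1 ≤ q ∧ 1 ≤ r ∧ 1 ≤ t ∧
    ((mkSL 2 1 1 1 (by ring) ^ n : SL(2, ℂ)) : Matrix (Fin 2) (Fin 2) ℂ) =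
      !![(p : ℂ), (q : ℂ); (r : ℂ), (t : ℂ)] := by
  induction n, hn using Nat.le_induction with
  | base => exact ⟨2, 1, 1, 1, by omega, by omega, by omega, by omega, by simp⟩
  | succ n hn ih =>
    obtain ⟨p, q, r, t, hp, hq, hr, ht, h⟩ := ih
    refine ⟨p * 2 + q, p + q, r * 2 + t, r + t, by omega, by omega, by omega, by omega, ?_⟩
    rw [pow_succ, Matrix.SpecialLinearGroup.coe_mul, h, coe_mkSL]
    ext i j
    fin_cases i <;> fin_cases j <;> simp

theorem isLoxodromic_pow {n : ℕ} (hn : 0 < n) :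
    IsLoxodromic (mkSL 2 1 1 1 (by ring) ^ n) := by
  obtain ⟨p, q, r, t, hp, hq, hr, ht, h⟩ := exists_natCast_pow_eq hn
  refine ⟨?_, ?_⟩
  · rw [h]; simp; omega
  · intro x hx he
    rw [h] at he
    simp only [Matrix.of_apply, Matrix.cons_val', Matrix.cons_val_zero, Matrix.cons_val_one,
      Matrix.cons_val_fin_one] at he
    have : (p : ℝ) + t = x := by exact_mod_cast he
    have h1 : (2 : ℝ) ≤ p := by exact_mod_cast hp
    have h2 : (1 : ℝ) ≤ t := by exact_mod_cast ht
    linarith [hx.2]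

/-- Arbitrarily small changes of finitely many matrices make all their nonempty products
loxodromic. -/
theorem exists_isLoxodromic_prod {ι : Type*} [Countable ι] (A : ι → SL(2, ℂ))
    {N : Set (ι → SL(2, ℂ))} (hN : N ∈ 𝓝 A) :
    ∃ B ∈ N, ∀ l : List ι, l ≠ [] → IsLoxodromic (l.map B).prod := by
  -- All matrices are deformed to one and the same hyperbolic matrix, so at parameter `1` every
  -- product is a power of it.
  choose γ h0 h1 using fun i => exists_path (A i) (mkSL 2 1 1 1 (by ring))
  have hcont : Continuous fun s : ℂ => fun i => evalSL s (γ i) :=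
    continuous_pi fun i => continuous_evalSL _
  have hN' : ∀ᶠ s : ℂ in 𝓝 0, (fun i => evalSL s (γ i)) ∈ N := by
    refine hcont.continuousAt ?_
    simpa only [h0] using hN
  set p : List ι → Polynomial ℂ := fun l => (l.map γ).prod 0 0 + (l.map γ).prod 1 1
  set q : List ι → Polynomial ℂ := fun l => (l.map γ).prod 1 0
  have hprod : ∀ s, ∀ l : List ι,
      (l.map fun i => evalSL s (γ i)).prod = evalSL s (l.map γ).prod := by
    intro s l
    rw [map_list_prod, List.map_map]
    rfl
  have hT : ∀ l : List ι, l ≠ [] → IsLoxodromic (evalSL 1 (l.map γ).prod) := by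
    intro l hl
    rw [← hprod]
    simp only [h1, List.map_const', List.prod_replicate]
    exact isLoxodromic_pow (List.length_pos_iff.2 hl)
  set good : {l : List ι // l ≠ []} → Set ℂ := fun l =>
    {s | (q l).eval s ≠ 0} ∩ {s | (p l).eval s ∉ (fun r : ℝ => (r : ℂ)) '' Icc (-2) 2}
  have hopen : ∀ l, IsOpen (good l) := fun l =>
    (isOpen_ne_fun (q l).continuous continuous_const).inter
      (isClosed_segment.isOpen_compl.preimage (p l).continuous)
  have hdense : ∀ l, Dense (good l) := by
    intro l
    have hTl := hT l l.2
    refine Dense.inter_of_isOpen_left (dense_setOf_eval_ne_zero ?_)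
      (dense_setOf_eval_notMem_segment (s₁ := 1) ?_)
      (isOpen_ne_fun (q l).continuous continuous_const)
    · intro h
      refine hTl.1 ?_
      rw [evalSL_apply]
      change (q l).eval 1 = 0
      rw [h, Polynomial.eval_zero]
    · rintro ⟨r, hr, he⟩
      refine hTl.2 r hr ?_
      rw [evalSL_apply, evalSL_apply, ← Polynomial.eval_add]
      exact he.symm
  -- Baire: each of the countably many words allows an open dense set of parameters, so a common
  -- good parameter exists arbitrarily close to `0`.
  obtain ⟨s, hs, hsN⟩ := (dense_iInter_of_isOpen hopen hdense).exists_mem_open isOpen_interior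
    ⟨0, mem_interior_iff_mem_nhds.2 hN'⟩
  refine ⟨fun i => evalSL s (γ i), (interior_subset hsN : _), fun l hl => ?_⟩
  have := mem_iInter.1 hs ⟨l, hl⟩
  rw [hprod]
  refine ⟨this.1, fun r hr he => this.2 ⟨r, hr, ?_⟩⟩
  rw [evalSL_apply, evalSL_apply, ← Polynomial.eval_add] at he
  exact he.symm

/-- The translation `z ↦ z + t`. -/
def translation (t : ℂ) : SL(2, ℂ) := mkSL 1 t 0 1 (by ring)

theorem mobius_translation_coe (t z : ℂ) :
    mobius (translation t : PSL(2, ℂ)) (z : RSphere) = ((z + t : ℂ) : RSphere) := by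
  rw [mobius_mk_coe_of_ne (by simp [translation])]
  simp [translation]

theorem mobius_translation_infty (t : ℂ) :
    mobius (translation t : PSL(2, ℂ)) OnePoint.infty = OnePoint.infty := by
  rw [mobius_mk_infty, if_pos (by simp [translation])]

theorem translation_zero : translation 0 = 1 := by
  ext i j
  fin_cases i <;> fin_cases j <;> simp [translation]

theorem translation_inv (t : ℂ) : (translation t)⁻¹ = translation (-t) := by
  rw [inv_eq_iff_mul_eq_one]
  apply Subtype.ext
  rw [Matrix.SpecialLinearGroup.coe_mul]
  ext i j
  fin_cases i <;> fin_cases j <;> simp [translation]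

theorem continuous_translation : Continuous translation := by
  refine Continuous.subtype_mk (continuous_matrix fun i j => ?_) _
  fin_cases i <;> fin_cases j <;> simp <;> fun_prop

/-- Conjugation by a translation changes neither the trace nor the lower left entry. -/
theorem IsLoxodromic.conj_translation {A : SL(2, ℂ)} (hA : IsLoxodromic A) (t : ℂ) :
    IsLoxodromic (translation t * A * (translation t)⁻¹) := by
  have : ((translation t * A * (translation t)⁻¹ : SL(2, ℂ)) : Matrix (Fin 2) (Fin 2) ℂ) =
      !![A 0 0 + t * A 1 0, -(A 0 0 + t * A 1 0) * t + (A 0 1 + t * A 1 1);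
        A 1 0, -A 1 0 * t + A 1 1] := by
    rw [translation_inv, Matrix.SpecialLinearGroup.coe_mul, Matrix.SpecialLinearGroup.coe_mul,
      translation, translation, coe_mkSL, coe_mkSL,
      Matrix.eta_fin_two (A : Matrix (Fin 2) (Fin 2) ℂ)]
    ext i j
    fin_cases i <;> fin_cases j <;> simp
    ring
  refine ⟨by rw [this]; exact hA.1, fun r hr he => hA.2 r hr ?_⟩
  rw [this] at he
  rw [← he]
  simp
  ring

theorem interior_preimage_coe_eq_empty {D : Set RSphere} (hD : interior D = ∅) :
    interior ((↑) ⁻¹' D : Set ℂ) = ∅ := by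
  rw [← OnePoint.isOpenEmbedding_coe.isOpenMap.preimage_interior_eq_interior_preimage
    OnePoint.continuous_coe, hD, preimage_empty]

theorem dense_setOf_add_notMem {D : Set RSphere} (hD : interior D = ∅) (p : ℂ) :
    Dense {t : ℂ | ((p + t : ℂ) : RSphere) ∉ D} := by
  have h1 : interior (Homeomorph.addLeft p ⁻¹' ((↑) ⁻¹' D)) = ∅ := by
    rw [← (Homeomorph.addLeft p).isOpenMap.preimage_interior_eq_interior_preimage
      (Homeomorph.addLeft p).continuous, interior_preimage_coe_eq_empty hD, preimage_empty]
  exact interior_eq_empty_iff_dense_compl.1 h1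

theorem isOpen_setOf_add_notMem {D : Set RSphere} (hD : IsClosed D) (p : ℂ) :
    IsOpen {t : ℂ | ((p + t : ℂ) : RSphere) ∉ D} :=
  hD.isOpen_compl.preimage (OnePoint.continuous_coe.comp (continuous_const.add continuous_id))

/-- For `t` in an open dense set the conjugate of `A` by the translation by `t` does not map
the given point to `D`. -/
theorem exists_open_dense_conj_notMem {D : Set RSphere} (hD : interior D = ∅) (hD' : IsClosed D)
    {A : SL(2, ℂ)} (hc : A 1 0 ≠ 0) (x : RSphere) :
    ∃ U : Set ℂ, IsOpen U ∧ Dense U ∧ ∀ t ∈ U,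
      mobius ((translation t * A * (translation t)⁻¹ : SL(2, ℂ)) : PSL(2, ℂ)) x ∉ D := by
  have hd := det_eq A
  simp_rw [translation_inv, QuotientGroup.mk_mul, mobius_mul]
  induction x using OnePoint.rec with
  | infty =>
    refine ⟨_, isOpen_setOf_add_notMem hD' (A 0 0 / A 1 0), dense_setOf_add_notMem hD _,
      fun t ht => ?_⟩
    rw [mobius_translation_infty, mobius_mk_infty, if_neg hc, mobius_translation_coe]
    exact ht
  | coe x =>
    -- `u t` is the image of `x` and `v t` its denominator. If `u` stayed in `D` on an open set it
    -- would be locally constant; as its derivative is `1 - (v t ^ 2)⁻¹`, this forces `v = ±1`,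
    -- although `v` is injective.
    set v : ℂ → ℂ := fun t => A 1 0 * (x + -t) + A 1 1 with hv
    set u : ℂ → ℂ := fun t => (A 0 0 * (x + -t) + A 0 1) / v t + t with hu
    have hvc : Continuous v := by fun_prop
    have hvd : Differentiable ℂ v := by fun_prop
    have hvinj : Function.Injective v := by
      intro a b hab
      have : A 1 0 * (a - b) = 0 := by
        simp only [hv] at hab; linear_combination -hab
      exact sub_eq_zero.1 ((mul_eq_zero.1 this).resolve_left hc)
    have hVo : IsOpen {t | v t ≠ 0} := isOpen_ne_fun hvc continuous_const
    have hVd : Dense {t | v t ≠ 0} := by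
      have : {t | v t = 0}.Finite := (Set.finite_singleton (0 : ℂ)).preimage hvinj.injOn
      exact this.countable.dense_compl ℂ
    have hua : ∀ t, v t ≠ 0 → HasDerivAt u (1 - ((v t) ^ 2)⁻¹) t := by
      intro t ht
      have h1 : HasDerivAt (fun t => A 0 0 * (x + -t) + A 0 1) (A 0 0 * -1) t :=
        (((hasDerivAt_id t).neg.const_add x).const_mul _).add_const _
      have h2 : HasDerivAt v (A 1 0 * -1) t :=
        (((hasDerivAt_id t).neg.const_add x).const_mul _).add_const _
      convert! (h1.div h2 ht).add (hasDerivAt_id t) using 1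
      field_simp
      simp only [hv]
      linear_combination hd
    have huo : ContinuousOn (fun t => (u t : RSphere)) {t | v t ≠ 0} := fun t ht =>
      (OnePoint.continuous_coe.continuousAt.comp (hua t ht).continuousAt).continuousWithinAt
    refine ⟨{t | v t ≠ 0} ∩ (fun t => (u t : RSphere)) ⁻¹' Dᶜ,
      huo.isOpen_inter_preimage hVo hD'.isOpen_compl, ?_, fun t ht => ?_⟩
    · rw [dense_iff_inter_open]
      intro O hO hOn
      obtain ⟨t, ht, htO⟩ := hVd.exists_mem_open hO hOn
      by_contra hcon
      rw [Set.not_nonempty_iff_eq_empty] at hcon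
      have hmem : ∀ᶠ s in 𝓝 t, s ∈ O ∧ v s ≠ 0 := (hO.eventually_mem htO).and (hVo.eventually_mem ht)
      have h1 : ∀ᶠ s in 𝓝 t, u s ∈ ((↑) ⁻¹' D : Set ℂ) := by
        filter_upwards [hmem] with s hs
        by_contra h
        have : s ∈ O ∩ ({t | v t ≠ 0} ∩ (fun t => (u t : RSphere)) ⁻¹' Dᶜ) := ⟨hs.1, hs.2, h⟩
        rw [hcon] at this
        exact this
      have hu_an : AnalyticAt ℂ u t := by
        rw [Complex.analyticAt_iff_eventually_differentiableAt]
        filter_upwards [hmem] with s hs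
        exact (hua s hs.2).differentiableAt
      have h2 := eventually_eq_of_interior_eq_empty hu_an (interior_preimage_coe_eq_empty hD) h1
      have h3 : ∀ᶠ s in 𝓝 t, v s ∈ ({1, -1} : Set ℂ) := by
        filter_upwards [h2.eventually_nhds, hmem] with s hs hs'
        have h4 : deriv u s = 0 := by
          rw [Filter.EventuallyEq.deriv_eq (f := fun _ => u t) hs, deriv_const]
        rw [(hua s hs'.2).deriv, sub_eq_zero, eq_comm, inv_eq_one] at h4
        exact mul_self_eq_one_iff.1 ((sq (v s)).symm.trans h4)
      exact infinite_of_mem_nhds t h3 ((Set.toFinite {1, -1}).preimage hvinj.injOn)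
    · rw [mobius_translation_coe, mobius_mk_coe_of_ne ht.1, mobius_translation_coe]
      exact ht.2

/-- The fixed points of a loxodromic matrix are finite in number, and infinity is not one. -/
theorem IsLoxodromic.exists_finite_fixed {A : SL(2, ℂ)} (hA : IsLoxodromic A) :
    ∃ S : Set ℂ, S.Finite ∧ ∀ x, mobius (A : PSL(2, ℂ)) x = x → ∃ z ∈ S, x = (z : RSphere) := by
  obtain ⟨a, r, ha, -, htend⟩ := hA.exists_attracting
  refine ⟨(↑) ⁻¹' {a, r}, (Set.toFinite {a, r}).preimage OnePoint.coe_injective.injOn, ?_⟩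
  intro x hx
  have hxi : x ≠ OnePoint.infty := by
    rintro rfl
    rw [mobius_mk_infty, if_neg hA.1] at hx
    exact OnePoint.coe_ne_infty _ hx
  obtain ⟨z, rfl⟩ := OnePoint.ne_infty_iff_exists.1 hxi
  refine ⟨z, ?_, rfl⟩
  by_contra h
  simp only [mem_preimage, mem_insert_iff, mem_singleton_iff, not_or] at h
  refine h.1 (tendsto_nhds_unique ?_ (htend _ h.2))
  exact tendsto_const_nhds.congr fun k => (Function.iterate_fixed hx k).symm

end RSphere

/-! ### Topology of `PSL(2, ℂ)` and countable dense subsets in the sphere -/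

theorem isClosed_center_SL :
    IsClosed ((Subgroup.center SL(2, ℂ) : Subgroup SL(2, ℂ)) : Set SL(2, ℂ)) := by
  have : ((Subgroup.center SL(2, ℂ) : Subgroup SL(2, ℂ)) : Set SL(2, ℂ)) =
      ⋂ g : SL(2, ℂ), {x | g * x = x * g} := by
    ext x
    simp [Subgroup.mem_center_iff]
  rw [this]
  have : T2Space SL(2, ℂ) := inferInstance
  exact isClosed_iInter fun g => isClosed_eq (by fun_prop) (by fun_prop)

/-- Makes distinctness of two branches an open condition. -/
instance : T2Space PSL(2, ℂ) := by
  have := isClosed_center_SL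
  infer_instance

/-- Any relatively open piece of `D` contains a point of `X`, so a boundary return is excluded by
testing countably many points. -/
theorem exists_countable_dense_in (D : Set RSphere) :
    ∃ X : Set RSphere, X.Countable ∧ X ⊆ D ∧
      ∀ W, IsOpen W → (W ∩ D).Nonempty → (W ∩ X).Nonempty := by
  obtain ⟨Y, hYD, hY, hYd⟩ := (TopologicalSpace.IsSeparable.of_separableSpace
    ((↑) ⁻¹' D : Set ℂ)).exists_countable_dense_subset
  refine ⟨(↑) '' Y ∪ ({OnePoint.infty} ∩ D), (hY.image _).union
    ((Set.countable_singleton _).mono inter_subset_left), ?_, ?_⟩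
  · rintro _ (⟨y, hy, rfl⟩ | ⟨-, h⟩)
    · exact hYD hy
    · exact h
  · rintro W hW ⟨x, hxW, hxD⟩
    induction x using OnePoint.rec with
    | infty => exact ⟨_, hxW, Or.inr ⟨rfl, hxD⟩⟩
    | coe x =>
      obtain ⟨y, hy, hy'⟩ := mem_closure_iff.1 (hYd hxD) _ (hW.preimage OnePoint.continuous_coe) hxW
      exact ⟨y, hy, Or.inl ⟨y, hy', rfl⟩⟩

/-! ### Perturbing the branches to a generic transformation -/

namespace PMT

variable {K : ℕ}

/-- Keeping the regions, the branches can be changed arbitrarily little so that the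
transformation becomes generic. -/
theorem exists_isGeneric (F : PMT K) {𝒩 : Set (Fin K → PSL(2, ℂ))} (h𝒩 : 𝒩 ∈ 𝓝 F.f) :
    ∃ G : PMT K, G.R = F.R ∧ G.f ∈ 𝒩 ∧ G.IsGeneric := by
  choose A hA using fun k => QuotientGroup.mk_surjective (F.f k)
  let π : (Fin K → SL(2, ℂ)) → (Fin K → PSL(2, ℂ)) := fun B k => (B k : PSL(2, ℂ))
  have hπ : Continuous π := continuous_pi fun k =>
    QuotientGroup.continuous_mk.comp (continuous_apply k)
  have hπA : π A = F.f := funext hA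
  -- Besides closeness to `F`, distinct branches must remain distinct, which preserves `minimal`.
  set M : Set (Fin K → SL(2, ℂ)) :=
    {B | π B ∈ 𝒩 ∧ ∀ j k, F.f j ≠ F.f k → π B j ≠ π B k} with hM
  have hMA : M ∈ 𝓝 A := by
    refine inter_mem (hπ.continuousAt (by rwa [hπA])) ?_
    refine eventually_all.2 fun j => eventually_all.2 fun k => ?_
    by_cases hjk : F.f j = F.f k
    · exact Eventually.of_forall fun B h => absurd hjk h
    · have h1 : ContinuousAt (fun B => π B j) A := ((continuous_apply j).comp hπ).continuousAt
      have h2 : ContinuousAt (fun B => π B k) A := ((continuous_apply k).comp hπ).continuousAt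
      filter_upwards [(h1.ne_iff_eventually_ne h2).1 (by rw [hπA]; exact hjk)] with B hB _
      exact hB
  obtain ⟨B, hBM, hB⟩ := exists_isLoxodromic_prod A (interior_mem_nhds.2 hMA)
  have hdisc := F.interior_disc
  choose X hXc hXsub hXd using fun k => exists_countable_dense_in (frontier (F.R k))
  -- Conjugating all branches by one translation keeps every product loxodromic and moves the fixed
  -- points, while the regions stay put.
  let C : ℂ → Fin K → SL(2, ℂ) := fun t k => translation t * B k * (translation t)⁻¹
  have hCprod : ∀ t, ∀ l : List (Fin K), (l.map (C t)).prod =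
      translation t * (l.map B).prod * (translation t)⁻¹ := by
    intro t l
    induction l with
    | nil => simp
    | cons k l ih => rw [List.map_cons, List.prod_cons, ih, List.map_cons, List.prod_cons]; simp only [C]; group
  have hCM : ∀ᶠ t in 𝓝 0, C t ∈ interior M := by
    have hC : Continuous C := continuous_pi fun k =>
      (continuous_translation.mul continuous_const).mul continuous_translation.inv
    refine hC.continuousAt (isOpen_interior.mem_nhds ?_)
    simpa [C, translation_zero] using hBM
  choose S hSf hS using fun l : {l : List (Fin K) // l ≠ []} =>
    (hB l.1 l.2).exists_finite_fixed
  have hfix : ∀ᶠ t in residual ℂ, ∀ l : {l : List (Fin K) // l ≠ []}, ∀ z ∈ S l,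
      ((z + t : ℂ) : RSphere) ∉ F.disc := by
    refine eventually_countable_forall.2 fun l => ?_
    refine (eventually_countable_ball (hSf l).countable).2 fun z _ => ?_
    exact residual_of_dense_open (isOpen_setOf_add_notMem F.isClosed_disc z)
      (dense_setOf_add_notMem hdisc z)
  have hret : ∀ᶠ t in residual ℂ, ∀ l : {l : List (Fin K) // l ≠ []}, ∀ k, ∀ x ∈ X k,
      mobius ((translation t * (l.1.map B).prod * (translation t)⁻¹ : SL(2, ℂ)) : PSL(2, ℂ)) x ∉
        F.disc := by
    refine eventually_countable_forall.2 fun l => eventually_countable_forall.2 fun k => ?_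
    refine (eventually_countable_ball (hXc k)).2 fun x _ => ?_
    obtain ⟨U, hUo, hUd, hU⟩ := exists_open_dense_conj_notMem hdisc F.isClosed_disc
      (hB l.1 l.2).1 x
    exact mem_of_superset (residual_of_dense_open hUo hUd) hU
  obtain ⟨t, ⟨ht1, ht2⟩, ht3⟩ := (dense_of_mem_residual (hfix.and hret)).exists_mem_open
    isOpen_interior ⟨0, mem_interior_iff_mem_nhds.2 hCM⟩
  have hCt : C t ∈ M := interior_subset (interior_subset (s := {t | C t ∈ interior M}) ht3 : C t ∈ interior M)
  let G : PMT K := { F with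
    f := π (C t)
    minimal := fun j k hjk harc => hCt.2 j k (F.minimal j k hjk harc) }
  have hcomp : ∀ w n, 0 < n → ∃ l : {l : List (Fin K) // l ≠ []},
      compAlong G.f w n = ((translation t * (l.1.map B).prod * (translation t)⁻¹ : SL(2, ℂ)) :
        PSL(2, ℂ)) := by
    intro w n hn
    obtain ⟨l, hl, hcl⟩ := compAlong_eq_prod w n
    refine ⟨⟨l, by rintro rfl; simp at hl; omega⟩, ?_⟩
    rw [hcl, ← hCprod]
    change (l.map (fun k => QuotientGroup.mk' _ (C t k))).prod = QuotientGroup.mk' _ _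
    rw [map_list_prod, List.map_map]
    rfl
  refine ⟨G, rfl, hCt.1, ?_, ?_, ?_⟩
  · intro w n hn
    obtain ⟨l, hl⟩ := hcomp w n hn
    exact ⟨_, hl.symm, (hB l.1 l.2).conj_translation t⟩
  · intro w n hn b hb hbfix
    obtain ⟨l, hl⟩ := hcomp w n hn
    rw [hl, QuotientGroup.mk_mul, QuotientGroup.mk_mul, QuotientGroup.mk_inv, mobius_mul,
      mobius_mul] at hbfix
    have h1 := congr_arg (mobius ((translation t : PSL(2, ℂ))⁻¹)) hbfix
    rw [mobius_inv_apply] at h1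
    obtain ⟨z, hz, hz'⟩ := hS l _ h1
    refine ht1 l z hz ?_
    rw [← mobius_translation_coe, ← hz', mobius_apply_inv]
    exact hb
  · rintro ⟨w, n, hn, W, hW, hne, hx⟩
    obtain ⟨x, hxW, hxX⟩ := hXd (w 0) W hW hne
    obtain ⟨l, hl⟩ := hcomp w n hn
    refine ht2 l (w 0) x hxX ?_
    rw [← hl]
    exact (hx x ⟨hxW, hXsub _ hxX⟩).2

end PMT

/-! ### Diffeomorphisms of the plane with compact support -/


/-- The homeomorphism `φ` of the plane is a diffeomorphism that is the identity outside a compact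
subset of `Ω`. -/
structure IsSupportedDiffeo (Ω : Set ℂ) (φ : ℂ ≃ₜ ℂ) : Prop where
  contDiff : ContDiff ℝ ∞ φ
  injective_fderiv : ∀ x, Function.Injective (fderiv ℝ φ x)
  exists_support : ∃ S ⊆ Ω, IsCompact S ∧ ∀ x ∉ S, φ x = x

namespace IsSupportedDiffeo

variable {Ω : Set ℂ} {φ ψ : ℂ ≃ₜ ℂ}

theorem refl (Ω : Set ℂ) : IsSupportedDiffeo Ω (Homeomorph.refl ℂ) where
  contDiff := contDiff_id
  injective_fderiv x := by
    change Function.Injective (fderiv ℝ id x)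
    rw [fderiv_id]
    exact Function.injective_id
  exists_support := ⟨∅, empty_subset _, isCompact_empty, fun _ _ => rfl⟩

theorem differentiable (h : IsSupportedDiffeo Ω φ) : Differentiable ℝ φ :=
  h.contDiff.differentiable (by simp)

theorem trans (h : IsSupportedDiffeo Ω φ) (h' : IsSupportedDiffeo Ω ψ) :
    IsSupportedDiffeo Ω (φ.trans ψ) where
  contDiff := h'.contDiff.comp h.contDiff
  injective_fderiv x := by
    change Function.Injective (fderiv ℝ (ψ ∘ φ) x)
    rw [fderiv_comp x (h'.differentiable _) (h.differentiable _)]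
    exact (h'.injective_fderiv _).comp (h.injective_fderiv _)
  exists_support := by
    obtain ⟨S, hS, hSc, hSφ⟩ := h.exists_support
    obtain ⟨T, hT, hTc, hTψ⟩ := h'.exists_support
    refine ⟨S ∪ T, union_subset hS hT, hSc.union hTc, fun x hx => ?_⟩
    rw [mem_union, not_or] at hx
    rw [Homeomorph.trans_apply, hSφ x hx.1, hTψ x hx.2]

theorem mono {Ω' : Set ℂ} (h : IsSupportedDiffeo Ω φ) (hΩ : Ω ⊆ Ω') :
    IsSupportedDiffeo Ω' φ where
  contDiff := h.contDiff
  injective_fderiv := h.injective_fderiv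
  exists_support := by
    obtain ⟨S, hS, hSc, hSφ⟩ := h.exists_support
    exact ⟨S, hS.trans hΩ, hSc, hSφ⟩

end IsSupportedDiffeo

/-- A smooth map that is close to the identity and differs from it only on a compact set is a
diffeomorphism. -/
theorem exists_isSupportedDiffeo_id_add {p : ℂ → ℂ} (hp : ContDiff ℝ ∞ p)
    (hb : ∀ x, ‖fderiv ℝ p x‖ ≤ 1 / 2) {S : Set ℂ} (hS : IsCompact S) (hpS : ∀ x ∉ S, p x = 0) :
    ∃ φ, IsSupportedDiffeo S φ ∧ ∀ x, φ x = x + p x := by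
  have hd : Differentiable ℝ p := hp.differentiable (by simp)
  -- The displacement is a contraction, so the map is a homeomorphism by the Lipschitz inverse
  -- function theorem.
  have hLip : LipschitzWith (1 / 2) p := lipschitzWith_of_nnnorm_fderiv_le hd fun x => by
    rw [← NNReal.coe_le_coe, coe_nnnorm]
    simpa using hb x
  have happ : ApproximatesLinearOn (fun x => x + p x)
      ((ContinuousLinearEquiv.refl ℝ ℂ : ℂ ≃L[ℝ] ℂ) : ℂ →L[ℝ] ℂ) univ (1 / 2) := by
    intro x _ y _
    have := hLip.dist_le_mul x y
    rw [dist_eq_norm, dist_eq_norm] at this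
    change ‖x + p x - (y + p y) - (x - y)‖ ≤ _
    rwa [show x + p x - (y + p y) - (x - y) = p x - p y by ring]
  have hc : Subsingleton ℂ ∨ (1 / 2 : NNReal) <
      ‖((ContinuousLinearEquiv.refl ℝ ℂ).symm : ℂ →L[ℝ] ℂ)‖₊⁻¹ := by
    right
    have : ((ContinuousLinearEquiv.refl ℝ ℂ).symm : ℂ →L[ℝ] ℂ) = ContinuousLinearMap.id ℝ ℂ := rfl
    rw [this, ← NNReal.coe_lt_coe, NNReal.coe_inv, coe_nnnorm, ContinuousLinearMap.norm_id]
    norm_num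
  refine ⟨happ.toHomeomorph _ hc, ⟨contDiff_id.add hp, fun x => ?_, S, subset_rfl, hS, ?_⟩,
    fun x => rfl⟩
  · change Function.Injective (fderiv ℝ (fun x => x + p x) x)
    rw [fderiv_fun_add differentiableAt_fun_id (hd x), fderiv_fun_id]
    refine (injective_iff_map_eq_zero _).2 fun v hv => ?_
    have h1 : v = -(fderiv ℝ p x v) := eq_neg_of_add_eq_zero_left hv
    have h2 : ‖v‖ ≤ 1 / 2 * ‖v‖ := by
      calc ‖v‖ = ‖-(fderiv ℝ p x v)‖ := congr_arg _ h1
        _ = ‖fderiv ℝ p x v‖ := norm_neg _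
        _ ≤ ‖fderiv ℝ p x‖ * ‖v‖ := ContinuousLinearMap.le_opNorm _ _
        _ ≤ _ := by gcongr; exact hb x
    have h3 := norm_nonneg v
    exact norm_eq_zero.1 (by linarith)
  · intro x hx
    change x + p x = x
    rw [hpS x hx, add_zero]

/-- Localization of a small smooth displacement `q` to a ball. -/
theorem exists_isSupportedDiffeo_bump : ∃ κ > 0, ∀ (z₀ : ℂ) (r : ℝ) (q : ℂ → ℂ), 0 < r →
    (∀ x ∈ Metric.closedBall z₀ (2 * r), ContDiffAt ℝ ∞ q x ∧ ‖q x‖ ≤ κ * r ∧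
      ‖fderiv ℝ q x‖ ≤ κ) →
    ∃ φ, IsSupportedDiffeo (Metric.closedBall z₀ (2 * r)) φ ∧
      ∀ x ∈ Metric.closedBall z₀ r, φ x = x + q x := by
  let f : ContDiffBump (0 : ℂ) := ⟨1, 2, one_pos, one_lt_two⟩
  have hf : ContDiff ℝ ∞ f := f.contDiff
  obtain ⟨C, hC⟩ := (hf.continuous_fderiv (by simp)).bounded_above_of_compact_support
    (f.hasCompactSupport.fderiv ℝ)
  have hC0 : 0 ≤ C := (norm_nonneg _).trans (hC 0)
  -- `C` bounds the derivative of the unscaled bump, so the derivative of `χ • q` is at most `κ + (C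
  -- / r) * (κ * r) = 1 / 2`, whatever the radius.
  refine ⟨(2 * (C + 1))⁻¹, by positivity, fun z₀ r q hr hq => ?_⟩
  set κ := (2 * (C + 1))⁻¹ with hκ
  have hκ0 : 0 < κ := by positivity
  set χ : ℂ → ℝ := fun x => f (r⁻¹ • (x - z₀)) with hχ
  have hχs : ContDiff ℝ ∞ χ := hf.comp ((contDiff_id.sub contDiff_const).const_smul r⁻¹)
  have hnorm : ∀ x, ‖r⁻¹ • (x - z₀)‖ = ‖x - z₀‖ / r := fun x => by
    rw [norm_smul, norm_inv, Real.norm_of_nonneg hr.le, div_eq_inv_mul]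
  have hχ0 : ∀ x ∉ Metric.closedBall z₀ (2 * r), χ x = 0 := by
    intro x hx
    refine f.zero_of_le_dist ?_
    rw [dist_zero_right, hnorm]
    rw [Metric.mem_closedBall, dist_eq_norm, not_le] at hx
    exact ((lt_div_iff₀ hr).2 hx).le
  have hχ1 : ∀ x ∈ Metric.closedBall z₀ r, χ x = 1 := by
    intro x hx
    refine f.one_of_mem_closedBall ?_
    rw [mem_closedBall_zero_iff, hnorm]
    rw [Metric.mem_closedBall, dist_eq_norm] at hx
    exact (div_le_one hr).2 hx
  have hχd : ∀ x, ‖fderiv ℝ χ x‖ ≤ C / r := by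
    intro x
    have h1 : HasFDerivAt (fun x : ℂ => r⁻¹ • (x - z₀)) (r⁻¹ • ContinuousLinearMap.id ℝ ℂ) x :=
      ((hasFDerivAt_id x).sub_const z₀).const_smul r⁻¹
    have h2 : HasFDerivAt χ _ x :=
      HasFDerivAt.comp (g := (f : ℂ → ℝ)) (f := fun x : ℂ => r⁻¹ • (x - z₀)) x
        ((hf.differentiable (by simp)) _).hasFDerivAt h1
    rw [h2.fderiv]
    calc _ ≤ ‖fderiv ℝ f (r⁻¹ • (x - z₀))‖ * ‖r⁻¹ • ContinuousLinearMap.id ℝ ℂ‖ :=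
          ContinuousLinearMap.opNorm_comp_le _ _
      _ ≤ C * r⁻¹ := by
          gcongr
          · exact hC _
          · rw [norm_smul, ContinuousLinearMap.norm_id, mul_one, norm_inv,
              Real.norm_of_nonneg hr.le]
      _ = C / r := (div_eq_mul_inv _ _).symm
  have hp0 : ∀ x ∉ Metric.closedBall z₀ (2 * r), (fun x => χ x • q x) =ᶠ[𝓝 x] fun _ => 0 := by
    intro x hx
    filter_upwards [Metric.isClosed_closedBall.isOpen_compl.mem_nhds hx] with y hy
    rw [hχ0 y hy, zero_smul]
  have hp : ContDiff ℝ ∞ fun x => χ x • q x := by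
    rw [contDiff_iff_contDiffAt]
    intro x
    by_cases hx : x ∈ Metric.closedBall z₀ (2 * r)
    · exact hχs.contDiffAt.smul (hq x hx).1
    · exact contDiffAt_const.congr_of_eventuallyEq (hp0 x hx)
  have hpb : ∀ x, ‖fderiv ℝ (fun x => χ x • q x) x‖ ≤ 1 / 2 := by
    intro x
    by_cases hx : x ∈ Metric.closedBall z₀ (2 * r)
    · obtain ⟨h1, h2, h3⟩ := hq x hx
      rw [fderiv_fun_smul (hχs.differentiable (by simp) x) (h1.differentiableAt (by simp))]
      have h4 : ‖χ x‖ ≤ 1 := by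
        rw [Real.norm_of_nonneg f.nonneg]
        exact f.le_one
      calc _ ≤ ‖χ x • fderiv ℝ q x‖ + ‖(fderiv ℝ χ x).smulRight (q x)‖ := norm_add_le _ _
        _ ≤ 1 * κ + C / r * (κ * r) := by
            rw [norm_smul, ContinuousLinearMap.norm_smulRight_apply]
            gcongr
            exact hχd x
        _ = 1 / 2 := by rw [hκ]; field_simp; ring
    · rw [(hp0 x hx).fderiv_eq, fderiv_fun_const]
      simp
  obtain ⟨φ, hφ, hφq⟩ := exists_isSupportedDiffeo_id_add hp hpb
    (isCompact_closedBall z₀ (2 * r)) fun x hx => (hp0 x hx).self_of_nhds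
  refine ⟨φ, hφ, fun x hx => ?_⟩
  rw [hφq, hχ1 x hx, one_smul]

theorem exists_closedBall_two_mul_subset {Ω : Set ℂ} {z : ℂ} (h : Ω ∈ 𝓝 z) :
    ∃ r > 0, Metric.closedBall z (2 * r) ⊆ Ω := by
  obtain ⟨ε, hε, hεΩ⟩ := Metric.nhds_basis_closedBall.mem_iff.1 h
  exact ⟨ε / 2, half_pos hε, by rwa [mul_div_cancel₀ _ two_ne_zero]⟩

/-- Compactly supported diffeomorphisms act transitively on a connected open set. -/
theorem exists_isSupportedDiffeo_apply_eq {Ω : Set ℂ} (hΩ : IsOpen Ω) (hc : IsPreconnected Ω)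
    {x y : ℂ} (hx : x ∈ Ω) (hy : y ∈ Ω) : ∃ φ, IsSupportedDiffeo Ω φ ∧ φ x = y := by
  obtain ⟨κ, hκ, H⟩ := exists_isSupportedDiffeo_bump
  -- The relation is transitive, and truncated small translations relate nearby points in both
  -- directions.
  refine hc.induction₂' (fun x y => ∃ φ, IsSupportedDiffeo Ω φ ∧ φ x = y) ?_ ?_ hx hy
  · intro x hx
    obtain ⟨r, hr, hrΩ⟩ := exists_closedBall_two_mul_subset (hΩ.mem_nhds hx)
    have hnear : ∀ᶠ y in 𝓝[Ω] x, ‖y - x‖ ≤ κ * r ∧ y ∈ Metric.closedBall x r := by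
      filter_upwards [mem_nhdsWithin_of_mem_nhds (Metric.closedBall_mem_nhds x hr),
        mem_nhdsWithin_of_mem_nhds (Metric.closedBall_mem_nhds x (mul_pos hκ hr))] with y h1 h2
      rw [Metric.mem_closedBall, dist_eq_norm] at h2
      exact ⟨h2, h1⟩
    filter_upwards [hnear] with y hy
    have key : ∀ v : ℂ, ‖v‖ ≤ κ * r → ∃ φ, IsSupportedDiffeo Ω φ ∧
        ∀ u ∈ Metric.closedBall x r, φ u = u + v := by
      intro v hv
      obtain ⟨φ, hφ, hφv⟩ := H x r (fun _ => v) hr fun u _ =>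
        ⟨contDiffAt_const, hv, by simp [hκ.le]⟩
      exact ⟨φ, hφ.mono hrΩ, hφv⟩
    obtain ⟨φ, hφ, hφv⟩ := key (y - x) hy.1
    obtain ⟨ψ, hψ, hψv⟩ := key (x - y) (by rw [norm_sub_rev]; exact hy.1)
    refine ⟨⟨φ, hφ, ?_⟩, ⟨ψ, hψ, ?_⟩⟩
    · rw [hφv _ (Metric.mem_closedBall_self hr.le)]; ring
    · rw [hψv _ hy.2]; ring
  · rintro x y z - - - ⟨φ, hφ, rfl⟩ ⟨ψ, hψ, rfl⟩
    exact ⟨φ.trans ψ, hφ.trans hψ, rfl⟩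

/-- Every similarity with fixed point `z` is locally the restriction of a compactly supported
diffeomorphism. -/
theorem exists_isSupportedDiffeo_similarity {Ω : Set ℂ} {z : ℂ} (hΩ : Ω ∈ 𝓝 z) {μ : ℂ}
    (hμ : μ ≠ 0) : ∃ φ, IsSupportedDiffeo Ω φ ∧ ∀ᶠ x in 𝓝 z, φ x = z + μ * (x - z) := by
  obtain ⟨κ, hκ, H⟩ := exists_isSupportedDiffeo_bump
  obtain ⟨r, hr, hrΩ⟩ := exists_closedBall_two_mul_subset hΩ
  have key : ∀ ν : ℂ, ‖ν - 1‖ ≤ κ / 2 → ∃ φ, IsSupportedDiffeo Ω φ ∧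
      ∀ᶠ x in 𝓝 z, φ x = z + ν * (x - z) := by
    intro ν hν
    obtain ⟨φ, hφ, hφv⟩ := H z r (fun x => (ν - 1) * (x - z)) hr fun x hx => by
      have h1 : HasFDerivAt (fun x : ℂ => (ν - 1) * (x - z))
          ((ν - 1) • ContinuousLinearMap.id ℝ ℂ) x :=
        ((hasFDerivAt_id (𝕜 := ℝ) x).sub_const z).const_mul (ν - 1)
      refine ⟨contDiffAt_const.mul (contDiffAt_id.sub contDiffAt_const), ?_, ?_⟩
      · rw [Metric.mem_closedBall, dist_eq_norm] at hx
        rw [norm_mul]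
        calc ‖ν - 1‖ * ‖x - z‖ ≤ κ / 2 * (2 * r) := by gcongr
          _ = κ * r := by ring
      · rw [h1.fderiv, norm_smul, ContinuousLinearMap.norm_id, mul_one]
        linarith
    refine ⟨φ, hφ.mono hrΩ, ?_⟩
    filter_upwards [Metric.closedBall_mem_nhds z hr] with x hx
    rw [hφv x hx]; ring
  -- Multiplication by `μ` may be far from the identity. It is the `n`-fold composition of
  -- multiplication by the root `exp (log μ / n)`, which is close to `1` for large `n`.
  have hlim : Tendsto (fun n : ℕ => Complex.exp (Complex.log μ / n)) atTop (𝓝 1) := by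
    have h1 : Tendsto (fun n : ℕ => Complex.log μ / n) atTop (𝓝 0) :=
      tendsto_const_div_atTop_nhds_zero_nat _
    have h2 := (Complex.continuous_exp.tendsto 0).comp h1
    rw [Complex.exp_zero] at h2
    exact h2
  have hev : ∀ᶠ n : ℕ in atTop, ‖Complex.exp (Complex.log μ / n) - 1‖ ≤ κ / 2 := by
    have := hlim.eventually (Metric.closedBall_mem_nhds (1 : ℂ) (half_pos hκ))
    simpa only [Metric.mem_closedBall, dist_eq_norm] using this
  obtain ⟨n, hn, hn0⟩ := (hev.and (eventually_gt_atTop 0)).exists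
  set ν := Complex.exp (Complex.log μ / n) with hν
  have hνn : ν ^ n = μ := by
    rw [hν, ← Complex.exp_nat_mul, mul_div_cancel₀ _ (by exact_mod_cast hn0.ne'),
      Complex.exp_log hμ]
  obtain ⟨φ, hφ, hφv⟩ := key ν hn
  rw [← hνn]
  clear hνn hν hn hn0
  clear_value ν
  induction n with
  | zero =>
    exact ⟨_, IsSupportedDiffeo.refl Ω, Eventually.of_forall fun x => by simp⟩
  | succ n ih =>
    obtain ⟨ψ, hψ, hψv⟩ := ih
    refine ⟨φ.trans ψ, hφ.trans hψ, ?_⟩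
    have hφz : φ z = z := by rw [hφv.self_of_nhds]; ring
    have h2 : ∀ᶠ x in 𝓝 z, ψ (φ x) = z + ν ^ n * (φ x - z) :=
      (φ.continuous.tendsto' z z hφz).eventually hψv
    filter_upwards [hφv, h2] with x h1 h2
    rw [Homeomorph.trans_apply, h2, h1, pow_succ]; ring

/-- A smooth germ that is tangent to the identity at `z` is the germ of a compactly supported
diffeomorphism. -/
theorem exists_isSupportedDiffeo_tangent_id {Ω : Set ℂ} {z : ℂ} (hΩ : Ω ∈ 𝓝 z) {q : ℂ → ℂ}
    (hq : ∀ᶠ x in 𝓝 z, ContDiffAt ℝ ∞ q x) (hq0 : q z = 0) (hq1 : fderiv ℝ q z = 0) :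
    ∃ φ, IsSupportedDiffeo Ω φ ∧ ∀ᶠ x in 𝓝 z, φ x = x + q x := by
  obtain ⟨κ, hκ, H⟩ := exists_isSupportedDiffeo_bump
  have hcont : ContinuousAt (fderiv ℝ q) z :=
    (hq.self_of_nhds.fderiv_right (m := 0) (by simp)).continuousAt
  have hsmall : ∀ᶠ x in 𝓝 z, ‖fderiv ℝ q x‖ ≤ κ / 2 := by
    have h1 : Tendsto (fun x => ‖fderiv ℝ q x‖) (𝓝 z) (𝓝 0) := by
      have := hcont.norm.tendsto
      rwa [hq1, norm_zero] at this
    exact h1.eventually (ge_mem_nhds (half_pos hκ))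
  -- On a small ball the derivative of `q` is at most `κ / 2`, so the mean value inequality gives
  -- the bound `κ * r` for `q` itself.
  obtain ⟨r, hr, hrΩ⟩ := exists_closedBall_two_mul_subset (inter_mem hΩ (hq.and hsmall))
  obtain ⟨φ, hφ, hφv⟩ := H z r q hr fun x hx => by
    refine ⟨(hrΩ hx).2.1, ?_, (hrΩ hx).2.2.trans (by linarith)⟩
    have h1 := (convex_closedBall z (2 * r)).norm_image_sub_le_of_norm_fderiv_le (𝕜 := ℝ) (f := q)
      (fun x hx => (hrΩ hx).2.1.differentiableAt (by simp)) (fun x hx => (hrΩ hx).2.2)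
      (Metric.mem_closedBall_self (by positivity)) hx
    rw [hq0, sub_zero] at h1
    rw [Metric.mem_closedBall, dist_eq_norm] at hx
    calc ‖q x‖ ≤ κ / 2 * ‖x - z‖ := h1
      _ ≤ κ / 2 * (2 * r) := by gcongr
      _ = κ * r := by ring
  refine ⟨φ, hφ.mono fun x hx => (hrΩ hx).1, ?_⟩
  filter_upwards [Metric.closedBall_mem_nhds z hr] with x hx using hφv x hx

/-- The local inverse of a smooth real function with nonzero derivative. -/
theorem exists_smooth_local_inverse {x : ℝ → ℝ} {t₀ : ℝ} (hx : ∀ᶠ t in 𝓝 t₀, ContDiffAt ℝ ∞ x t)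
    (hx1 : deriv x t₀ ≠ 0) : ∃ ψ : ℝ → ℝ, (∀ᶠ t in 𝓝 t₀, ψ (x t) = t) ∧
      ∀ᶠ s in 𝓝 (x t₀), ContDiffAt ℝ ∞ ψ s := by
  have hs := (hx.self_of_nhds.hasStrictDerivAt (by simp)).hasStrictFDerivAt_equiv hx1
  set e := hs.toOpenPartialHomeomorph x with he
  have hex : (e : ℝ → ℝ) = x := hs.toOpenPartialHomeomorph_coe
  have hsrc : t₀ ∈ e.source := hs.mem_toOpenPartialHomeomorph_source
  refine ⟨e.symm, ?_, ?_⟩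
  · filter_upwards [e.open_source.mem_nhds hsrc] with t ht
    rw [← hex, e.left_inv ht]
  · have htgt : x t₀ ∈ e.target := by rw [← hex]; exact e.map_source hsrc
    have hsymm : e.symm (x t₀) = t₀ := by rw [← hex, e.left_inv hsrc]
    have hd : ∀ᶠ t in 𝓝 t₀, deriv x t ≠ 0 := by
      have : ContinuousAt (deriv x) t₀ := by
        have h1 := (hx.self_of_nhds.fderiv_right (m := 0) (by simp)).continuousAt
        exact h1.clm_apply continuousAt_const
      exact this.eventually_ne hx1
    have hcs : Tendsto e.symm (𝓝 (x t₀)) (𝓝 t₀) := by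
      have := e.continuousAt_symm htgt
      rwa [ContinuousAt, hsymm] at this
    filter_upwards [e.open_target.mem_nhds htgt, hcs.eventually hd, hcs.eventually hx]
      with s h1 h2 h3
    refine e.contDiffAt_symm_deriv h2 h1 ?_ (by rwa [hex])
    rw [hex]
    exact (h3.differentiableAt (by simp)).hasDerivAt

/-- A smooth arc in a connected open set can be moved onto another one by a compactly supported
diffeomorphism, locally at given points. -/
theorem exists_isSupportedDiffeo_arc {Ω : Set ℂ} (hΩ : IsOpen Ω) (hc : IsPreconnected Ω)
    {α β : ℝ → ℂ} {s₀ t₀ : ℝ} (hα : ∀ᶠ s in 𝓝 s₀, ContDiffAt ℝ ∞ α s) (hα1 : deriv α s₀ ≠ 0)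
    (hαΩ : α s₀ ∈ Ω) (hβ : ∀ᶠ t in 𝓝 t₀, ContDiffAt ℝ ∞ β t) (hβ1 : deriv β t₀ ≠ 0)
    (hβΩ : β t₀ ∈ Ω) :
    ∃ φ, IsSupportedDiffeo Ω φ ∧ ∀ᶠ t in 𝓝 t₀, φ (β t) = α (s₀ + (t - t₀)) := by
  set z := α s₀ with hz
  have hΩz : Ω ∈ 𝓝 z := hΩ.mem_nhds hαΩ
  -- The arcs are matched to increasing order: the base point by `φ₁`, the velocity by the
  -- similarity `φ₂`, the whole germ by `φ₃`.
  obtain ⟨φ₁, hφ₁, hφ₁z⟩ := exists_isSupportedDiffeo_apply_eq hΩ hc hβΩ hαΩ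
  set β₁ : ℝ → ℂ := fun t => φ₁ (β t) with hβ₁
  have hβ₁s : ∀ᶠ t in 𝓝 t₀, ContDiffAt ℝ ∞ β₁ t := by
    filter_upwards [hβ] with t ht using hφ₁.contDiff.contDiffAt.comp t ht
  have hβ₁d : deriv β₁ t₀ ≠ 0 := by
    have h1 : HasDerivAt β₁ (fderiv ℝ φ₁ (β t₀) (deriv β t₀)) t₀ :=
      (hφ₁.differentiable (β t₀)).hasFDerivAt.comp_hasDerivAt t₀
        (hβ.self_of_nhds.differentiableAt (by simp)).hasDerivAt
    rw [h1.deriv]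
    intro h
    exact hβ1 (hφ₁.injective_fderiv _ (h.trans (map_zero _).symm))
  obtain ⟨φ₂, hφ₂, hφ₂z⟩ := exists_isSupportedDiffeo_similarity hΩz (div_ne_zero hα1 hβ₁d)
  set μ := deriv α s₀ / deriv β₁ t₀ with hμ
  have hβ₁z : β₁ t₀ = z := hφ₁z
  set b : ℝ → ℂ := fun t => z + μ * (β₁ t - z) with hb
  have hbz : b t₀ = z := by simp only [hb, hβ₁z]; ring
  have hbs : ∀ᶠ t in 𝓝 t₀, ContDiffAt ℝ ∞ b t := by
    filter_upwards [hβ₁s] with t ht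
    exact contDiffAt_const.add (contDiffAt_const.mul (ht.sub contDiffAt_const))
  have hbd : HasDerivAt b (deriv α s₀) t₀ := by
    have := (((hβ₁s.self_of_nhds.differentiableAt (by simp)).hasDerivAt.sub_const z).const_mul
      μ).const_add z
    convert! this using 1
    rw [hμ, div_mul_cancel₀ _ hβ₁d]
  set v := deriv α s₀ with hv
  -- `L` is the component along the velocity `v`, so `t ↦ L (b t - z)` is locally invertible; its
  -- inverse yields a function `τ` on the plane with `τ (b t) = t` near `t₀`.
  set L : ℂ →L[ℝ] ℝ := Complex.reCLM.comp (ContinuousLinearMap.mul ℝ ℂ v⁻¹) with hL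
  have hLx : ∀ x, L x = (v⁻¹ * x).re := fun x => rfl
  set x : ℝ → ℝ := fun t => L (b t - z) with hx
  have hxs : ∀ᶠ t in 𝓝 t₀, ContDiffAt ℝ ∞ x t := by
    filter_upwards [hbs] with t ht
    exact L.contDiff.contDiffAt.comp t (ht.sub contDiffAt_const)
  have hxd : HasDerivAt x 1 t₀ := by
    have h1 := (L.hasFDerivAt (x := b t₀ - z)).comp_hasDerivAt t₀ (hbd.sub_const z)
    have h2 : L v = 1 := by rw [hLx, inv_mul_cancel₀ hα1, Complex.one_re]
    rwa [h2] at h1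
  obtain ⟨ψ, hψx, hψs⟩ := exists_smooth_local_inverse hxs (by rw [hxd.deriv]; exact one_ne_zero)
  have hxt : x t₀ = L (z - z) := by rw [hx]; simp only [hbz]
  have hψ0 : ψ (L (z - z)) = t₀ := by rw [← hxt]; exact hψx.self_of_nhds
  set τ : ℂ → ℝ := fun u => ψ (L (u - z)) with hτ
  have hτz : τ z = t₀ := hψ0
  have hLc : Tendsto (fun u => L (u - z)) (𝓝 z) (𝓝 (x t₀)) := by
    rw [hxt]
    exact (L.continuous.comp (continuous_id.sub continuous_const)).tendsto z
  have hτs : ∀ᶠ u in 𝓝 z, ContDiffAt ℝ ∞ τ u := by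
    filter_upwards [hLc.eventually hψs] with u hu
    exact hu.comp u (L.contDiff.contDiffAt.comp u (contDiffAt_id.sub contDiffAt_const))
  have hτc : Tendsto τ (𝓝 z) (𝓝 t₀) := by
    have := hτs.self_of_nhds.continuousAt
    rwa [ContinuousAt, hτz] at this
  -- The remaining displacement. The arcs now share point and velocity, so `d` vanishes to first
  -- order and `u ↦ u + d (τ u)` is tangent to the identity.
  set d : ℝ → ℂ := fun t => α (s₀ + (t - t₀)) - b t with hd
  have hshift : Tendsto (fun t => s₀ + (t - t₀)) (𝓝 t₀) (𝓝 s₀) := by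
    have : Continuous fun t => s₀ + (t - t₀) := by fun_prop
    exact this.tendsto' _ _ (by ring)
  have hds : ∀ᶠ t in 𝓝 t₀, ContDiffAt ℝ ∞ d t := by
    filter_upwards [hshift.eventually hα, hbs] with t h1 h2
    refine ContDiffAt.sub (h1.comp t ?_) h2
    exact contDiffAt_const.add (contDiffAt_id.sub contDiffAt_const)
  have hdd : HasDerivAt d 0 t₀ := by
    have h1 : HasDerivAt α v (s₀ + (t₀ - t₀)) := by
      rw [sub_self, add_zero]
      exact (hα.self_of_nhds.differentiableAt (by simp)).hasDerivAt
    have h2 : HasDerivAt (fun t => s₀ + (t - t₀)) 1 t₀ :=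
      ((hasDerivAt_id t₀).sub_const t₀).const_add s₀
    have := (h1.scomp t₀ h2).sub hbd
    convert! this using 1
    rw [one_smul, sub_self]
  obtain ⟨φ₃, hφ₃, hφ₃z⟩ := exists_isSupportedDiffeo_tangent_id hΩz (q := fun u => d (τ u))
    (by
      filter_upwards [hτc.eventually hds, hτs] with u h1 h2
      exact h1.comp u h2)
    (by
      rw [hτz, hd]
      simp only [hbz, sub_self, add_zero]
      rw [hz, sub_self])
    (by
      have h1 : HasFDerivAt (fun u => d (τ u)) _ z :=
        (hτz.symm ▸ hdd : HasDerivAt d 0 (τ z)).hasFDerivAt.comp z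
          (hτs.self_of_nhds.differentiableAt (by simp)).hasFDerivAt
      rw [h1.fderiv]
      ext u
      simp)
  refine ⟨(φ₁.trans φ₂).trans φ₃, (hφ₁.trans hφ₂).trans hφ₃, ?_⟩
  have hβ₁c : Tendsto β₁ (𝓝 t₀) (𝓝 z) := by
    have := hβ₁s.self_of_nhds.continuousAt
    rwa [ContinuousAt, hβ₁z] at this
  have hbc : Tendsto b (𝓝 t₀) (𝓝 z) := by
    have := hbs.self_of_nhds.continuousAt
    rwa [ContinuousAt, hbz] at this
  filter_upwards [hβ₁c.eventually hφ₂z, hbc.eventually hφ₃z, hψx] with t h1 h2 h3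
  rw [Homeomorph.trans_apply, Homeomorph.trans_apply]
  change φ₃ (φ₂ (β₁ t)) = _
  rw [h1]
  change φ₃ (b t) = _
  have h4 : τ (b t) = t := h3
  rw [h2, h4, hd]
  ring

/-! ### Transporting a transformation by a diffeomorphism -/

namespace RSphere

theorem coord_eq_inv_coord_inversion (z : RSphere) : coord z = (coord (inversion z))⁻¹ := by
  induction z using OnePoint.rec with
  | infty => simp [coord, inversion]
  | coe z =>
    by_cases hz : z = 0
    · subst hz; simp [coord, inversion]
    · rw [inversion_coe hz, coord_coe, coord_coe, inv_inv]

theorem coe_coord {z : RSphere} (hz : z ≠ OnePoint.infty) : (coord z : RSphere) = z := by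
  obtain ⟨a, rfl⟩ := OnePoint.ne_infty_iff_exists.1 hz
  rfl

theorem continuousAt_coord {z : RSphere} (hz : z ≠ OnePoint.infty) : ContinuousAt coord z := by
  obtain ⟨a, rfl⟩ := OnePoint.ne_infty_iff_exists.1 hz
  rw [OnePoint.continuousAt_coe]
  exact continuousAt_id

/-- At a finite point a smooth curve is smooth in the coordinate `z`. -/
theorem IsSmoothRegularOn.coord_of_ne_infty {γ : ℝ → RSphere} {a b t : ℝ}
    (h : IsSmoothRegularOn γ a b) (hab : a < b) (ht : t ∈ Icc a b) (hγ : γ t ≠ OnePoint.infty) :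
    ContDiffWithinAt ℝ ∞ (fun s => coord (γ s)) (Icc a b) t ∧
      derivWithin (fun s => coord (γ s)) (Icc a b) t ≠ 0 := by
  rcases h t ht with ⟨-, h1, h2⟩ | ⟨h0, h1, h2⟩
  · exact ⟨h1, h2⟩
  have hw : coord (inversion (γ t)) ≠ 0 := by
    intro hw
    have h3 := coord_eq_inv_coord_inversion (γ t)
    rw [hw, inv_zero] at h3
    apply h0
    rw [← coe_coord hγ, h3]
  have heq : (fun s => coord (γ s)) = fun s => (coord (inversion (γ s)))⁻¹ :=
    funext fun s => coord_eq_inv_coord_inversion _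
  rw [heq]
  refine ⟨h1.inv hw, ?_⟩
  have hd : HasDerivWithinAt (fun s => (coord (inversion (γ s)))⁻¹)
      (-(derivWithin (fun s => coord (inversion (γ s))) (Icc a b) t) /
        coord (inversion (γ t)) ^ 2) (Icc a b) t :=
    (h1.differentiableWithinAt (by simp)).hasDerivWithinAt.fun_inv hw
  rw [hd.derivWithin (uniqueDiffOn_Icc hab t ht)]
  exact div_ne_zero (neg_ne_zero.2 h2) (pow_ne_zero _ hw)

theorem chordal_self (z : RSphere) : chordal z z = 0 := by
  induction z using OnePoint.rec <;> simp [chordal]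

theorem chordal_coe_le (a b : ℂ) : chordal (a : RSphere) (b : RSphere) ≤ 2 * ‖a - b‖ := by
  change 2 * ‖a - b‖ / (Real.sqrt (1 + ‖a‖ ^ 2) * Real.sqrt (1 + ‖b‖ ^ 2)) ≤ _
  have h : ∀ c : ℂ, 1 ≤ Real.sqrt (1 + ‖c‖ ^ 2) := fun c => by
    rw [Real.one_le_sqrt]; nlinarith [sq_nonneg ‖c‖]
  exact div_le_self (by positivity) (one_le_mul_of_one_le_of_one_le (h a) (h b))

theorem hausdorffClose_refl {ε : ℝ} (hε : 0 < ε) (A : Set RSphere) : HausdorffClose ε A A :=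
  ⟨fun a ha => ⟨a, ha, by rwa [chordal_self]⟩, fun a ha => ⟨a, ha, by rwa [chordal_self]⟩⟩

theorem subdivision_mem {m : ℕ} {t : ℕ → ℝ} (h0 : t 0 = 0) (hm : t m = 1)
    (h : ∀ i < m, t i < t (i + 1)) {i : ℕ} (hi : i ≤ m) : t i ∈ Icc (0 : ℝ) 1 := by
  have hmono : ∀ j k, j ≤ k → k ≤ m → t j ≤ t k := by
    intro j k hjk
    induction k, hjk using Nat.le_induction with
    | base => intro _; exact le_rfl
    | succ k _ ih => intro hk; exact (ih (by omega)).trans (h k (by omega)).le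
  exact ⟨h0 ▸ hmono 0 i (Nat.zero_le i) hi, hm ▸ hmono i m hi le_rfl⟩

end RSphere

namespace IsSupportedDiffeo

variable {Ω : Set ℂ} {φ : ℂ ≃ₜ ℂ}

theorem onePointCongr_coe (φ : ℂ ≃ₜ ℂ) (z : ℂ) : φ.onePointCongr (z : RSphere) = (φ z : RSphere) :=
  rfl

theorem onePointCongr_infty (φ : ℂ ≃ₜ ℂ) :
    φ.onePointCongr (OnePoint.infty : RSphere) = OnePoint.infty :=
  rfl

/-- The support is a compact subset of `Ω`, so its complement is open and contains even the boundary
of `Ω` and infinity. -/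
theorem eventually_onePointCongr_eq (h : IsSupportedDiffeo Ω φ) {z : RSphere}
    (hz : z ∉ ((↑) '' Ω : Set RSphere)) : ∀ᶠ x in 𝓝 z, φ.onePointCongr x = x := by
  obtain ⟨S, hS, hSc, hSφ⟩ := h.exists_support
  have ho : IsOpen ((↑) '' S : Set RSphere)ᶜ :=
    OnePoint.isOpen_compl_image_coe.2 ⟨hSc.isClosed, hSc⟩
  filter_upwards [ho.mem_nhds fun h' => hz (image_mono hS h')] with x hx
  induction x using OnePoint.rec with
  | infty => rfl
  | coe x =>
    rw [onePointCongr_coe, hSφ]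
    exact fun h' => hx (mem_image_of_mem _ h')

/-- A moved point and its image both lie in a ball of radius `ε / 4`, hence less than `ε / 2` apart;
the chordal distance is at most twice the Euclidean one. -/
theorem chordal_lt (h : IsSupportedDiffeo Ω φ) {c : ℂ} {ε : ℝ} (hε : 0 < ε)
    (hΩ : Ω ⊆ Metric.ball c (ε / 4)) (z : RSphere) : chordal z (φ.onePointCongr z) < ε := by
  obtain ⟨S, hS, -, hSφ⟩ := h.exists_support
  induction z using OnePoint.rec with
  | infty => rwa [onePointCongr_infty, chordal_self]
  | coe z =>
    rw [onePointCongr_coe]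
    by_cases hz : z ∈ S
    · have hz' : φ z ∈ S := by
        by_contra h'
        have := φ.injective (hSφ _ h')
        rw [this] at h'
        exact h' hz
      have h1 := Metric.mem_ball.1 (hΩ (hS hz))
      have h2 := Metric.mem_ball.1 (hΩ (hS hz'))
      have h3 := dist_triangle_right z (φ z) c
      have h4 := chordal_coe_le z (φ z)
      rw [← dist_eq_norm] at h4
      linarith
    · rwa [hSφ z hz, chordal_self]

/-- Near infinity `φ` is the identity; at finite points the coordinate `z` may be used, in which `φ`
has injective derivative. -/
theorem isSmoothRegularOn (h : IsSupportedDiffeo Ω φ) {γ : ℝ → RSphere} {a b : ℝ} (hab : a < b)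
    (hγc : ContinuousOn γ (Icc a b)) (hγ : IsSmoothRegularOn γ a b) :
    IsSmoothRegularOn (fun s => φ.onePointCongr (γ s)) a b := by
  intro t ht
  by_cases hi : γ t = OnePoint.infty
  · right
    have hev : (fun s => coord (inversion (φ.onePointCongr (γ s)))) =ᶠ[𝓝[Icc a b] t]
        fun s => coord (inversion (γ s)) := by
      have h1 : ∀ᶠ x in 𝓝 (γ t), φ.onePointCongr x = x :=
        h.eventually_onePointCongr_eq (by rw [hi]; simp)
      filter_upwards [(hγc t ht).eventually h1] with s hs
      rw [hs]
    rcases hγ t ht with ⟨h0, -⟩ | ⟨h0, h1, h2⟩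
    · exact absurd hi h0
    · refine ⟨?_, h1.congr_of_eventuallyEq_of_mem hev ht, ?_⟩
      · beta_reduce; rw [hi, onePointCongr_infty]; exact OnePoint.infty_ne_coe _
      · rwa [hev.derivWithin_eq_of_mem ht]
  · left
    obtain ⟨h1, h2⟩ := hγ.coord_of_ne_infty hab ht hi
    have hev : (fun s => coord (φ.onePointCongr (γ s))) =ᶠ[𝓝[Icc a b] t]
        fun s => φ (coord (γ s)) := by
      have h3 : ∀ᶠ x in 𝓝 (γ t), x ≠ OnePoint.infty := isOpen_ne.mem_nhds hi
      filter_upwards [(hγc t ht).eventually h3] with s hs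
      obtain ⟨x, hx⟩ := OnePoint.ne_infty_iff_exists.1 hs
      rw [← hx, onePointCongr_coe, coord_coe, coord_coe]
    refine ⟨?_, ?_, ?_⟩
    · obtain ⟨x, hx⟩ := OnePoint.ne_infty_iff_exists.1 hi
      beta_reduce
      rw [← hx, onePointCongr_coe]
      exact OnePoint.coe_ne_infty _
    · exact (h.contDiff.contDiffAt.comp_contDiffWithinAt t h1).congr_of_eventuallyEq_of_mem hev ht
    · rw [hev.derivWithin_eq_of_mem ht]
      have h3 : HasDerivWithinAt (fun s => φ (coord (γ s)))
          (fderiv ℝ φ (coord (γ t)) (derivWithin (fun s => coord (γ s)) (Icc a b) t))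
          (Icc a b) t :=
        (h.differentiable _).hasFDerivAt.comp_hasDerivWithinAt t
          (h1.differentiableWithinAt (by simp)).hasDerivWithinAt
      rw [h3.derivWithin (uniqueDiffOn_Icc hab t ht)]
      intro h4
      exact h2 (h.injective_fderiv _ (h4.trans (map_zero _).symm))

theorem isPiecewiseSmoothSimpleClosedCurve (h : IsSupportedDiffeo Ω φ) {C : Set RSphere}
    (hC : IsPiecewiseSmoothSimpleClosedCurve C) :
    IsPiecewiseSmoothSimpleClosedCurve (φ.onePointCongr '' C) := by
  obtain ⟨γ, hγc, hγ01, hγi, rfl, m, t, ht0, htm, ht⟩ := hC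
  refine ⟨fun s => φ.onePointCongr (γ s), φ.onePointCongr.continuous.comp_continuousOn hγc,
    congrArg _ hγ01, φ.onePointCongr.injective.comp_injOn hγi, by rw [← image_comp]; rfl,
    m, t, ht0, htm, fun i hi => ⟨(ht i hi).1, h.isSmoothRegularOn (ht i hi).1 (hγc.mono ?_)
      (ht i hi).2⟩⟩
  have hlt := fun i hi => (ht i hi).1
  exact Icc_subset_Icc (subdivision_mem ht0 htm hlt hi.le).1
    (subdivision_mem ht0 htm hlt (Nat.succ_le_of_lt hi)).2

end IsSupportedDiffeo

namespace PMT

variable {K : ℕ}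

/-- The transformation with the same branches whose regions are moved by a diffeomorphism. -/
def transport (F : PMT K) {Ω : Set ℂ} {φ : ℂ ≃ₜ ℂ} (h : IsSupportedDiffeo Ω φ) : PMT K where
  R k := φ.onePointCongr '' F.R k
  f := F.f
  isOpen_R k := φ.onePointCongr.isOpenMap _ (F.isOpen_R k)
  isConnected_R k := (F.isConnected_R k).image _ φ.onePointCongr.continuous.continuousOn
  frontier_R k := by
    obtain ⟨𝒞, h1, h2, h3⟩ := F.frontier_R k
    refine ⟨(fun C => φ.onePointCongr '' C) '' 𝒞, h1.image _, ?_, ?_⟩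
    · rintro _ ⟨C, hC, rfl⟩
      exact h.isPiecewiseSmoothSimpleClosedCurve (h2 C hC)
    · rw [← φ.onePointCongr.image_frontier, h3, image_sUnion]
  disjoint_R j k hjk :=
    (disjoint_image_iff φ.onePointCongr.injective).2 (F.disjoint_R j k hjk)
  cover_R := by
    simp_rw [← φ.onePointCongr.image_closure, ← image_iUnion, F.cover_R]
    exact image_univ_of_surjective φ.onePointCongr.surjective
  minimal j k hjk harc := by
    refine F.minimal j k hjk ?_
    obtain ⟨γ, h1, h2, h3⟩ := harc
    refine ⟨fun s => φ.onePointCongr.symm (γ s),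
      φ.onePointCongr.symm.continuous.comp_continuousOn h1,
      φ.onePointCongr.symm.injective.comp_injOn h2, ?_⟩
    rintro _ ⟨s, hs, rfl⟩
    change φ.onePointCongr.symm (γ s) ∈ _
    have := h3 (mem_image_of_mem _ hs)
    rw [← φ.onePointCongr.image_closure, ← φ.onePointCongr.image_closure,
      ← image_inter φ.onePointCongr.injective] at this
    obtain ⟨y, hy, hy'⟩ := this
    rw [← hy', Homeomorph.symm_apply_apply]
    exact hy

variable (F : PMT K) {Ω : Set ℂ} {φ : ℂ ≃ₜ ℂ} (h : IsSupportedDiffeo Ω φ)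

theorem transport_R (k : Fin K) : (F.transport h).R k = φ.onePointCongr '' F.R k := rfl

theorem transport_f : (F.transport h).f = F.f := rfl

theorem frontier_transport_R (k : Fin K) :
    frontier ((F.transport h).R k) = φ.onePointCongr '' frontier (F.R k) :=
  (φ.onePointCongr.image_frontier _).symm

theorem disc_transport : (F.transport h).disc = φ.onePointCongr '' F.disc := by
  change (⋃ k, frontier ((F.transport h).R k)) = φ.onePointCongr '' ⋃ k, frontier (F.R k)
  rw [image_iUnion]
  exact iUnion_congr fun k => F.frontier_transport_R h k

theorem hausdorffClose_image {c : ℂ} {ε : ℝ} (h : IsSupportedDiffeo Ω φ) (hε : 0 < ε)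
    (hΩ : Ω ⊆ Metric.ball c (ε / 4)) (A : Set RSphere) :
    HausdorffClose ε A (φ.onePointCongr '' A) := by
  refine ⟨fun a ha => ⟨_, mem_image_of_mem _ ha, h.chordal_lt hε hΩ a⟩, ?_⟩
  rintro _ ⟨a, ha, rfl⟩
  exact ⟨a, ha, h.chordal_lt hε hΩ a⟩

end PMT

/-! ### Smooth points of the boundaries of the regions -/

namespace RSphere

/-- Near the finite point `γ t₀` the set `A` is the smooth regular arc `γ`. -/
structure IsSmoothPointOf (A : Set RSphere) (γ : ℝ → RSphere) (t₀ : ℝ) : Prop where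
  continuousAt : ContinuousAt γ t₀
  ne_infty : γ t₀ ≠ OnePoint.infty
  contDiffAt : ∀ᶠ t in 𝓝 t₀, ContDiffAt ℝ ∞ (fun s => coord (γ s)) t
  deriv_ne_zero : deriv (fun s => coord (γ s)) t₀ ≠ 0
  eventually_mem : ∀ᶠ t in 𝓝 t₀, γ t ∈ A
  exists_subset : ∀ δ > 0, ∃ W, IsOpen W ∧ γ t₀ ∈ W ∧ W ∩ A ⊆ γ '' Ioo (t₀ - δ) (t₀ + δ)

theorem IsSmoothPointOf.of_inter_subset {A B O : Set RSphere} {γ : ℝ → RSphere} {t₀ : ℝ}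
    (h : IsSmoothPointOf A γ t₀) (hO : IsOpen O) (hγ : γ t₀ ∈ O) (hAB : A ⊆ B)
    (hBA : O ∩ B ⊆ A) : IsSmoothPointOf B γ t₀ where
  continuousAt := h.continuousAt
  ne_infty := h.ne_infty
  contDiffAt := h.contDiffAt
  deriv_ne_zero := h.deriv_ne_zero
  eventually_mem := h.eventually_mem.mono fun _ ht => hAB ht
  exists_subset δ hδ := by
    obtain ⟨W, h1, h2, h3⟩ := h.exists_subset δ hδ
    exact ⟨W ∩ O, h1.inter hO, ⟨h2, hγ⟩, fun x hx => h3 ⟨hx.1.1, hBA ⟨hx.1.2, hx.2⟩⟩⟩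

theorem exists_mem_Icc_subdivision {t : ℕ → ℝ} {s : ℝ} (h0 : t 0 ≤ s) {m : ℕ} (hm : s < t m) :
    ∃ i < m, s ∈ Ico (t i) (t (i + 1)) := by
  induction m with
  | zero => exact absurd hm h0.not_gt
  | succ m ih =>
    by_cases h : s < t m
    · obtain ⟨i, hi, h⟩ := ih h
      exact ⟨i, by omega, h⟩
    · exact ⟨m, by omega, not_lt.1 h, hm⟩

theorem IsPiecewiseSmoothSimpleClosedCurve.isClosed {C : Set RSphere}
    (hC : IsPiecewiseSmoothSimpleClosedCurve C) : IsClosed C := by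
  obtain ⟨γ, hγc, -, -, rfl, -⟩ := hC
  exact (isCompact_Icc.image_of_continuousOn hγc).isClosed

/-- A piecewise smooth simple closed curve has smooth points in any open set that it meets. -/
theorem IsPiecewiseSmoothSimpleClosedCurve.exists_isSmoothPointOf {C O E : Set RSphere}
    (hC : IsPiecewiseSmoothSimpleClosedCurve C) (hO : IsOpen O) (hOC : (O ∩ C).Nonempty)
    (hE : E.Finite) : ∃ γ t₀, γ t₀ ∈ O ∧ γ t₀ ∉ E ∧ IsSmoothPointOf C γ t₀ := by
  obtain ⟨γ, hγc, hγ01, hγi, rfl, m, t, ht0, htm, ht⟩ := hC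
  obtain ⟨_, hsO, s, hs, rfl⟩ := hOC
  have hV : IsOpen (Ioo (0 : ℝ) 1 ∩ γ ⁻¹' O) :=
    (hγc.mono Ioo_subset_Icc_self).isOpen_inter_preimage isOpen_Ioo hO
  have hVne : (Ioo (0 : ℝ) 1 ∩ γ ⁻¹' O).Nonempty := by
    have hcl : s ∈ closure (Ioo (0 : ℝ) 1) := by rwa [closure_Ioo zero_ne_one]
    have := mem_closure_iff_nhdsWithin_neBot.1 hcl
    have h1 : ∀ᶠ x in 𝓝[Ioo 0 1] s, γ x ∈ O :=
      ((hγc s hs).mono Ioo_subset_Icc_self).eventually_mem (hO.mem_nhds hsO)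
    obtain ⟨x, hx, hx'⟩ := (h1.and self_mem_nhdsWithin).exists
    exact ⟨x, hx', hx⟩
  obtain ⟨x, hx⟩ := hVne
  have hinf : (Ioo (0 : ℝ) 1 ∩ γ ⁻¹' O).Infinite := infinite_of_mem_nhds x (hV.mem_nhds hx)
  have hfin1 : (t '' Iic m).Finite := (finite_Iic m).image t
  have hfin2 : (Ioo (0 : ℝ) 1 ∩ γ ⁻¹' (insert OnePoint.infty E)).Finite :=
    .of_injOn (f := γ) (fun _ h => h.2) (hγi.mono fun _ h => Ioo_subset_Ico_self h.1)
      (hE.insert OnePoint.infty)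
  -- Only finitely many parameters are nodes of the subdivision or are sent to infinity or into `E`.
  obtain ⟨t₀, ⟨ht₀, ht₀O⟩, ht₀'⟩ := (hinf.sdiff (hfin1.union hfin2)).nonempty
  have hne : ∀ i ≤ m, t i ≠ t₀ := fun i hi h => ht₀' (Or.inl ⟨i, hi, h⟩)
  have hγE : γ t₀ ∉ insert OnePoint.infty E := fun h => ht₀' (Or.inr ⟨ht₀, h⟩)
  obtain ⟨i, hi, hti⟩ := exists_mem_Icc_subdivision (t := t) (ht0.trans_le ht₀.1.le)
    (ht₀.2.trans_eq htm.symm)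
  have hti' : t₀ ∈ Ioo (t i) (t (i + 1)) := ⟨lt_of_le_of_ne hti.1 (hne i hi.le), hti.2⟩
  have hcont : ContinuousAt γ t₀ := hγc.continuousAt (Icc_mem_nhds ht₀.1 ht₀.2)
  have hne_infty : γ t₀ ≠ OnePoint.infty := fun h => hγE (Or.inl h)
  refine ⟨γ, t₀, ht₀O, fun h => hγE (Or.inr h), hcont, hne_infty, ?_, ?_, ?_, ?_⟩
  · filter_upwards [isOpen_Ioo.mem_nhds hti', hcont.eventually_mem (isOpen_ne.mem_nhds hne_infty)]
      with s hs hs'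
    exact ((ht i hi).2.coord_of_ne_infty (ht i hi).1 (Ioo_subset_Icc_self hs) hs').1.contDiffAt
      (Icc_mem_nhds hs.1 hs.2)
  · have := ((ht i hi).2.coord_of_ne_infty (ht i hi).1 (Ioo_subset_Icc_self hti') hne_infty).2
    rwa [derivWithin_of_mem_nhds (Icc_mem_nhds hti'.1 hti'.2)] at this
  · filter_upwards [Icc_mem_nhds ht₀.1 ht₀.2] with s hs
    exact mem_image_of_mem _ hs
  · intro δ hδ
    -- The rest of the curve is a compact set missing `γ t₀`. Parameter `1` is replaced by `0`, as
    -- injectivity is known on `Ico 0 1` only.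
    have hcpt : IsCompact (γ '' (Icc 0 1 \ Ioo (t₀ - δ) (t₀ + δ))) :=
      (isCompact_Icc.diff isOpen_Ioo).image_of_continuousOn (hγc.mono sdiff_subset)
    refine ⟨_, hcpt.isClosed.isOpen_compl, ?_, ?_⟩
    · rintro ⟨s, ⟨hs, hs'⟩, hst⟩
      have hst₀ : s ≠ t₀ := by
        rintro rfl
        exact hs' ⟨by linarith, by linarith⟩
      rcases hs.2.lt_or_eq with h1 | rfl
      · exact hst₀ (hγi ⟨hs.1, h1⟩ (Ioo_subset_Ico_self ht₀) hst)
      · rw [← hγ01] at hst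
        exact ht₀.1.ne (hγi ⟨le_rfl, one_pos⟩ (Ioo_subset_Ico_self ht₀) hst)
    · rintro _ ⟨hsW, s, hs, rfl⟩
      by_contra h
      exact hsW ⟨s, ⟨hs, fun h' => h ⟨s, h', rfl⟩⟩, rfl⟩

/-- A finite union of closed sets coincides with one of them somewhere in any open set that it
meets. -/
theorem exists_inter_sUnion_subset {X : Type*} [TopologicalSpace X] {𝒞 : Set (Set X)}
    (h𝒞 : 𝒞.Finite) (hcl : ∀ C ∈ 𝒞, IsClosed C) {O : Set X} (hO : IsOpen O)
    (h : (O ∩ ⋃₀ 𝒞).Nonempty) :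
    ∃ C ∈ 𝒞, ∃ O' ⊆ O, IsOpen O' ∧ (O' ∩ C).Nonempty ∧ O' ∩ ⋃₀ 𝒞 ⊆ C := by
  induction 𝒞, h𝒞 using Set.Finite.induction_on generalizing O with
  | empty => simp at h
  | @insert C 𝒞 _ _ ih =>
    have hC := hcl C (mem_insert _ _)
    by_cases h' : ((O \ C) ∩ ⋃₀ 𝒞).Nonempty
    · obtain ⟨D, hD, O', h1, h2, h3, h4⟩ :=
        ih (fun D hD => hcl D (mem_insert_of_mem _ hD)) (hO.sdiff hC) h'
      refine ⟨D, mem_insert_of_mem _ hD, O', h1.trans sdiff_subset, h2, h3, ?_⟩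
      rw [sUnion_insert]
      rintro x ⟨hx, hx' | hx'⟩
      · exact absurd hx' (h1 hx).2
      · exact h4 ⟨hx, hx'⟩
    · have hsub : O ∩ ⋃₀ insert C 𝒞 ⊆ C := by
        rw [sUnion_insert]
        rintro x ⟨hx, hx' | hx'⟩
        · exact hx'
        · by_contra hxC
          exact h' ⟨x, ⟨hx, hxC⟩, hx'⟩
      obtain ⟨x, hx⟩ := h
      exact ⟨C, mem_insert _ _, O, Subset.rfl, hO, ⟨x, hx.1, hsub hx⟩, hsub⟩

end RSphere

theorem PMT.exists_isSmoothPointOf {K : ℕ} (F : PMT K) (k : Fin K) {O E : Set RSphere}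
    (hO : IsOpen O) (h : (O ∩ frontier (F.R k)).Nonempty) (hE : E.Finite) :
    ∃ γ t₀, γ t₀ ∈ O ∧ γ t₀ ∉ E ∧ IsSmoothPointOf (frontier (F.R k)) γ t₀ := by
  obtain ⟨𝒞, hfin, hC, heq⟩ := F.frontier_R k
  rw [heq] at h ⊢
  obtain ⟨C, hC', O', h1, h2, h3, h4⟩ :=
    exists_inter_sUnion_subset hfin (fun C h => (hC C h).isClosed) hO h
  obtain ⟨γ, t₀, h5, h6, h7⟩ := (hC C hC').exists_isSmoothPointOf h2 h3 hE
  exact ⟨γ, t₀, h1 h5, h6, h7.of_inter_subset h2 h5 (subset_sUnion_of_mem hC') h4⟩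

/-- A disc with finitely many points removed is connected. -/
theorem isPreconnected_ball_diff_finite (c : ℂ) (r : ℝ) {E : Set ℂ} (hE : E.Finite) :
    IsPreconnected (Metric.ball c r \ E) := by
  rcases le_or_gt r 0 with hr | hr
  · rw [Metric.ball_eq_empty.2 hr, empty_sdiff]
    exact isPreconnected_empty
  -- The disc is homeomorphic to the plane, where complements of countable sets are connected.
  let e := OpenPartialHomeomorph.univBall c r
  have hsrc : e.source = univ := OpenPartialHomeomorph.univBall_source c r
  have htgt : e.target = Metric.ball c r := OpenPartialHomeomorph.univBall_target c hr
  have hfin : (e ⁻¹' E).Finite :=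
    hE.preimage ((e.injOn).mono (by rw [hsrc]; exact subset_univ _))
  have hconn := (hfin.countable.isConnected_compl_of_one_lt_rank
    (by rw [Complex.rank_real_complex]; norm_num)).isPreconnected
  have himg : e '' (e ⁻¹' E)ᶜ = Metric.ball c r \ E := by
    ext x
    constructor
    · rintro ⟨y, hy, rfl⟩
      exact ⟨htgt ▸ e.map_source (hsrc ▸ mem_univ y), hy⟩
    · rintro ⟨hx, hxE⟩
      rw [← htgt] at hx
      refine ⟨e.symm x, ?_, e.right_inv hx⟩
      rw [mem_compl_iff, mem_preimage, e.right_inv hx]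
      exact hxE
  rw [← himg]
  exact hconn.image _ (e.continuousOn.mono (by rw [hsrc]; exact subset_univ _))

/-! ### Boundary returns after small perturbations of the regions -/

namespace RSphere

/-- Möbius transformations preserve smooth regular arcs. -/
theorem contDiffAt_coord_mobius {g : PSL(2, ℂ)} {γ : ℝ → RSphere} {s₀ : ℝ}
    (hγ : ContinuousAt γ s₀) (hne : γ s₀ ≠ OnePoint.infty)
    (hsm : ∀ᶠ s in 𝓝 s₀, ContDiffAt ℝ ∞ (fun s => coord (γ s)) s)
    (hd : deriv (fun s => coord (γ s)) s₀ ≠ 0) (hg : mobius g (γ s₀) ≠ OnePoint.infty) :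
    (∀ᶠ s in 𝓝 s₀, ContDiffAt ℝ ∞ (fun s => coord (mobius g (γ s))) s) ∧
      deriv (fun s => coord (mobius g (γ s))) s₀ ≠ 0 := by
  obtain ⟨A, rfl⟩ := QuotientGroup.mk_surjective g
  set u : ℝ → ℂ := fun s => coord (γ s) with hu
  have hden : A 1 0 * u s₀ + A 1 1 ≠ 0 := by
    intro h
    apply hg
    rw [← coe_coord hne]
    exact (mobius_mk_coe A _).trans (if_pos h)
  have hcu : ContinuousAt u s₀ := (continuousAt_coord hne).comp hγ
  have hev : ∀ᶠ s in 𝓝 s₀, A 1 0 * u s + A 1 1 ≠ 0 :=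
    ((hcu.const_mul _).add_const _).eventually_ne hden
  have heq : ∀ᶠ s in 𝓝 s₀, coord (mobius (A : PSL(2, ℂ)) (γ s)) =
      (A 0 0 * u s + A 0 1) / (A 1 0 * u s + A 1 1) := by
    filter_upwards [hev, hγ.eventually_ne hne] with s hs hs'
    rw [← coe_coord hs', mobius_mk_coe_of_ne hs, coord_coe]
  refine ⟨?_, ?_⟩
  · filter_upwards [heq.eventually_nhds, hev, hsm] with s h1 h2 h3
    refine ContDiffAt.congr_of_eventuallyEq ?_ h1
    have h4 : ∀ p q : ℂ, ContDiffAt ℝ ∞ (fun s => p * u s + q) s := fun p q =>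
      (contDiffAt_const.mul h3).add contDiffAt_const
    simp_rw [div_eq_mul_inv]
    exact (h4 _ _).mul ((h4 _ _).inv h2)
  · have h1 : HasDerivAt u (deriv u s₀) s₀ :=
      (hsm.self_of_nhds.differentiableAt (by simp)).hasDerivAt
    have h2 := ((h1.const_mul (A 0 0)).add_const (A 0 1)).fun_div
      ((h1.const_mul (A 1 0)).add_const (A 1 1)) hden
    have heq' : (fun s => coord (mobius (A : PSL(2, ℂ)) (γ s))) =ᶠ[𝓝 s₀]
        fun s => (A 0 0 * u s + A 0 1) / (A 1 0 * u s + A 1 1) := heq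
    rw [heq'.deriv_eq, h2.deriv]
    refine div_ne_zero ?_ (pow_ne_zero _ hden)
    have h3 : A 0 0 * deriv u s₀ * (A 1 0 * u s₀ + A 1 1) -
        (A 0 0 * u s₀ + A 0 1) * (A 1 0 * deriv u s₀) = deriv u s₀ := by
      linear_combination deriv u s₀ * det_eq A
    rw [h3]
    exact hd

end RSphere

namespace PMT

variable {K : ℕ} {F : PMT K}

/-- At time `0` the moved arc lies on the moved boundary by construction. At times `1` to `n` its
orbit lies where `φ` is the identity, so regions and discontinuity set there are those of `F`. -/
theorem hasBoundaryReturn_transport {Ω : Set ℂ} {φ : ℂ ≃ₜ ℂ} (h : IsSupportedDiffeo Ω φ)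
    {w : ℕ → Fin K} {n : ℕ} (hn : 0 < n) {γ : ℝ → RSphere} {t₀ : ℝ}
    (hγ : IsSmoothPointOf (frontier (F.R (w 0))) γ t₀)
    (hit : F.Itinerary w n (φ.onePointCongr (γ t₀)))
    (horb : ∀ i ∈ Finset.Icc 1 n,
      mobius (compAlong F.f w i) (φ.onePointCongr (γ t₀)) ∉ ((↑) '' Ω : Set RSphere))
    (hdisc : ∀ᶠ t in 𝓝 t₀, mobius (compAlong F.f w n) (φ.onePointCongr (γ t)) ∈ F.disc) :
    (F.transport h).HasBoundaryReturn := by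
  have hcont : ContinuousAt (fun t => φ.onePointCongr (γ t)) t₀ :=
    φ.onePointCongr.continuous.continuousAt.comp hγ.continuousAt
  have hfix : ∀ᶠ x in 𝓝 (φ.onePointCongr (γ t₀)), ∀ i ∈ Finset.Icc 1 n,
      φ.onePointCongr (mobius (compAlong F.f w i) x) = mobius (compAlong F.f w i) x := by
    rw [Filter.eventually_all_finset]
    exact fun i hi => (continuous_mobius _).continuousAt.eventually
      (h.eventually_onePointCongr_eq (horb i hi))
  obtain ⟨δ, hδ, hδ'⟩ := Metric.eventually_nhds_iff_ball.1
    ((hcont.eventually (hit.eventually.and hfix)).and hdisc)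
  rw [Real.ball_eq_Ioo] at hδ'
  obtain ⟨W, hW, hγW, hWγ⟩ := hγ.exists_subset δ hδ
  refine ⟨w, n, hn, φ.onePointCongr '' W, φ.onePointCongr.isOpenMap _ hW, ?_, ?_⟩
  · rw [frontier_transport_R]
    exact ⟨_, mem_image_of_mem _ hγW, mem_image_of_mem _ hγ.eventually_mem.self_of_nhds⟩
  · rintro x ⟨hxW, hxR⟩
    have hx0 : x ∈ closure ((F.transport h).R (w 0)) := frontier_subset_closure hxR
    rw [frontier_transport_R] at hxR
    obtain ⟨y, hy⟩ : x ∈ φ.onePointCongr '' (W ∩ frontier (F.R (w 0))) := by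
      rw [image_inter φ.onePointCongr.injective]
      exact ⟨hxW, hxR⟩
    obtain ⟨t, ht, rfl⟩ := hWγ hy.1
    obtain ⟨⟨h1, h2⟩, h3⟩ := hδ' t ht
    rw [hy.2] at h1 h2 h3
    refine ⟨fun i hi => ?_, ?_⟩
    · rcases Nat.eq_zero_or_pos i with rfl | hi0
      · simpa [compAlong, mobius_one] using hx0
      · refine subset_closure ?_
        rw [transport_R, transport_f, ← h2 i (Finset.mem_Icc.2 ⟨hi0, hi.le⟩)]
        exact mem_image_of_mem _ (h1 i hi)
    · rw [disc_transport, transport_f, ← h2 n (Finset.mem_Icc.2 ⟨hn, le_rfl⟩)]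
      exact mem_image_of_mem _ h3

/-- A point of the conformality region that reaches the discontinuity set does not return to
itself before. -/
theorem Itinerary.compAlong_ne_self {w : ℕ → Fin K} {n : ℕ} {z : RSphere}
    (h : F.Itinerary w n z) (hz : mobius (compAlong F.f w n) z ∈ F.disc) {i : ℕ} (hi : 0 < i)
    (hin : i ≤ n) : mobius (compAlong F.f w i) z ≠ z := by
  intro heq
  rw [← h.map_iterate hin] at heq
  have hper : Function.IsPeriodicPt F.map i z := heq
  rw [← h.map_iterate le_rfl, ← hper.iterate_mod_apply n] at hz
  have := h.mem_dom (n % i) ((Nat.mod_lt n hi).trans_le hin)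
  rw [conf_eq_compl_disc] at this
  exact this hz

/-- Density of the preimages provides, in a small disc around a boundary point `b`, a point of a
region whose orbit reaches the discontinuity set. The boundary of that region also crosses the disc,
and an arc of it can be pushed onto the pull-back of the boundary arc that is reached. -/
theorem exists_transport_hasBoundaryReturn (hreg : F.regularSet = ∅) {ε : ℝ} (hε : 0 < ε) :
    ∃ (b : ℂ) (Ω : Set ℂ) (φ : ℂ ≃ₜ ℂ) (h : IsSupportedDiffeo Ω φ),
      Ω ⊆ Metric.ball b (ε / 4) ∧ (F.transport h).HasBoundaryReturn := by
  have hdense : Dense (⋃ n, F.preDisc n) := by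
    rw [dense_iff_closure_eq]
    exact compl_empty_iff.1 hreg
  obtain ⟨b, hb⟩ : ∃ b : ℂ, (b : RSphere) ∈ F.disc := by
    obtain ⟨x, hx⟩ := hdense.nonempty
    obtain ⟨n, -, hx⟩ := mem_iUnion.1 hx
    obtain ⟨k, hk⟩ := mem_iUnion.1 hx
    obtain ⟨γ, t₀, -, -, hγ⟩ := F.exists_isSmoothPointOf k isOpen_univ ⟨_, mem_univ _, hk⟩
      finite_empty
    refine ⟨coord (γ t₀), ?_⟩
    rw [coe_coord hγ.ne_infty]
    exact mem_iUnion.2 ⟨k, hγ.eventually_mem.self_of_nhds⟩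
  set D : Set ℂ := Metric.ball b (ε / 4) with hD
  have hbD : b ∈ D := Metric.mem_ball_self (by positivity)
  have hDs : IsOpen ((↑) '' D : Set RSphere) :=
    OnePoint.isOpenEmbedding_coe.isOpenMap _ Metric.isOpen_ball
  have hDconf : (((↑) '' D : Set RSphere) ∩ F.conf).Nonempty := by
    by_contra hcon
    have hsub : ((↑) '' D : Set RSphere) ⊆ F.disc := by
      intro x hx
      by_contra hx'
      refine hcon ⟨x, hx, ?_⟩
      rwa [conf_eq_compl_disc]
    have := interior_maximal hsub hDs (mem_image_of_mem _ hbD)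
    rw [interior_disc] at this
    exact this
  obtain ⟨z, ⟨hzD, hzc⟩, hz⟩ := hdense.inter_open_nonempty _ (hDs.inter F.isOpen_conf) hDconf
  obtain ⟨n, hzdom, hzn⟩ := mem_iUnion.1 hz
  have hn : 0 < n := by
    rcases Nat.eq_zero_or_pos n with rfl | h
    · rw [conf_eq_compl_disc] at hzc
      exact absurd hzn hzc
    · exact h
  obtain ⟨w, hw⟩ := exists_itinerary hzdom
  rw [hw.map_iterate le_rfl] at hzn
  obtain ⟨l, hl⟩ := mem_iUnion.1 hzn
  set g := compAlong F.f w n with hg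
  have hN : IsOpen (((↑) '' D : Set RSphere) ∩ {x | F.Itinerary w n x}) :=
    hDs.inter (isOpen_setOf_itinerary w n)
  -- The target is moved to a nearby smooth boundary point; its preimage `z'` stays in `D` and keeps
  -- the itinerary.
  obtain ⟨α, s₀, ⟨hαD, hαit⟩, -, hα⟩ := F.exists_isSmoothPointOf l
    (hN.preimage (continuous_mobius g⁻¹)) ⟨_, ⟨by
      rw [mem_preimage, mobius_inv_apply]
      exact ⟨hzD, hw⟩, hl⟩⟩ finite_empty
  set z' := mobius g⁻¹ (α s₀) with hz'
  have hαl := hα.eventually_mem.self_of_nhds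
  have hz'ne : z' ≠ OnePoint.infty := by
    obtain ⟨x, -, hx⟩ := hαD
    rw [← hx]
    exact OnePoint.coe_ne_infty x
  have hz'disc : mobius g z' ∈ F.disc := by
    rw [hz', mobius_apply_inv]
    exact mem_iUnion.2 ⟨l, hαl⟩
  have hfin : ((fun i => mobius (compAlong F.f w i) z') '' (Finset.Icc 1 n : Set ℕ)).Finite :=
    (Finset.finite_toSet _).image _
  -- The later orbit of `z'` must not be disturbed, so it is removed from the support; the punctured
  -- disc is still connected.
  set Z := (fun i => mobius (compAlong F.f w i) z') '' (Finset.Icc 1 n : Set ℕ) with hZ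
  have hz'Z : z' ∉ Z := by
    rintro ⟨i, hi, heq⟩
    rw [Finset.mem_coe, Finset.mem_Icc] at hi
    exact hαit.compAlong_ne_self hz'disc hi.1 hi.2 heq
  have hz'R : z' ∈ F.R (w 0) := by
    have := hαit 0 hn
    rwa [compAlong, mobius_one] at this
  have hbR : (b : RSphere) ∉ F.R (w 0) := by
    intro h
    have : (b : RSphere) ∈ F.conf := mem_iUnion.2 ⟨_, h⟩
    rw [conf_eq_compl_disc] at this
    exact this hb
  have hDpre : IsPreconnected ((↑) '' D : Set RSphere) :=
    (convex_ball b _).isPreconnected.image _ OnePoint.continuous_coe.continuousOn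
  -- The connected set `D` contains `z'` in the region and `b` outside it.
  have hDfr : (((↑) '' D : Set RSphere) ∩ frontier (F.R (w 0))).Nonempty := by
    by_contra hcon
    refine hbR (hDpre.subset_of_closure_inter_subset (F.isOpen_R _) ⟨z', hαD, hz'R⟩ ?_
      (mem_image_of_mem _ hbD))
    rintro x ⟨hx, hxD⟩
    by_contra hxR
    refine hcon ⟨x, hxD, ?_⟩
    rw [(F.isOpen_R _).frontier_eq]
    exact ⟨hx, hxR⟩
  obtain ⟨γ, t₀, hγD, hγZ, hγ⟩ := F.exists_isSmoothPointOf (w 0) hDs hDfr hfin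
  have hfin' : ((↑) ⁻¹' Z : Set ℂ).Finite := hfin.preimage OnePoint.coe_injective.injOn
  have hmem : ∀ x : RSphere, x ∈ ((↑) '' D : Set RSphere) → x ∉ Z →
      coord x ∈ D \ ((↑) ⁻¹' Z : Set ℂ) := by
    rintro _ ⟨x, hx, rfl⟩ hxZ
    exact ⟨hx, hxZ⟩
  obtain ⟨hα1, hα2⟩ := contDiffAt_coord_mobius (g := g⁻¹) hα.continuousAt hα.ne_infty
    hα.contDiffAt hα.deriv_ne_zero hz'ne
  obtain ⟨φ, hφ, hφγ⟩ := exists_isSupportedDiffeo_arc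
    (Metric.isOpen_ball.sdiff hfin'.isClosed) (isPreconnected_ball_diff_finite b (ε / 4) hfin')
    hα1 hα2 (hmem _ hαD hz'Z) hγ.contDiffAt hγ.deriv_ne_zero (hmem _ hγD hγZ)
  have hshift : Tendsto (fun t => s₀ + (t - t₀)) (𝓝 t₀) (𝓝 s₀) := by
    have : Continuous fun t : ℝ => s₀ + (t - t₀) := by fun_prop
    simpa using this.tendsto t₀
  have hφγ' : ∀ᶠ t in 𝓝 t₀, φ.onePointCongr (γ t) = mobius g⁻¹ (α (s₀ + (t - t₀))) := by
    have h1 : ContinuousAt (fun s => mobius g⁻¹ (α s)) s₀ :=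
      (continuous_mobius _).continuousAt.comp hα.continuousAt
    filter_upwards [hφγ, hγ.continuousAt.eventually_ne hγ.ne_infty,
      hshift.eventually (h1.eventually_ne hz'ne)] with t h2 h3 h4
    rw [← coe_coord h3, IsSupportedDiffeo.onePointCongr_coe, h2, coe_coord h4]
  have hφz : φ.onePointCongr (γ t₀) = z' := by
    have := hφγ'.self_of_nhds
    rwa [sub_self, add_zero] at this
  refine ⟨b, _, φ, hφ, sdiff_subset, hasBoundaryReturn_transport hφ hn hγ ?_ ?_ ?_⟩
  · rw [hφz]
    exact hαit
  · rw [hφz]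
    rintro i hi ⟨x, hx, hxi⟩
    exact hx.2 ⟨i, hi, hxi.symm⟩
  · filter_upwards [hφγ', hshift.eventually hα.eventually_mem] with t h1 h2
    rw [h1, mobius_apply_inv]
    exact mem_iUnion.2 ⟨l, h2⟩

end PMT

/-! ### The theorem -/

theorem mainTheorem4 {K : ℕ} (F : PMT K) (hstable : F.IsStructurallyStable)
    (hwand : F.HasNoWanderingComponents) : F.IsHyperbolic := by
  obtain ⟨𝒩, h𝒩, ε, hε, hconj⟩ := hstable
  obtain ⟨G, hGR, hGf, hG⟩ := F.exists_isGeneric h𝒩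
  have hFG : PMT.IsConj F G := by
    have hd : G.disc = F.disc := by rw [PMT.disc, PMT.disc, hGR]
    refine hconj G hGf ?_ fun k => ?_
    · rw [hd]
      exact hausdorffClose_refl hε _
    · rw [hGR]
      exact hausdorffClose_refl hε _
  obtain ⟨h, σ, H⟩ := hFG.exists_isConjBy
  have hreg : F.regularSet.Nonempty := by
    by_contra hreg
    obtain ⟨b, Ω, φ, hφ, hΩ, hret⟩ :=
      PMT.exists_transport_hasBoundaryReturn (not_nonempty_iff_eq_empty.1 hreg) hε
    have hFT : PMT.IsConj F (F.transport hφ) := by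
      refine hconj _ (mem_of_mem_nhds h𝒩) ?_ fun k => ?_
      · rw [PMT.disc_transport]
        exact PMT.hausdorffClose_image hφ hε hΩ _
      · rw [PMT.transport_R, ← φ.onePointCongr.image_closure]
        exact PMT.hausdorffClose_image hφ hε hΩ _
    obtain ⟨_, _, H'⟩ := hFT.symm.exists_isConjBy
    -- The boundary return passes from the transported transformation to `F` and on to `G`.
    exact hG.not_hasBoundaryReturn (H.hasBoundaryReturn (H'.hasBoundaryReturn hret))
  exact ⟨PMT.perAttr_nonempty_of_isConj hFG hG hreg hwand, PMT.perNeu_eq_empty_of_isConjBy H hG,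
    PMT.perGhost_eq_empty_of_isConjBy H hG, hwand⟩

end
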